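/- Let $H$ be a complex Hilbert space and $\Delta$ a strictly positive operator on $H$, i.e. a (possibly unbounded) self-adjoint operator with $\langle v,\Delta v\rangle\ge c\|v\|^2$ on its domain for some $c>0$. Let $r\ge 2$ be an integer and let $H^\infty=\bigcap_{n}\operatorname{dom}(\Delta^n)$. Let $\mathcal D$ be a twisted algebra of differential operators (DOs) associated to $\Delta$: an (not necessarily unital) algebra of linear operators $H^\infty\to H^\infty$ with an increasing exhaustive filtration $\mathcal D=\bigcup_{m\in\mathbb N}\mathcal D^m$ by linear subspaces, $\mathcal D^m\mathcal D^n\subseteq\mathcal D^{m+n}$, together with a linear automorphism $\theta$ of $\mathcal D$ satisfying $\theta(\mathcal D^m)=\mathcal D^m$, such that (i) $\Delta X-\theta^r(X)\Delta\in\mathcal D^{m+r-1}$ for all $X\in\mathcal D^m$; (ii) for each $X\in\mathcal D^m$ there is $C>0$ with $\|Xv\|\le C\|\Delta^{m/r}v\|$ for all $v\in H^\infty$. Assume that $\theta$ is diagonalizable, i.e. $\mathcal D$ is the algebraic direct sum of the eigenspaces of $\theta$. Let $\rho$ be a closed, possibly unbounded operator on $H$ with core $H^\infty$ which restricts to a bijection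 of $H^\infty$ onto itself, and suppose that $\sigma(X):=\rho X\rho^{-1}$ lies in $\mathcal D$ for every $X\in\mathcal D$. Suppose that for all $X\in\mathcal D$: - $\rho X\Delta^{-z/r}$ is (i.e. extends from $H^\infty$ to) a trace class operator on $H$ for all $z\in\mathbb C$ with sufficiently large real part; - $\zeta_X(z)=\operatorname{Tr}(\rho X\Delta^{-z/r})$, defined for $\operatorname{Re}z$ large, extends to a meromorphic function on $\mathbb C$ with only simple poles. Then $\Phi(X)=\operatorname{Res}_{z=0}\zeta_X(z)$, the residue at $0$ of the meromorphic extension, defines a linear functional $\Phi:\mathcal D\to\mathbb C$ which is a $\sigma$-twisted trace: $\Phi(XY)=\Phi(Y\sigma(X))$ for all $X,Y\in\mathcal D$. -/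

import Mathlib

open scoped InnerProductSpace Topology

noncomputable section

/-- A strictly positive (self-adjoint, bounded below by a positive constant), possibly unbounded
operator on a Hilbert space: an abstract Laplace operator. -/
structure AbstractLaplacian (H : Type*) [NormedAddCommGroup H] [InnerProductSpace ℂ H]
    [CompleteSpace H] where
  op : H →ₗ.[ℂ] H
  selfAdjoint : IsSelfAdjoint op
  strictlyPositive : ∃ c : ℝ, 0 < c ∧ ∀ v : op.domain, c * ‖(v : H)‖ ^ 2 ≤ (⟪(v : H), op v⟫_ℂ).re

namespace AbstractLaplacian

variable {H : Type*} [NormedAddCommGroup H] [InnerProductSpace ℂ H] [CompleteSpace H]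
variable (Δ : AbstractLaplacian H)

theorem exists_lower_bound :
    ∃ c : ℝ, 0 < c ∧ ∀ v : Δ.op.domain, c * ‖(v : H)‖ ≤ ‖Δ.op v‖ := by
  obtain ⟨c, hc, h⟩ := Δ.strictlyPositive
  refine ⟨c, hc, fun v => ?_⟩
  rcases eq_or_lt_of_le (norm_nonneg (v : H)) with h0 | h0
  · rw [← h0]; simp
  · have h1 := h v
    have h2 : (⟪(v : H), Δ.op v⟫_ℂ).re ≤ ‖(v : H)‖ * ‖Δ.op v‖ :=
      (Complex.re_le_norm _).trans (norm_inner_le_norm _ _)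
    have h3 : ‖(v : H)‖ * (c * ‖(v : H)‖) ≤ ‖(v : H)‖ * ‖Δ.op v‖ := by nlinarith
    exact le_of_mul_le_mul_left h3 h0

theorem inner_op_left (v w : Δ.op.domain) :
    ⟪Δ.op v, (w : H)⟫_ℂ = ⟪(v : H), Δ.op w⟫_ℂ := by
  have hd := Δ.selfAdjoint.dense_domain
  have h : Δ.op.IsFormalAdjoint Δ.op := by
    have h1 := LinearPMap.adjoint_isFormalAdjoint (T := Δ.op) hd
    have h2 : Δ.op.adjoint = Δ.op := LinearPMap.isSelfAdjoint_def.mp Δ.selfAdjoint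
    rwa [h2] at h1
  exact h v w

theorem op_injective : Function.Injective Δ.op.toFun := by
  obtain ⟨c, hc, h⟩ := Δ.exists_lower_bound
  rw [← LinearMap.ker_eq_bot, LinearMap.ker_eq_bot']
  intro v hv
  have h1 := h v
  have h2 : Δ.op v = 0 := hv
  rw [h2, norm_zero] at h1
  have h3 : ‖(v : H)‖ ≤ 0 := by
    by_contra h4
    push Not at h4
    have := mul_pos hc h4
    linarith
  exact Subtype.ext (norm_le_zero_iff.mp h3)

theorem isClosed_range : IsClosed (Set.range Δ.op.toFun) := by
  obtain ⟨c, hc, h⟩ := Δ.exists_lower_bound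
  have hcl : IsClosed (Δ.op.graph : Set (H × H)) := IsSelfAdjoint.isClosed Δ.selfAdjoint
  have : CompleteSpace Δ.op.graph := hcl.completeSpace_coe
  let f : Δ.op.graph → H := fun p => p.1.2
  have hf : AntilipschitzWith (max (Real.toNNReal c⁻¹) 1) f := by
    refine AntilipschitzWith.of_le_mul_dist fun p q => ?_
    have hpq : p.1 - q.1 ∈ Δ.op.graph := Δ.op.graph.sub_mem p.2 q.2
    obtain ⟨v, hv1, hv2⟩ := (LinearPMap.mem_graph_iff Δ.op).mp hpq
    have hv := h v
    rw [hv1, hv2] at hv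
    have hv' : ‖(p.1 - q.1).1‖ ≤ c⁻¹ * ‖(p.1 - q.1).2‖ := by
      rw [inv_mul_eq_div, le_div_iff₀ hc]; linarith
    have hd : dist p q = max ‖(p.1 - q.1).1‖ ‖(p.1 - q.1).2‖ := by
      rw [Subtype.dist_eq, dist_eq_norm, Prod.norm_def]
    have hd2 : dist (f p) (f q) = ‖(p.1 - q.1).2‖ := by
      rw [dist_eq_norm]; rfl
    rw [hd, hd2]
    have hn := norm_nonneg (p.1 - q.1).2
    push_cast
    refine max_le ?_ ?_
    · refine hv'.trans (mul_le_mul_of_nonneg_right ?_ hn)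
      exact (Real.le_coe_toNNReal _).trans (le_max_left _ _)
    · calc ‖(p.1 - q.1).2‖ = 1 * ‖(p.1 - q.1).2‖ := (one_mul _).symm
        _ ≤ _ := mul_le_mul_of_nonneg_right (le_max_right _ _) hn
  have hu : UniformContinuous f :=
    uniformContinuous_snd.comp uniformContinuous_subtype_val
  have hr : Set.range Δ.op.toFun = Set.range f := by
    ext y
    constructor
    · rintro ⟨v, rfl⟩
      exact ⟨⟨((v : H), Δ.op v), Δ.op.mem_graph v⟩, rfl⟩
    · rintro ⟨p, rfl⟩
      obtain ⟨v, -, hv2⟩ := (LinearPMap.mem_graph_iff Δ.op).mp p.2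
      exact ⟨v, hv2⟩
  rw [hr]
  exact hf.isClosed_range hu

theorem op_surjective : Function.Surjective Δ.op.toFun := by
  have hcl : IsClosed ((LinearMap.range Δ.op.toFun : Submodule ℂ H) : Set H) := by
    have := Δ.isClosed_range
    rwa [← LinearMap.coe_range] at this
  have : CompleteSpace (LinearMap.range Δ.op.toFun : Submodule ℂ H) := hcl.completeSpace_coe
  rw [← LinearMap.range_eq_top, ← Submodule.orthogonal_eq_bot_iff, Submodule.eq_bot_iff]
  intro w hw
  have hw' : ∀ v : Δ.op.domain, ⟪(0 : H), (v : H)⟫_ℂ = ⟪w, Δ.op v⟫_ℂ := by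
    intro v
    rw [inner_zero_left]
    exact ((Submodule.mem_orthogonal' _ _).mp hw _ ⟨v, rfl⟩).symm
  have hd := Δ.selfAdjoint.dense_domain
  have hmem : w ∈ Δ.op.adjoint.domain := LinearPMap.mem_adjoint_domain_of_exists w ⟨0, hw'⟩
  have hval : Δ.op.adjoint ⟨w, hmem⟩ = 0 := LinearPMap.adjoint_apply_eq hd ⟨w, hmem⟩ hw'
  have hgr : (w, (0 : H)) ∈ Δ.op.adjoint.graph := by
    have := Δ.op.adjoint.mem_graph ⟨w, hmem⟩
    rwa [hval] at this
  have h2 : Δ.op.adjoint = Δ.op := LinearPMap.isSelfAdjoint_def.mp Δ.selfAdjoint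
  rw [h2] at hgr
  obtain ⟨v, hv1, hv2⟩ := (LinearPMap.mem_graph_iff Δ.op).mp hgr
  have hv0 : v = 0 := Δ.op_injective (by
    show Δ.op v = Δ.op 0
    rw [hv2, LinearPMap.map_zero])
  have hv1' : (v : H) = w := hv1
  rw [← hv1', hv0]; rfl

/-- `Δ` as a linear bijection from its domain onto `H`. -/
def opEquiv : Δ.op.domain ≃ₗ[ℂ] H :=
  LinearEquiv.ofBijective Δ.op.toFun ⟨Δ.op_injective, Δ.op_surjective⟩

theorem op_opEquiv_symm (x : H) : Δ.op (Δ.opEquiv.symm x) = x :=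
  Δ.opEquiv.apply_symm_apply x

theorem opEquiv_symm_op (v : Δ.op.domain) : Δ.opEquiv.symm (Δ.op v) = v :=
  Δ.opEquiv.symm_apply_apply v

theorem exists_inv_bound : ∃ C : ℝ, ∀ x : H, ‖(Δ.opEquiv.symm x : H)‖ ≤ C * ‖x‖ := by
  obtain ⟨c, hc, h⟩ := Δ.exists_lower_bound
  refine ⟨c⁻¹, fun x => ?_⟩
  have h1 := h (Δ.opEquiv.symm x)
  rw [op_opEquiv_symm] at h1
  rw [inv_mul_eq_div, le_div_iff₀ hc]
  linarith

/-- The bounded inverse `Δ⁻¹` on `H`. -/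
def inv : H →L[ℂ] H :=
  LinearMap.mkContinuousOfExistsBound (Δ.op.domain.subtype ∘ₗ Δ.opEquiv.symm.toLinearMap)
    Δ.exists_inv_bound

theorem inv_apply (x : H) : Δ.inv x = (Δ.opEquiv.symm x : H) := rfl

theorem inv_isSelfAdjoint : IsSelfAdjoint Δ.inv := by
  rw [ContinuousLinearMap.isSelfAdjoint_iff_isSymmetric]
  intro x y
  have h := Δ.inner_op_left (Δ.opEquiv.symm x) (Δ.opEquiv.symm y)
  rw [op_opEquiv_symm, op_opEquiv_symm] at h
  exact h.symm

/-- The domain of `Δ ^ n`. -/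
def domPow : ℕ → Submodule ℂ H
  | 0 => ⊤
  | n + 1 => ((domPow n).comap Δ.op.toFun).map Δ.op.domain.subtype

theorem mem_domPow_succ (n : ℕ) (v : H) :
    v ∈ Δ.domPow (n + 1) ↔ ∃ h : v ∈ Δ.op.domain, Δ.op ⟨v, h⟩ ∈ Δ.domPow n := by
  constructor
  · rintro ⟨w, hw, rfl⟩
    exact ⟨w.2, hw⟩
  · rintro ⟨h, hv⟩
    exact ⟨⟨v, h⟩, hv, rfl⟩

/-- The space `H^∞` of smooth vectors: the common domain of all powers of `Δ`. -/
def smooth : Submodule ℂ H := ⨅ n : ℕ, Δ.domPow n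

theorem mem_smooth (v : H) : v ∈ Δ.smooth ↔ ∀ n, v ∈ Δ.domPow n := Submodule.mem_iInf _

theorem smooth_le_domain : Δ.smooth ≤ Δ.op.domain := fun v hv =>
  ((Δ.mem_domPow_succ 0 v).mp ((Δ.mem_smooth v).mp hv 1)).1

theorem op_mem_smooth (v : Δ.smooth) : Δ.op ⟨v, Δ.smooth_le_domain v.2⟩ ∈ Δ.smooth := by
  rw [mem_smooth]
  intro n
  exact ((Δ.mem_domPow_succ n v).mp ((Δ.mem_smooth v).mp v.2 (n + 1))).2

/-- `Δ` as a linear operator on `H^∞`. -/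
def onSmooth : Module.End ℂ Δ.smooth :=
  LinearMap.codRestrict Δ.smooth (Δ.op.toFun ∘ₗ Submodule.inclusion Δ.smooth_le_domain)
    Δ.op_mem_smooth

/-- The bounded operator `Δ^{-w}` on `H`, for `0 < Re w`: the continuous function `x ↦ x ^ w`
(with value `0` at `0`) applied to the bounded positive operator `Δ⁻¹`. -/
def negPow (w : ℂ) : H →L[ℂ] H := cfc (fun x : ℂ => x ^ w) Δ.inv

theorem negPow_mem_smooth (w : ℂ) (v : Δ.smooth) : Δ.negPow w (v : H) ∈ Δ.smooth := by
  have : IsStarNormal Δ.inv := Δ.inv_isSelfAdjoint.isStarNormal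
  have hc : ∀ x : H, Δ.negPow w (Δ.inv x) = Δ.inv (Δ.negPow w x) := by
    have h : Commute (cfc (fun x : ℂ => x ^ w) Δ.inv) (cfc (fun x : ℂ => x) Δ.inv) :=
      cfc_commute_cfc _ _ _
    rw [cfc_id' ℂ Δ.inv] at h
    intro x
    exact congrArg (fun T : H →L[ℂ] H => T x) h.eq
  have key : ∀ (n : ℕ) (x : H), x ∈ Δ.domPow n → Δ.negPow w x ∈ Δ.domPow n := by
    intro n
    induction n with
    | zero => intro x _; exact Submodule.mem_top
    | succ n ih =>
      intro x hx
      obtain ⟨h, hx'⟩ := (Δ.mem_domPow_succ n x).mp hx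
      have e : Δ.negPow w x = Δ.inv (Δ.negPow w (Δ.op ⟨x, h⟩)) := by
        rw [← hc, inv_apply, opEquiv_symm_op]
      rw [e, inv_apply, mem_domPow_succ]
      refine ⟨(Δ.opEquiv.symm _).2, ?_⟩
      rw [Subtype.coe_eta, op_opEquiv_symm]
      exact ih _ hx'
  rw [mem_smooth]
  exact fun n => key n _ ((Δ.mem_smooth _).mp v.2 n)

/-- `Δ^{-w}` restricted to `H^∞`, for `0 < Re w`. -/
def negPowOnSmooth (w : ℂ) : Module.End ℂ Δ.smooth :=
  LinearMap.codRestrict Δ.smooth ((Δ.negPow w).toLinearMap ∘ₗ Δ.smooth.subtype)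
    (Δ.negPow_mem_smooth w)

/-- The complex power `Δ^z` on `H^∞`, for every complex `z`, as `Δ^n Δ^{-(n - z)}` with a natural
number `n > Re z`. -/
def cpow (z : ℂ) : Module.End ℂ Δ.smooth :=
  Δ.onSmooth ^ (⌊z.re⌋₊ + 1) * Δ.negPowOnSmooth ((⌊z.re⌋₊ + 1 : ℕ) - z)

end AbstractLaplacian

/-- A twisted algebra of abstract differential operators associated to `Δ`, an abstract Laplace
operator of order `r`. The algebra need not be unital. -/
structure TwistedDOAlgebra {H : Type*} [NormedAddCommGroup H] [InnerProductSpace ℂ H]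
    [CompleteSpace H] (Δ : AbstractLaplacian H) (r : ℕ) where
  /-- the underlying algebra of operators on `H^∞` -/
  alg : NonUnitalSubalgebra ℂ (Module.End ℂ Δ.smooth)
  /-- the pieces of the filtration -/
  filt : ℕ → Submodule ℂ (Module.End ℂ Δ.smooth)
  filt_mono : Monotone filt
  mem_alg_iff : ∀ X, X ∈ alg ↔ ∃ m, X ∈ filt m
  mul_mem_filt : ∀ m n X Y, X ∈ filt m → Y ∈ filt n → X * Y ∈ filt (m + n)
  /-- the twisting, a linear automorphism which preserves the filtration -/
  twist : alg ≃ₗ[ℂ] alg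
  twist_mem_filt_iff : ∀ m (X : alg),
    (twist X : Module.End ℂ Δ.smooth) ∈ filt m ↔ (X : Module.End ℂ Δ.smooth) ∈ filt m
  /-- the twisted commutator `Δ X - θ^r(X) Δ` has order `m + r - 1` when `X` has order `m` -/
  twistedCommutator_mem : ∀ m (X : alg), (X : Module.End ℂ Δ.smooth) ∈ filt m →
    Δ.onSmooth * (X : Module.End ℂ Δ.smooth)
      - ((twist ^ r) X : Module.End ℂ Δ.smooth) * Δ.onSmooth ∈ filt (m + r - 1)
  /-- the elliptic estimate -/
  elliptic : ∀ m, ∀ X ∈ filt m, ∃ C : ℝ, 0 < C ∧ ∀ v : Δ.smooth,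
    ‖(X v : H)‖ ≤ C * ‖(Δ.cpow ((m : ℂ) / (r : ℂ)) v : H)‖

/-- A linear map on a vector space is diagonalizable if the space is the algebraic direct sum of
the eigenspaces of the map. -/
def IsDiagonalizableMap {V : Type*} [AddCommGroup V] [Module ℂ V] (f : V →ₗ[ℂ] V) : Prop :=
  DirectSum.IsInternal fun μ : ℂ => Module.End.eigenspace f μ

/-- A modular operator: a closed, possibly unbounded operator with core `H^∞`, which restricts to
a bijection of `H^∞`, so that conjugation by it makes sense for operators on `H^∞`. -/
structure ModularOperator {H : Type*} [NormedAddCommGroup H] [InnerProductSpace ℂ H]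
    [CompleteSpace H] (Δ : AbstractLaplacian H) where
  op : H →ₗ.[ℂ] H
  isClosed : op.IsClosed
  core : op.HasCore Δ.smooth
  /-- the restriction of the operator to `H^∞` -/
  onSmooth : Δ.smooth ≃ₗ[ℂ] Δ.smooth
  onSmooth_apply : ∀ v : Δ.smooth, (onSmooth v : H) = op ⟨v, core.le_domain v.2⟩

/-- Conjugation by the modular operator, `X ↦ ρ X ρ⁻¹`, on operators on `H^∞`. -/
def ModularOperator.conj {H : Type*} [NormedAddCommGroup H] [InnerProductSpace ℂ H]
    [CompleteSpace H] {Δ : AbstractLaplacian H} (ρ : ModularOperator Δ)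
    (X : Module.End ℂ Δ.smooth) : Module.End ℂ Δ.smooth :=
  ρ.onSmooth.toLinearMap * X * ρ.onSmooth.symm.toLinearMap

section Trace

variable {H : Type*} [NormedAddCommGroup H] [InnerProductSpace ℂ H] [CompleteSpace H]

/-- The index set of a chosen orthonormal basis of `H`. -/
def stdBasisIndex (H : Type*) [NormedAddCommGroup H] [InnerProductSpace ℂ H] [CompleteSpace H] :
    Set H := (exists_hilbertBasis ℂ H).choose

/-- A chosen orthonormal basis of `H`; nothing below depends on the choice. -/
def stdBasis (H : Type*) [NormedAddCommGroup H] [InnerProductSpace ℂ H] [CompleteSpace H] :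
    HilbertBasis (stdBasisIndex H) ℂ H := (exists_hilbertBasis ℂ H).choose_spec.choose

/-- A bounded operator `T` is trace class if `∑ ⟨e, |T| e⟩` converges over an orthonormal basis. -/
def IsTraceClass (T : H →L[ℂ] H) : Prop :=
  Summable fun i => (⟪stdBasis H i, CFC.abs T (stdBasis H i)⟫_ℂ).re

/-- The operator trace. -/
def opTrace (T : H →L[ℂ] H) : ℂ := ∑' i, ⟪stdBasis H i, T (stdBasis H i)⟫_ℂ

variable {Δ : AbstractLaplacian H}

/-- The bounded operator `T` on `H` extends the operator `A` on `H^∞`. -/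
def ExtendsSmooth (T : H →L[ℂ] H) (A : Module.End ℂ Δ.smooth) : Prop :=
  ∀ v : Δ.smooth, T (v : H) = (A v : H)

/-- An operator on `H^∞` is trace class if it extends to a trace class operator on `H`. -/
def IsTraceClassOnSmooth (A : Module.End ℂ Δ.smooth) : Prop :=
  ∃ T : H →L[ℂ] H, ExtendsSmooth T A ∧ IsTraceClass T

open Classical in
/-- The trace of an operator on `H^∞` which extends to a bounded operator on `H`. -/
def smoothTrace (A : Module.End ℂ Δ.smooth) : ℂ :=
  if h : ∃ T : H →L[ℂ] H, ExtendsSmooth T A then opTrace h.choose else 0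

/-- The operator `ρ X Δ^{-z/r}` on `H^∞`. -/
def zetaOperator (r : ℕ) (ρ : ModularOperator Δ) (X : Module.End ℂ Δ.smooth) (z : ℂ) :
    Module.End ℂ Δ.smooth :=
  ρ.onSmooth.toLinearMap * X * Δ.cpow (-z / (r : ℂ))

/-- The zeta function `ζ_X(z) = Tr(ρ X Δ^{-z/r})`, meaningful where the operator is trace class. -/
def zetaFunction (r : ℕ) (ρ : ModularOperator Δ) (X : Module.End ℂ Δ.smooth) (z : ℂ) : ℂ :=
  smoothTrace (zetaOperator r ρ X z)

/-- `Z` is a meromorphic continuation of `ζ_X` to the whole complex plane. -/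
def IsZetaContinuation (r : ℕ) (ρ : ModularOperator Δ) (X : Module.End ℂ Δ.smooth)
    (Z : ℂ → ℂ) : Prop :=
  Meromorphic Z ∧ ∃ x₀ : ℝ, ∀ z : ℂ, x₀ < z.re → Z z = zetaFunction r ρ X z

end Trace

/-- All poles of the (meromorphic) function `f` are simple. -/
def HasOnlySimplePoles (f : ℂ → ℂ) : Prop := ∀ z, (-1 : ℤ) ≤ meromorphicOrderAt f z

/-- `a` is the residue of `f` at `z₀`: the normalized integral over all small circles. -/
def IsResidueAt (f : ℂ → ℂ) (z₀ a : ℂ) : Prop :=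
  ∀ᶠ ε in 𝓝[>] (0 : ℝ), (∮ z in C(z₀, ε), f z) = 2 * (Real.pi : ℂ) * Complex.I * a

end

/-!
Write `X' = ρ X ρ⁻¹`. In the region of convergence, cyclicity of the trace gives

  `Tr (ρ X Y Δ⁻ˢ) = Tr (ρ Y Δ⁻ˢ X')`,

and it remains to move `Δ⁻ˢ` past `X'` without changing the residue at `s = 0`. Complex powers of
`Δ` are integrals of resolvents, and resolvents can be commuted past `X'` by algebra alone. So both
sides are read off from the single function

  `f t = Tr (ρ Y (t + ω Δⁿ)⁻¹ X')`

of `t > 0`, with a large power `n` and a direction `ω = 1 + i y`, through the residue at `s = 0` of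
the meromorphic continuation of `s ∫ t⁻ˢ f t dt` (`HasMellinResidue`).

* Integrating the resolvent first replaces it by a scalar multiple of `Δ⁻ⁿˢ`, and cyclicity
  (`zetaFunction_mul_eq_twisted`) turns the result into `ζ_{XY} (r n s)`, with residue
  `Φ (X Y) / (r n)` (`hasTraceResidue_right`).

* By diagonalizability `X'` may be taken to be an eigenvector of the twist `θ`, with eigenvalue
  `μ`. For `ν = μ ^ (r n)` the operator `T = Δⁿ X' - ν X' Δⁿ` has order one less than expected
  (`onSmooth_pow_mul_sub_mem`), and

    `(t + ω Δⁿ)⁻¹ X' = X' (t + ω ν Δⁿ)⁻¹ - ω (t + ω Δⁿ)⁻¹ T (t + ω ν Δⁿ)⁻¹`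

  (`sandwich_eq`). Treating `T` in the same way, and iterating, gives terms with more and more
  resolvents on the right. The Mellin transform of a product of `k` of these is the scalar
  `s ∫ t⁻ˢ ∏ (t + cᵢ)⁻¹ dt` times a power of `Δ`, and the continuation of this scalar to `s = 0` is
  `1` for `k = 1` but `0` for `k ≥ 2` (`exists_extension_mul_mellin_invProd`). Zeta functions have
  only simple poles, so the terms with `k ≥ 2` have no residue (`hasMellinResidue_resolventProd`).
  The remainder is bounded and `O(t⁻²)` after sufficiently many steps, and has none either
  (`hasMellinResidue_zero_of_bounded`). Only the term `X' (t + ω ν Δⁿ)⁻¹` is left, with residue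
  `Φ (Y X') / (r n)` (`eventually_hasTraceResidue_left`).

The eigenvalues of `θ` are arbitrary nonzero complex numbers, so `t + ν Δⁿ` need not be invertible
for `t > 0`. This is what `ω` is for: finitely many numbers `ν` occur, and all but finitely many
directions `ω` keep every `ω ν` off the negative real axis (`eventually_mul_mem_slitPlane`).

The traces in the expansion all have the form `τ B = Tr (A B)`, with `A` the trace class extension
of `ρ Y Δ⁻ᵃ` for a fixed large `a`, and `B` bounded. The functional `τ` is continuous in the
operator norm (`IsTraceClass.exists_functional`), and so commutes with the integrals; these in turn
are integrals of continuous functions on the spectrum of `Δ⁻¹`, where the estimates are pointwise.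
-/

noncomputable section

/-! ### Hilbert–Schmidt operators and the trace -/

section HilbertSchmidt

variable {H : Type*} [NormedAddCommGroup H] [InnerProductSpace ℂ H] [CompleteSpace H]

/-- Hilbert–Schmidt operators, tested on the chosen orthonormal basis. -/
def IsHilbertSchmidt (T : H →L[ℂ] H) : Prop := Summable fun i => ‖T (stdBasis H i)‖ ^ 2

/-- Parseval's identity. -/
theorem hasSum_norm_sq_inner (x : H) :
    HasSum (fun i => ‖⟪stdBasis H i, x⟫_ℂ‖ ^ 2) (‖x‖ ^ 2) := by
  have h := (stdBasis H).hasSum_inner_mul_inner x x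
  have h2 := Complex.hasSum_re h
  have e : (⟪x, x⟫_ℂ).re = ‖x‖ ^ 2 := by
    rw [inner_self_eq_norm_sq_to_K]; norm_cast
  rw [e] at h2
  convert h2 using 2 with i
  rw [← inner_conj_symm x, ← Complex.normSq_eq_conj_mul_self, Complex.ofReal_re,
    Complex.normSq_eq_norm_sq]

/-- The matrix coefficients of a Hilbert–Schmidt operator are square summable. -/
theorem IsHilbertSchmidt.summable_prod {T : H →L[ℂ] H} (hT : IsHilbertSchmidt T) :
    Summable fun p : stdBasisIndex H × stdBasisIndex H =>
      ‖⟪stdBasis H p.2, T (stdBasis H p.1)⟫_ℂ‖ ^ 2 := by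
  refine (summable_prod_of_nonneg (fun _ => sq_nonneg _)).mpr
    ⟨fun i => (hasSum_norm_sq_inner (T (stdBasis H i))).summable, ?_⟩
  refine Summable.congr hT fun i => ?_
  exact (hasSum_norm_sq_inner (T (stdBasis H i))).tsum_eq.symm

theorem IsHilbertSchmidt.adjoint {T : H →L[ℂ] H} (hT : IsHilbertSchmidt T) :
    IsHilbertSchmidt (star T) := by
  have h := hT.summable_prod.prod_symm
  rw [summable_prod_of_nonneg (fun _ => sq_nonneg _)] at h
  refine h.2.congr fun i => ?_
  rw [← (hasSum_norm_sq_inner (star T (stdBasis H i))).tsum_eq]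
  refine tsum_congr fun j => ?_
  rw [ContinuousLinearMap.star_eq_adjoint, ContinuousLinearMap.adjoint_inner_right,
    ← inner_conj_symm, RCLike.norm_conj]
  rfl

theorem IsHilbertSchmidt.mul_left {T : H →L[ℂ] H} (hT : IsHilbertSchmidt T) (B : H →L[ℂ] H) :
    IsHilbertSchmidt (B * T) := by
  refine Summable.of_nonneg_of_le (fun _ => sq_nonneg _) (fun i => ?_)
    (Summable.mul_left (‖B‖ ^ 2) hT)
  rw [← mul_pow]
  exact pow_le_pow_left₀ (norm_nonneg _) (B.le_opNorm _) 2

theorem IsHilbertSchmidt.mul_right {T : H →L[ℂ] H} (hT : IsHilbertSchmidt T) (B : H →L[ℂ] H) :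
    IsHilbertSchmidt (T * B) := by
  have h := (hT.adjoint.mul_left (star B)).adjoint
  rwa [← star_mul, star_star] at h

theorem summable_mul_of_sq {ι : Type*} {f g : ι → ℝ} (hf : Summable fun i => f i ^ 2)
    (hg : Summable fun i => g i ^ 2) : Summable fun i => f i * g i := by
  refine Summable.of_norm_bounded (hf.add hg) fun i => ?_
  rw [Real.norm_eq_abs, abs_mul]
  nlinarith [sq_nonneg (|f i| - |g i|), sq_abs (f i), sq_abs (g i), sq_nonneg (f i),
    sq_nonneg (g i)]

theorem inner_mul_apply_eq (S T : H →L[ℂ] H) (x : H) :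
    ⟪x, (S * T) x⟫_ℂ = ⟪star S x, T x⟫_ℂ := by
  rw [ContinuousLinearMap.star_eq_adjoint, ContinuousLinearMap.adjoint_inner_left]; rfl

theorem IsHilbertSchmidt.summable_inner_mul {S T : H →L[ℂ] H} (hS : IsHilbertSchmidt S)
    (hT : IsHilbertSchmidt T) :
    Summable fun i => ⟪stdBasis H i, (S * T) (stdBasis H i)⟫_ℂ := by
  refine Summable.of_norm_bounded (summable_mul_of_sq hS.adjoint hT) fun i => ?_
  rw [inner_mul_apply_eq]
  exact norm_inner_le_norm _ _

/-- The trace of a product of two Hilbert–Schmidt operators as a double sum. -/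
theorem opTrace_mul_eq_tsum {S T : H →L[ℂ] H} (hS : IsHilbertSchmidt S)
    (hT : IsHilbertSchmidt T) :
    Summable (fun p : stdBasisIndex H × stdBasisIndex H =>
      ⟪stdBasis H p.1, S (stdBasis H p.2)⟫_ℂ * ⟪stdBasis H p.2, T (stdBasis H p.1)⟫_ℂ) ∧
    opTrace (S * T) = ∑' p : stdBasisIndex H × stdBasisIndex H,
      ⟪stdBasis H p.1, S (stdBasis H p.2)⟫_ℂ * ⟪stdBasis H p.2, T (stdBasis H p.1)⟫_ℂ := by
  have hs : Summable (fun p : stdBasisIndex H × stdBasisIndex H =>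
      ⟪stdBasis H p.1, S (stdBasis H p.2)⟫_ℂ * ⟪stdBasis H p.2, T (stdBasis H p.1)⟫_ℂ) := by
    refine Summable.of_norm ?_
    simp only [norm_mul]
    exact summable_mul_of_sq hS.summable_prod.prod_symm hT.summable_prod
  refine ⟨hs, ?_⟩
  rw [hs.tsum_prod, opTrace]
  refine tsum_congr fun i => ?_
  rw [inner_mul_apply_eq, ← (stdBasis H).tsum_inner_mul_inner]
  refine tsum_congr fun j => ?_
  rw [ContinuousLinearMap.star_eq_adjoint, ContinuousLinearMap.adjoint_inner_left]

/-- For Hilbert–Schmidt operators the cyclicity of the trace is an exchange of the order of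
summation. -/
theorem opTrace_mul_comm_of_isHilbertSchmidt {S T : H →L[ℂ] H} (hS : IsHilbertSchmidt S)
    (hT : IsHilbertSchmidt T) : opTrace (S * T) = opTrace (T * S) := by
  rw [(opTrace_mul_eq_tsum hS hT).2, (opTrace_mul_eq_tsum hT hS).2,
    ← (Equiv.prodComm (stdBasisIndex H) (stdBasisIndex H)).tsum_eq]
  exact tsum_congr fun p => mul_comm _ _

theorem norm_abs_apply (T : H →L[ℂ] H) (x : H) : ‖CFC.abs T x‖ = ‖T x‖ := by
  have h : ∀ A : H →L[ℂ] H, ‖A x‖ ^ 2 = (⟪x, (star A * A) x⟫_ℂ).re := by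
    intro A
    rw [inner_mul_apply_eq, star_star, inner_self_eq_norm_sq_to_K]
    norm_cast
  have h2 : star (CFC.abs T) * CFC.abs T = star T * T := by
    rw [(CFC.abs_nonneg T).isSelfAdjoint.star_eq, CFC.abs_mul_abs]
  have h3 : ‖CFC.abs T x‖ ^ 2 = ‖T x‖ ^ 2 := by rw [h, h, h2]
  exact (pow_left_inj₀ (norm_nonneg _) (norm_nonneg _) two_ne_zero).mp h3

/-- Polar decomposition; only boundedness of the left factor is recorded. It extends
`|T| x ↦ T x`, which is isometric, from the range of `|T|` to its closure, and is `0` on the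
orthogonal complement. -/
theorem exists_eq_mul_abs (T : H →L[ℂ] H) : ∃ U : H →L[ℂ] H, T = U * CFC.abs T := by
  set M : Submodule ℂ H := (LinearMap.range (CFC.abs T).toLinearMap).topologicalClosure with hM
  have hMc : CompleteSpace M := (Submodule.isClosed_topologicalClosure _).completeSpace_coe
  let e : H →ₗ[ℂ] M := LinearMap.codRestrict M (CFC.abs T).toLinearMap
    fun x => Submodule.le_topologicalClosure _ ⟨x, rfl⟩
  have hd : DenseRange e := by
    intro y
    rw [closure_subtype]
    have hy : (y : H) ∈ closure (LinearMap.range (CFC.abs T).toLinearMap : Set H) := y.2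
    convert hy using 2
    ext z
    constructor
    · rintro ⟨_, ⟨x, rfl⟩, rfl⟩
      exact ⟨x, rfl⟩
    · rintro ⟨x, rfl⟩
      exact ⟨e x, ⟨x, rfl⟩, rfl⟩
  let V : M →L[ℂ] H := T.toLinearMap.extendOfNorm e
  have hV : ∀ x, V (e x) = T x := fun x =>
    LinearMap.extendOfNorm_eq hd ⟨1, fun x => by
      rw [one_mul]; exact (norm_abs_apply T x).ge⟩ x
  refine ⟨V ∘L M.orthogonalProjectionOnto, ?_⟩
  ext x
  have : M.orthogonalProjectionOnto (CFC.abs T x) = e x :=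
    Submodule.orthogonalProjectionOnto_mem_subspace_eq_self (e x)
  show T x = V (M.orthogonalProjectionOnto (CFC.abs T x))
  rw [this, hV]

/-- A trace class operator is a product of two Hilbert–Schmidt operators, namely
`T = (U √|T|) √|T|`. -/
theorem IsTraceClass.exists_isHilbertSchmidt {T : H →L[ℂ] H} (hT : IsTraceClass T) :
    ∃ V S : H →L[ℂ] H, IsHilbertSchmidt V ∧ IsHilbertSchmidt S ∧ T = V * S := by
  obtain ⟨U, hU⟩ := exists_eq_mul_abs T
  set S := CFC.sqrt (CFC.abs T)
  have hSS : S * S = CFC.abs T := CFC.sqrt_mul_sqrt_self _ (CFC.abs_nonneg T)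
  have hSs : star S = S := (CFC.sqrt_nonneg _).isSelfAdjoint.star_eq
  have hS : IsHilbertSchmidt S := by
    refine Summable.congr hT fun i => ?_
    rw [← hSS, inner_mul_apply_eq, hSs, inner_self_eq_norm_sq_to_K]
    norm_cast
  exact ⟨U * S, S, hS.mul_left U, hS, by rw [mul_assoc, hSS]; exact hU⟩

/-- A trace class operator `T` defines a continuous linear functional `B ↦ Tr(T B) = Tr(B T)`
on the bounded operators. -/
theorem IsTraceClass.exists_functional {T : H →L[ℂ] H} (hT : IsTraceClass T) :
    ∃ τ : (H →L[ℂ] H) →L[ℂ] ℂ, ∀ B,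
      (Summable fun i => ⟪stdBasis H i, (T * B) (stdBasis H i)⟫_ℂ) ∧
      opTrace (T * B) = τ B ∧ opTrace (B * T) = τ B := by
  obtain ⟨V, S, hV, hS, rfl⟩ := hT.exists_isHilbertSchmidt
  have hsum := summable_mul_of_sq hS.adjoint hV
  have hb : ∀ B : H →L[ℂ] H, ∀ i, ‖⟪star S (stdBasis H i), B (V (stdBasis H i))⟫_ℂ‖
      ≤ ‖B‖ * (‖star S (stdBasis H i)‖ * ‖V (stdBasis H i)‖) := by
    intro B i
    refine (norm_inner_le_norm _ _).trans ?_
    calc _ ≤ ‖star S (stdBasis H i)‖ * (‖B‖ * ‖V (stdBasis H i)‖) := by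
          gcongr; exact B.le_opNorm _
      _ = _ := by ring
  have hs : ∀ B : H →L[ℂ] H, Summable fun i => ⟪star S (stdBasis H i), B (V (stdBasis H i))⟫_ℂ :=
    fun B => Summable.of_norm_bounded (hsum.mul_left _) (hb B)
  let τ : (H →L[ℂ] H) →L[ℂ] ℂ := LinearMap.mkContinuous
    { toFun := fun B => ∑' i, ⟪star S (stdBasis H i), B (V (stdBasis H i))⟫_ℂ
      map_add' := fun B C => by
        rw [← (hs B).tsum_add (hs C)]
        exact tsum_congr fun i => by rw [← inner_add_right]; rfl
      map_smul' := fun c B => by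
        rw [RingHom.id_apply, smul_eq_mul, ← tsum_mul_left]
        exact tsum_congr fun i => by rw [← inner_smul_right]; rfl }
    (∑' i, ‖star S (stdBasis H i)‖ * ‖V (stdBasis H i)‖) (fun B => by
      rw [mul_comm, ← tsum_mul_left]
      exact tsum_of_norm_bounded (hsum.mul_left _).hasSum (hb B))
  have hτ : ∀ B, τ B = opTrace (S * (B * V)) := fun B =>
    tsum_congr fun i => by rw [inner_mul_apply_eq]; rfl
  refine ⟨τ, fun B => ⟨?_, ?_, ?_⟩⟩
  · rw [mul_assoc]
    exact hV.summable_inner_mul (hS.mul_right B)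
  · rw [hτ, mul_assoc, opTrace_mul_comm_of_isHilbertSchmidt hV (hS.mul_right B), mul_assoc]
  · rw [hτ, ← mul_assoc, opTrace_mul_comm_of_isHilbertSchmidt (hV.mul_left B) hS]

end HilbertSchmidt

/-! ### Mellin transforms of products of inverses `(t + c)⁻¹` -/

section MellinCalculus

open MeasureTheory Set Filter Asymptotics

/-- A point off the negative real axis stays at positive distance from it, with a bound that grows
linearly along the axis: minimize `‖θ + (1 - θ) c‖` over `0 ≤ θ ≤ 1`. -/
theorem exists_le_norm_add_of_mem_slitPlane {c : ℂ} (hc : c ∈ Complex.slitPlane) :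
    ∃ δ : ℝ, 0 < δ ∧ ∀ τ : ℝ, 0 ≤ τ → δ * (τ + 1) ≤ ‖(τ : ℂ) + c‖ := by
  have hcont : ContinuousOn (fun θ : ℝ => ‖(θ : ℂ) + (1 - θ) * c‖) (Icc 0 1) := by fun_prop
  obtain ⟨θ₀, hθ₀, hmin⟩ := isCompact_Icc.exists_isMinOn (nonempty_Icc.mpr zero_le_one) hcont
  refine ⟨‖(θ₀ : ℂ) + (1 - θ₀) * c‖, ?_, fun τ hτ => ?_⟩
  · rw [norm_pos_iff]
    intro h0
    rcases eq_or_lt_of_le hθ₀.2 with h1 | h1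
    · rw [h1] at h0; simp at h0
    · have hpos : 0 < 1 - θ₀ := by linarith
      have hc' : c = ((-(θ₀ / (1 - θ₀)) : ℝ) : ℂ) := by
        have : ((1 : ℂ) - θ₀) ≠ 0 := by exact_mod_cast hpos.ne'
        push_cast
        field_simp
        linear_combination h0
      rw [hc', Complex.ofReal_mem_slitPlane] at hc
      have := div_nonneg hθ₀.1 hpos.le
      linarith
  · have hτ1 : 0 < τ + 1 := by linarith
    have hmem : τ / (τ + 1) ∈ Icc (0 : ℝ) 1 :=
      ⟨by positivity, by rw [div_le_one hτ1]; linarith⟩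
    have h := hmin hmem
    simp only [mem_ofPred_eq] at h
    have e : (τ : ℂ) + c = ((τ + 1 : ℝ) : ℂ) *
        (((τ / (τ + 1) : ℝ) : ℂ) + (1 - ((τ / (τ + 1) : ℝ) : ℂ)) * c) := by
      have : ((τ : ℂ) + 1) ≠ 0 := by exact_mod_cast hτ1.ne'
      push_cast
      field_simp
      ring
    rw [e, norm_mul, Complex.norm_real, Real.norm_of_nonneg hτ1.le, mul_comm]
    exact mul_le_mul_of_nonneg_left h hτ1.le

theorem MellinConvergent.continuousLinearMap_comp {E F : Type*} [NormedAddCommGroup E]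
    [NormedSpace ℂ E] [NormedAddCommGroup F] [NormedSpace ℂ F] (L : E →L[ℂ] F) {f : ℝ → E} {s : ℂ}
    (hf : MellinConvergent f s) : MellinConvergent (fun t => L (f t)) s := by
  have := L.integrable_comp hf
  exact this.congr (Eventually.of_forall fun t => by simp)

theorem mellin_continuousLinearMap_comp {E F : Type*} [NormedAddCommGroup E]
    [NormedSpace ℂ E] [CompleteSpace E] [NormedAddCommGroup F] [NormedSpace ℂ F] [CompleteSpace F]
    (L : E →L[ℂ] F) {f : ℝ → E} {s : ℂ}
    (hf : MellinConvergent f s) : mellin (fun t => L (f t)) s = L (mellin f s) := by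
  rw [mellin, mellin, ← L.integral_comp_comm hf]
  simp

/-- The product `∏ (t + c)⁻¹` over a list of complex numbers. -/
def invProd (cs : List ℂ) (t : ℝ) : ℂ := (cs.map fun c => ((t : ℂ) + c)⁻¹).prod

theorem norm_invProd_le {cs : List ℂ} (hcs : ∀ c ∈ cs, c ∈ Complex.slitPlane) :
    ∃ C : ℝ, 0 ≤ C ∧ ∀ τ : ℝ, 0 ≤ τ → ‖invProd cs τ‖ ≤ C * ((τ + 1)⁻¹) ^ cs.length := by
  induction cs with
  | nil => exact ⟨1, zero_le_one, fun τ _ => by simp [invProd]⟩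
  | cons c cs ih =>
    obtain ⟨C, hC, h⟩ := ih fun c hc => hcs c (List.mem_cons_of_mem _ hc)
    obtain ⟨δ, hδ, hd⟩ := exists_le_norm_add_of_mem_slitPlane (hcs c List.mem_cons_self)
    refine ⟨δ⁻¹ * C, by positivity, fun τ hτ => ?_⟩
    have e : invProd (c :: cs) τ = ((τ : ℂ) + c)⁻¹ * invProd cs τ := by simp [invProd]
    have h1 : ‖((τ : ℂ) + c)⁻¹‖ ≤ δ⁻¹ * (τ + 1)⁻¹ := by
      rw [norm_inv, ← mul_inv]
      exact inv_anti₀ (by positivity) (hd τ hτ)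
    rw [e, norm_mul, List.length_cons, pow_succ]
    calc _ ≤ (δ⁻¹ * (τ + 1)⁻¹) * (C * ((τ + 1)⁻¹) ^ cs.length) :=
          mul_le_mul h1 (h τ hτ) (norm_nonneg _) (by positivity)
      _ = _ := by ring

theorem add_ne_zero_of_mem_slitPlane {c : ℂ} (hc : c ∈ Complex.slitPlane) {τ : ℝ} (hτ : 0 ≤ τ) :
    (τ : ℂ) + c ≠ 0 := by
  obtain ⟨δ, hδ, h⟩ := exists_le_norm_add_of_mem_slitPlane hc
  rw [← norm_pos_iff]
  exact lt_of_lt_of_le (by positivity) (h τ hτ)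

theorem continuousOn_invProd {cs : List ℂ} (hcs : ∀ c ∈ cs, c ∈ Complex.slitPlane) :
    ContinuousOn (invProd cs) (Ici 0) := by
  induction cs with
  | nil => simpa [invProd] using! continuousOn_const
  | cons c cs ih =>
    have e : invProd (c :: cs) = fun τ : ℝ => ((τ : ℂ) + c)⁻¹ * invProd cs τ := by
      ext; simp [invProd]
    rw [e]
    refine ContinuousOn.mul (ContinuousOn.inv₀ (by fun_prop) fun τ hτ => ?_)
      (ih fun c hc => hcs c (List.mem_cons_of_mem _ hc))
    exact add_ne_zero_of_mem_slitPlane (hcs c List.mem_cons_self) hτ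

/-- A locally integrable function which is bounded and `O(t ^ (-a))` has a convergent Mellin
transform in the strip `0 < re s < a`. -/
theorem mellinConvergent_of_bounded {E : Type*} [NormedAddCommGroup E] [NormedSpace ℂ E]
    {f : ℝ → E} {a C : ℝ} (hf : ContinuousOn f (Ioi 0)) (h0 : ∀ t, 0 < t → ‖f t‖ ≤ C)
    (h1 : ∀ t, 0 < t → ‖f t‖ ≤ C * t ^ (-a)) {s : ℂ} (hs0 : 0 < s.re) (hs1 : s.re < a) :
    MellinConvergent f s := by
  refine mellinConvergent_of_isBigO_rpow (a := a) (b := 0)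
    (hf.locallyIntegrableOn measurableSet_Ioi) ?_ hs1 ?_ hs0
  · refine IsBigO.of_bound C ?_
    filter_upwards [eventually_gt_atTop 0] with t ht
    rw [Real.norm_of_nonneg (by positivity)]
    exact h1 t ht
  · refine IsBigO.of_bound C ?_
    filter_upwards [self_mem_nhdsWithin] with t ht
    simpa using h0 t ht

theorem differentiableAt_mellin_of_bounded {E : Type*} [NormedAddCommGroup E] [NormedSpace ℂ E]
    {f : ℝ → E} {a C : ℝ} (hf : ContinuousOn f (Ioi 0)) (h0 : ∀ t, 0 < t → ‖f t‖ ≤ C)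
    (h1 : ∀ t, 0 < t → ‖f t‖ ≤ C * t ^ (-a)) {s : ℂ} (hs0 : 0 < s.re) (hs1 : s.re < a) :
    DifferentiableAt ℂ (mellin f) s := by
  refine mellin_differentiableAt_of_isBigO_rpow (a := a) (b := 0)
    (hf.locallyIntegrableOn measurableSet_Ioi) ?_ hs1 ?_ hs0
  · refine IsBigO.of_bound C ?_
    filter_upwards [eventually_gt_atTop 0] with t ht
    rw [Real.norm_of_nonneg (by positivity)]
    exact h1 t ht
  · refine IsBigO.of_bound C ?_
    filter_upwards [self_mem_nhdsWithin] with t ht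
    simpa using h0 t ht

theorem invProd_bounds {cs : List ℂ} (hcs : ∀ c ∈ cs, c ∈ Complex.slitPlane) {k : ℕ}
    (hk : k ≤ cs.length) :
    ∃ C : ℝ, (∀ t : ℝ, 0 < t → ‖invProd cs t‖ ≤ C) ∧
      ∀ t : ℝ, 0 < t → ‖invProd cs t‖ ≤ C * t ^ (-(k : ℝ)) := by
  obtain ⟨C, hC, h⟩ := norm_invProd_le hcs
  refine ⟨C, fun t ht => (h t ht.le).trans ?_, fun t ht => (h t ht.le).trans ?_⟩
  · refine mul_le_of_le_one_right hC (pow_le_one₀ (by positivity) ?_)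
    exact inv_le_one_of_one_le₀ (by linarith)
  · refine mul_le_mul_of_nonneg_left ?_ hC
    rw [Real.rpow_neg ht.le, Real.rpow_natCast, ← inv_pow]
    calc _ ≤ ((t + 1)⁻¹) ^ k := pow_le_pow_of_le_one (by positivity)
          (inv_le_one_of_one_le₀ (by linarith)) hk
      _ ≤ _ := pow_le_pow_left₀ (by positivity) (inv_anti₀ ht (by linarith)) _

theorem hasDerivAt_mul_inv_add {c : ℂ} {t : ℝ} (h : (t : ℂ) + c ≠ 0) :
    HasDerivAt (fun t : ℝ => (t : ℂ) * ((t : ℂ) + c)⁻¹) (c * invProd [c, c] t) t := by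
  have h1 : HasDerivAt (fun t : ℝ => (t : ℂ)) 1 t := Complex.ofRealCLM.hasDerivAt
  have h2 := h1.mul ((h1.add_const c).inv h)
  refine h2.congr_deriv ?_
  simp [invProd]
  field_simp
  ring

/-- Integration by parts continues `s ∫ t ^ (-s) (t + c)⁻¹` across `re s = 0`. -/
theorem mul_mellin_invProd_singleton {c : ℂ} (hc : c ∈ Complex.slitPlane) {s : ℂ}
    (hs0 : 0 < s.re) (hs1 : s.re < 1) :
    s * mellin (invProd [c]) (1 - s) = c * mellin (invProd [c, c]) (1 - s) := by
  obtain ⟨C₁, hC₁, hC₁'⟩ := invProd_bounds (cs := [c]) (k := 1) (by simpa using hc) (by simp)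
  obtain ⟨C₂, hC₂, hC₂'⟩ := invProd_bounds (cs := [c, c]) (k := 2) (by simpa using hc) (by simp)
  have hre : (1 - s).re = 1 - s.re := by simp
  have hI1 : MellinConvergent (invProd [c]) (1 - s) :=
    mellinConvergent_of_bounded
      ((continuousOn_invProd (by simpa using hc)).mono Ioi_subset_Ici_self)
      hC₁ hC₁' (by rw [hre]; linarith) (by rw [hre]; push_cast; linarith)
  have hI2 : MellinConvergent (invProd [c, c]) (1 - s) :=
    mellinConvergent_of_bounded
      ((continuousOn_invProd (by simpa using hc)).mono Ioi_subset_Ici_self)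
      hC₂ hC₂' (by rw [hre]; linarith) (by rw [hre]; push_cast; linarith)
  have hs : s ≠ 0 := fun h => by rw [h] at hs0; simp at hs0
  have hsimp : ∀ t : ℝ, invProd [c] t = ((t : ℂ) + c)⁻¹ := fun t => by simp [invProd]
  have hderiv : ∀ t ∈ Ioi (0 : ℝ), HasDerivAt
      (fun t : ℝ => (t : ℂ) ^ (-s) * ((t : ℂ) * ((t : ℂ) + c)⁻¹))
      ((t : ℂ) ^ (1 - s - 1) • (c * invProd [c, c] t)
        - s * ((t : ℂ) ^ (1 - s - 1) • invProd [c] t)) t := by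
    intro t ht
    have ht' : (0 : ℝ) < t := ht
    have ht0 : (t : ℂ) ≠ 0 := by exact_mod_cast ht'.ne'
    have h1' : HasDerivAt (fun t : ℝ => (t : ℂ) ^ (-s)) (-s * (t : ℂ) ^ (-s - 1)) t :=
      hasDerivAt_ofReal_cpow_const ht'.ne' (neg_ne_zero.mpr hs)
    have h2 := h1'.mul (hasDerivAt_mul_inv_add (add_ne_zero_of_mem_slitPlane hc ht'.le))
    refine h2.congr_deriv ?_
    rw [hsimp, smul_eq_mul, smul_eq_mul, Complex.cpow_sub _ _ ht0, Complex.cpow_one,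
      show (1 - s - 1 : ℂ) = -s by ring]
    field_simp
    ring
  have hint : IntegrableOn (fun t : ℝ => (t : ℂ) ^ (1 - s - 1) • (c * invProd [c, c] t)
      - s * ((t : ℂ) ^ (1 - s - 1) • invProd [c] t)) (Ioi 0) := by
    refine Integrable.sub ?_ (Integrable.const_mul hI1 s)
    refine (Integrable.const_mul hI2 c).congr (Eventually.of_forall fun t => ?_)
    simp only [smul_eq_mul]; ring
  have hnorm : ∀ t : ℝ, 0 < t → ‖(t : ℂ) ^ (-s) * ((t : ℂ) * ((t : ℂ) + c)⁻¹)‖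
      = t ^ (1 - s.re) * ‖invProd [c] t‖ := by
    intro t ht
    rw [norm_mul, norm_mul, Complex.norm_cpow_eq_rpow_re_of_pos ht, Complex.norm_real,
      Real.norm_of_nonneg ht.le, hsimp, Real.rpow_sub ht, Real.rpow_one, Complex.neg_re,
      Real.rpow_neg ht.le]
    field_simp
  have hlim0 : Tendsto (fun t : ℝ => (t : ℂ) ^ (-s) * ((t : ℂ) * ((t : ℂ) + c)⁻¹))
      (𝓝[>] 0) (𝓝 0) := by
    have hz : Tendsto (fun t : ℝ => t ^ (1 - s.re) * C₁) (𝓝[>] 0) (𝓝 0) := by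
      have : ContinuousAt (fun t : ℝ => t ^ (1 - s.re) * C₁) 0 :=
        (Real.continuousAt_rpow_const _ _ (Or.inr (by linarith))).mul continuousAt_const
      have h := this.tendsto
      rw [Real.zero_rpow (by linarith), zero_mul] at h
      exact h.mono_left nhdsWithin_le_nhds
    refine squeeze_zero_norm' ?_ hz
    filter_upwards [self_mem_nhdsWithin] with t ht
    rw [hnorm t ht]
    exact mul_le_mul_of_nonneg_left (hC₁ t ht) (Real.rpow_nonneg (le_of_lt ht) _)
  have hlim1 : Tendsto (fun t : ℝ => (t : ℂ) ^ (-s) * ((t : ℂ) * ((t : ℂ) + c)⁻¹))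
      atTop (𝓝 0) := by
    have hz : Tendsto (fun t : ℝ => C₁ * t ^ (-s.re)) atTop (𝓝 0) := by
      simpa using (tendsto_rpow_neg_atTop hs0).const_mul C₁
    refine squeeze_zero_norm' ?_ hz
    filter_upwards [eventually_gt_atTop 0] with t ht
    rw [hnorm t ht]
    calc _ ≤ t ^ (1 - s.re) * (C₁ * t ^ (-((1 : ℕ) : ℝ))) :=
          mul_le_mul_of_nonneg_left (hC₁' t ht) (Real.rpow_nonneg ht.le _)
      _ = C₁ * (t ^ (1 - s.re) * t ^ (-((1 : ℕ) : ℝ))) := by ring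
      _ = _ := by rw [← Real.rpow_add ht]; congr 2; push_cast; ring
  have hcont : ContinuousWithinAt (fun t : ℝ => (t : ℂ) ^ (-s) * ((t : ℂ) * ((t : ℂ) + c)⁻¹))
      (Ici 0) 0 := by
    rw [← continuousWithinAt_Ioi_iff_Ici]
    simpa [ContinuousWithinAt] using hlim0
  have h := integral_Ioi_of_hasDerivAt_of_tendsto hcont hderiv hint hlim1
  rw [integral_sub] at h
  · rw [integral_const_mul] at h
    have e : ∫ t in Ioi (0 : ℝ), (t : ℂ) ^ (1 - s - 1) • (c * invProd [c, c] t)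
        = c * mellin (invProd [c, c]) (1 - s) := by
      rw [mellin, ← integral_const_mul]
      refine integral_congr_ae (Eventually.of_forall fun t => ?_)
      simp only [smul_eq_mul]; ring
    rw [e] at h
    have h' : c * mellin (invProd [c, c]) (1 - s) - s * mellin (invProd [c]) (1 - s) = 0 := by
      refine h.trans ?_; simp
    linear_combination -h'
  · refine (Integrable.const_mul hI2 c).congr (Eventually.of_forall fun t => ?_)
    simp only [smul_eq_mul]; ring
  · exact Integrable.const_mul hI1 s

/-- The integrand `c (t + c)⁻²` is the derivative of `t (t + c)⁻¹`. -/
theorem mul_mellin_invProd_pair {c : ℂ} (hc : c ∈ Complex.slitPlane) :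
    c * mellin (invProd [c, c]) 1 = 1 := by
  obtain ⟨C₂, hC₂, hC₂'⟩ := invProd_bounds (cs := [c, c]) (k := 2) (by simpa using hc) (by simp)
  have hI2 : MellinConvergent (invProd [c, c]) 1 :=
    mellinConvergent_of_bounded
      ((continuousOn_invProd (by simpa using hc)).mono Ioi_subset_Ici_self)
      hC₂ hC₂' (by simp) (by simp)
  have hI : IntegrableOn (fun t : ℝ => c * invProd [c, c] t) (Ioi 0) := by
    refine (Integrable.const_mul hI2 c).congr (Eventually.of_forall fun t => ?_)
    simp
  have hlim : Tendsto (fun t : ℝ => (t : ℂ) * ((t : ℂ) + c)⁻¹) atTop (𝓝 1) := by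
    have h1 : Tendsto (fun t : ℝ => ((t : ℂ) + c)⁻¹) atTop (𝓝 0) := by
      obtain ⟨C₁, hC₁, hC₁'⟩ := invProd_bounds (cs := [c]) (k := 1) (by simpa using hc) (by simp)
      have hz : Tendsto (fun t : ℝ => C₁ * t ^ (-((1 : ℕ) : ℝ))) atTop (𝓝 0) := by
        simpa using (tendsto_rpow_neg_atTop (y := 1) one_pos).const_mul C₁
      refine squeeze_zero_norm' ?_ hz
      filter_upwards [eventually_gt_atTop 0] with t ht
      simpa [invProd] using hC₁' t ht
    have h2 : Tendsto (fun t : ℝ => 1 - c * ((t : ℂ) + c)⁻¹) atTop (𝓝 1) := by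
      simpa using (h1.const_mul c).const_sub 1
    refine h2.congr' ?_
    filter_upwards [eventually_ge_atTop 0] with t ht
    have := add_ne_zero_of_mem_slitPlane hc ht
    field_simp
    ring
  have h := integral_Ioi_of_hasDerivAt_of_tendsto' (a := 0) (fun t ht =>
    hasDerivAt_mul_inv_add (add_ne_zero_of_mem_slitPlane hc ht)) hI hlim
  rw [integral_const_mul] at h
  simpa [mellin] using h

/-- For a nonempty list `cs`, the function `s ∫ t ^ (-s) ∏ (t + c)⁻¹` of `s` extends holomorphically
to the strip `-1 < re s < 1`; its value at `0` is `1` for a single factor, and `0` otherwise. -/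
theorem exists_extension_mul_mellin_invProd {cs : List ℂ} (hcs : ∀ c ∈ cs, c ∈ Complex.slitPlane)
    (hne : cs ≠ []) :
    ∃ h : ℂ → ℂ, (∀ s : ℂ, -1 < s.re → s.re < 1 → DifferentiableAt ℂ h s) ∧
      (h 0 = if cs.length = 1 then 1 else 0) ∧
      ∀ s : ℂ, 0 < s.re → s.re < 1 → h s = s * mellin (invProd cs) (1 - s) := by
  have key : ∀ cs : List ℂ, (∀ c ∈ cs, c ∈ Complex.slitPlane) → 2 ≤ cs.length → ∀ s : ℂ,
      -1 < s.re → s.re < 1 → DifferentiableAt ℂ (fun s => mellin (invProd cs) (1 - s)) s := by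
    intro cs hcs h2 s hs0 hs1
    obtain ⟨C, hC, hC'⟩ := invProd_bounds hcs h2
    have h := differentiableAt_mellin_of_bounded (s := 1 - s)
      ((continuousOn_invProd hcs).mono Ioi_subset_Ici_self) hC hC'
      (by simp; linarith) (by simp; linarith)
    exact h.comp s (by fun_prop)
  match cs, hne with
  | [c], _ =>
    have hc : c ∈ Complex.slitPlane := hcs c (by simp)
    refine ⟨fun s => c * mellin (invProd [c, c]) (1 - s), fun s h0 h1 => ?_, ?_, ?_⟩
    · exact (key [c, c] (by simpa using hc) (by simp) s h0 h1).const_mul c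
    · simpa using mul_mellin_invProd_pair hc
    · exact fun s h0 h1 => (mul_mellin_invProd_singleton hc h0 h1).symm
  | c :: c' :: cs, _ =>
    refine ⟨fun s => s * mellin (invProd (c :: c' :: cs)) (1 - s), fun s h0 h1 => ?_, ?_, ?_⟩
    · exact differentiableAt_id.mul (key _ hcs (by simp) s h0 h1)
    · simp
    · exact fun s _ _ => rfl

end MellinCalculus

/-! ### Resolvents and complex powers of a nonnegative continuous function -/

section CompactCalculus

open MeasureTheory Set Filter Asymptotics

variable {X : Type*} [TopologicalSpace X] (p : C(X, ℝ))

/-- A real-valued continuous function, viewed as complex-valued. -/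
def complexify : C(X, ℂ) := ⟨fun x => (p x : ℂ), by fun_prop⟩

@[simp] theorem complexify_apply (x : X) : complexify p x = (p x : ℂ) := rfl

/-- The function `(t p ^ n + c)⁻¹`, as an inverse in the algebra of continuous functions. For
`p = Δ⁻¹` it is the resolvent `(t + c Δⁿ)⁻¹` multiplied by `Δⁿ`; in this form it makes sense where
`p` vanishes. The value is junk unless `t p ^ n + c` has no zero. -/
def resolventFun (n : ℕ) (c : ℂ) (t : ℝ) : C(X, ℂ) :=
  Ring.inverse ((t : ℂ) • complexify p ^ n + algebraMap ℂ C(X, ℂ) c)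

/-- The product of the functions `(t p ^ n + c)⁻¹` over a list of complex numbers `c`. -/
def resolventProd (n : ℕ) (cs : List ℂ) (t : ℝ) : C(X, ℂ) :=
  (cs.map fun c => resolventFun p n c t).prod

theorem resolventProd_cons (n : ℕ) (c : ℂ) (cs : List ℂ) (t : ℝ) :
    resolventProd p n (c :: cs) t = resolventFun p n c t * resolventProd p n cs t := by
  simp [resolventProd]

variable {p}

theorem isUnit_resolvent (hp : ∀ x, 0 ≤ p x) (n : ℕ) {c : ℂ} (hc : c ∈ Complex.slitPlane)
    {t : ℝ} (ht : 0 ≤ t) :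
    IsUnit ((t : ℂ) • complexify p ^ n + algebraMap ℂ C(X, ℂ) c) := by
  rw [ContinuousMap.isUnit_iff_forall_ne_zero]
  intro x
  have := add_ne_zero_of_mem_slitPlane hc (mul_nonneg ht (pow_nonneg (hp x) n))
  simpa using this

theorem resolventFun_mul_cancel (hp : ∀ x, 0 ≤ p x) (n : ℕ) {c : ℂ}
    (hc : c ∈ Complex.slitPlane) {t : ℝ} (ht : 0 ≤ t) :
    resolventFun p n c t * ((t : ℂ) • complexify p ^ n + algebraMap ℂ C(X, ℂ) c) = 1 :=
  Ring.inverse_mul_cancel _ (isUnit_resolvent hp n hc ht)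

theorem resolventFun_apply (hp : ∀ x, 0 ≤ p x) (n : ℕ) {c : ℂ} (hc : c ∈ Complex.slitPlane)
    {t : ℝ} (ht : 0 ≤ t) (x : X) : resolventFun p n c t x = (((t * p x ^ n : ℝ) : ℂ) + c)⁻¹ := by
  have h := congrArg (fun f : C(X, ℂ) => f x) (resolventFun_mul_cancel hp n hc ht)
  refine eq_inv_of_mul_eq_one_left ?_
  simpa using h

theorem resolventProd_apply (hp : ∀ x, 0 ≤ p x) (n : ℕ) {cs : List ℂ}
    (hcs : ∀ c ∈ cs, c ∈ Complex.slitPlane) {t : ℝ} (ht : 0 ≤ t) (x : X) :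
    resolventProd p n cs t x = invProd cs (t * p x ^ n) := by
  induction cs with
  | nil => simp [resolventProd, invProd]
  | cons c cs ih =>
    have ih := ih fun c hc => hcs c (List.mem_cons_of_mem _ hc)
    rw [resolventProd_cons, ContinuousMap.mul_apply, ih,
      resolventFun_apply hp n (hcs c List.mem_cons_self) ht]
    simp [invProd]

variable (p) in
/-- The function `p ^ w` for `0 < re w`, with value `0` where `p` vanishes. -/
def cpowFun (w : ℂ) (hw : 0 < w.re) : C(X, ℂ) :=
  ⟨fun x => (p x : ℂ) ^ w, by
    refine continuous_iff_continuousAt.mpr fun x => ?_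
    have h := Complex.continuousAt_ofReal_cpow_const (p x) w (Or.inl hw)
    exact ContinuousAt.comp (f := fun x => p x) (g := fun a : ℝ => (a : ℂ) ^ w) h
      p.continuous.continuousAt⟩

theorem cpowFun_add_natCast {w v : ℂ} (hw : 0 < w.re) (hv : 0 < v.re) (n : ℕ) (h : v = w + n) :
    cpowFun p v hv = complexify p ^ n * cpowFun p w hw := by
  ext x
  show (p x : ℂ) ^ v = (p x : ℂ) ^ n * (p x : ℂ) ^ w
  have h0 : ∀ u : ℂ, 0 < u.re → u ≠ 0 := fun u hu h => by rw [h] at hu; simp at hu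
  by_cases hx : (p x : ℂ) = 0
  · rw [hx, Complex.zero_cpow (h0 v hv), Complex.zero_cpow (h0 w hw), mul_zero]
  · rw [h, Complex.cpow_add _ _ hx, Complex.cpow_natCast, mul_comm]

theorem cpowFun_natCast (n : ℕ)
    (hn : 0 < (n : ℂ).re) : cpowFun p (n : ℂ) hn = complexify p ^ n := by
  ext x
  exact Complex.cpow_natCast _ _

variable (p) in
/-- The family of functions `p ^ w` on the right half plane, extended by `0`. -/
def cpowFamily (w : ℂ) : C(X, ℂ) := if hw : 0 < w.re then cpowFun p w hw else 0

theorem cpowFamily_of_re_pos {w : ℂ} (hw : 0 < w.re) : cpowFamily p w = cpowFun p w hw :=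
  dif_pos hw

/-- Joint continuity of `(w, x) ↦ p x ^ w` gives continuity in `w`, uniformly in `x`. -/
theorem continuousOn_cpowFamily : ContinuousOn (cpowFamily p) {w | 0 < w.re} := by
  rw [continuousOn_iff_continuous_domRestrict]
  let f : C({w : ℂ | 0 < w.re} × X, ℂ) := ⟨fun z => (p z.2 : ℂ) ^ (z.1 : ℂ), by
    refine continuous_iff_continuousAt.mpr fun z => ?_
    have h := Complex.continuousAt_ofReal_cpow (p z.2) z.1 (Or.inl z.1.2)
    exact ContinuousAt.comp (f := fun z : {w : ℂ | 0 < w.re} × X => (p z.2, (z.1 : ℂ)))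
      (g := fun a : ℝ × ℂ => (a.1 : ℂ) ^ a.2) h (by fun_prop)⟩
  refine f.curry.continuous.congr fun w => ?_
  rw [domRestrict_apply, cpowFamily_of_re_pos w.2]
  rfl

variable [CompactSpace X]

theorem continuousOn_resolventProd (hp : ∀ x, 0 ≤ p x) (n : ℕ) {cs : List ℂ}
    (hcs : ∀ c ∈ cs, c ∈ Complex.slitPlane) :
    ContinuousOn (resolventProd p n cs) (Ioi 0) := by
  induction cs with
  | nil => simpa [resolventProd, Function.comp_def] using! continuousOn_const
  | cons c cs ih =>
    have e : resolventProd p n (c :: cs) = fun t => resolventFun p n c t * resolventProd p n cs t :=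
      funext fun t => resolventProd_cons p n c cs t
    rw [e]
    refine ContinuousOn.mul (fun t ht => ?_) (ih fun c hc => hcs c (List.mem_cons_of_mem _ hc))
    obtain ⟨u, hu⟩ := isUnit_resolvent hp n (hcs c List.mem_cons_self) (le_of_lt ht)
    have h1 := NormedRing.inverse_continuousAt u
    rw [hu] at h1
    have h2 : ContinuousAt (fun t : ℝ =>
        (t : ℂ) • complexify p ^ n + algebraMap ℂ C(X, ℂ) c) t := by fun_prop
    exact (ContinuousAt.comp (f := fun t : ℝ =>
        (t : ℂ) • complexify p ^ n + algebraMap ℂ C(X, ℂ) c) h1 h2).continuousWithinAt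

/-- Of the `n` powers of `p` which a resolvent can absorb, `q` buy decay of order `t ^ (-q / n)`. -/
theorem pow_mul_resolventProd_bounds (hp : ∀ x, 0 ≤ p x) {n q : ℕ} (hq : 1 ≤ q) (hqn : q ≤ n)
    {cs : List ℂ} (hcs : ∀ c ∈ cs, c ∈ Complex.slitPlane) (hne : cs ≠ []) :
    ∃ C : ℝ, (∀ t : ℝ, 0 < t → ‖complexify p ^ q * resolventProd p n cs t‖ ≤ C) ∧
      ∀ t : ℝ, 0 < t → ‖complexify p ^ q * resolventProd p n cs t‖ ≤ C * t ^ (-((q : ℝ) / n)) := by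
  obtain ⟨C, hC, h⟩ := norm_invProd_le hcs
  have hn : 0 < (n : ℝ) := by exact_mod_cast (by omega : 0 < n)
  have hpq : ∀ x, p x ^ q ≤ ‖p‖ ^ q := fun x => pow_le_pow_left₀ (hp x)
    ((Real.le_norm_self _).trans (p.norm_coe_le_norm x)) q
  -- the pointwise bound by a single resolvent factor
  have hb : ∀ t : ℝ, 0 < t → ∀ x, ‖(complexify p ^ q * resolventProd p n cs t) x‖
      ≤ C * (p x ^ q * (t * p x ^ n + 1)⁻¹) := by
    intro t ht x
    have hτ : 0 ≤ t * p x ^ n := mul_nonneg ht.le (pow_nonneg (hp x) n)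
    rw [ContinuousMap.mul_apply, resolventProd_apply hp n hcs ht.le, norm_mul,
      ContinuousMap.pow_apply, complexify_apply, norm_pow, Complex.norm_real,
      Real.norm_of_nonneg (hp x)]
    have h2 : ((t * p x ^ n + 1)⁻¹) ^ cs.length ≤ (t * p x ^ n + 1)⁻¹ := by
      refine pow_le_of_le_one (by positivity) (inv_le_one_of_one_le₀ (by linarith)) ?_
      exact fun h => hne (List.length_eq_zero_iff.mp h)
    calc _ ≤ p x ^ q * (C * (t * p x ^ n + 1)⁻¹) := by
          refine mul_le_mul_of_nonneg_left ((h _ hτ).trans ?_) (pow_nonneg (hp x) q)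
          exact mul_le_mul_of_nonneg_left h2 hC
      _ = _ := by ring
  refine ⟨C * (‖p‖ ^ q + 1), fun t ht => ?_, fun t ht => ?_⟩
  · refine (ContinuousMap.norm_le _ (by positivity)).mpr fun x => (hb t ht x).trans ?_
    have hτ : 0 ≤ t * p x ^ n := mul_nonneg ht.le (pow_nonneg (hp x) n)
    refine mul_le_mul_of_nonneg_left ?_ hC
    calc _ ≤ p x ^ q := mul_le_of_le_one_right (pow_nonneg (hp x) q)
          (inv_le_one_of_one_le₀ (by linarith))
      _ ≤ _ := by linarith [hpq x]
  · refine (ContinuousMap.norm_le _ (by positivity)).mpr fun x => (hb t ht x).trans ?_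
    have hτ : 0 ≤ t * p x ^ n := mul_nonneg ht.le (pow_nonneg (hp x) n)
    rw [mul_assoc]
    refine mul_le_mul_of_nonneg_left ?_ hC
    -- `u ^ q = (u ^ n) ^ (q / n)`, and `(t u ^ n) ^ (q / n) ≤ t u ^ n + 1`
    have e1 : p x ^ q = (p x ^ n) ^ ((q : ℝ) / n) := by
      rw [← Real.rpow_natCast (p x) n, ← Real.rpow_mul (hp x), mul_div_cancel₀ _ hn.ne',
        Real.rpow_natCast]
    have hqn1 : (q : ℝ) / n ≤ 1 := by rw [div_le_one hn]; exact_mod_cast hqn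
    have e2 : t ^ ((q : ℝ) / n) * p x ^ q ≤ t * p x ^ n + 1 := by
      rw [e1, ← Real.mul_rpow ht.le (pow_nonneg (hp x) n)]
      calc _ ≤ (t * p x ^ n + 1) ^ ((q : ℝ) / n) :=
            Real.rpow_le_rpow hτ (by linarith) (by positivity)
        _ ≤ (t * p x ^ n + 1) ^ (1 : ℝ) := Real.rpow_le_rpow_of_exponent_le (by linarith) hqn1
        _ = _ := Real.rpow_one _
    have ht' : 0 < t ^ ((q : ℝ) / n) := Real.rpow_pos_of_pos ht _
    have e3 : p x ^ q * (t * p x ^ n + 1)⁻¹ ≤ t ^ (-((q : ℝ) / n)) := by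
      rw [Real.rpow_neg ht.le, ← div_eq_mul_inv, div_le_iff₀ (by linarith), inv_mul_eq_div,
        le_div_iff₀ ht']
      linarith
    refine e3.trans (le_mul_of_one_le_left (by positivity) ?_)
    have : 0 ≤ ‖p‖ ^ q := by positivity
    linarith

/-- The Mellin transform of a product of resolvents is a complex power: pointwise, substitute
`t ↦ t / p ^ n` in the integral. -/
theorem mellin_functional_resolventProd (hp : ∀ x, 0 ≤ p x) {n q : ℕ} (hq : 1 ≤ q) (hqn : q ≤ n)
    {cs : List ℂ} (hcs : ∀ c ∈ cs, c ∈ Complex.slitPlane) (hne : cs ≠ [])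
    (L : C(X, ℂ) →L[ℂ] ℂ) {s : ℂ} (hs1 : s.re < 1) (hs0 : 0 < ((q : ℂ) - n + n * s).re) :
    MellinConvergent (fun t => L (complexify p ^ q * resolventProd p n cs t)) (1 - s) ∧
    mellin (fun t => L (complexify p ^ q * resolventProd p n cs t)) (1 - s)
      = mellin (invProd cs) (1 - s) * L (cpowFun p _ hs0) := by
  have hn : 0 < (n : ℝ) := by exact_mod_cast (by omega : 0 < n)
  obtain ⟨C, hC, hC'⟩ := pow_mul_resolventProd_bounds hp hq hqn hcs hne
  have hs0' : 0 < (q : ℝ) - n + n * s.re := by simpa using hs0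
  have hconv : MellinConvergent (fun t => complexify p ^ q * resolventProd p n cs t) (1 - s) := by
    refine mellinConvergent_of_bounded
      (continuousOn_const.mul (continuousOn_resolventProd hp n hcs)) hC hC' (by simp; linarith) ?_
    rw [lt_div_iff₀ hn, Complex.sub_re, Complex.one_re]
    linarith
  refine ⟨hconv.continuousLinearMap_comp L, ?_⟩
  rw [mellin_continuousLinearMap_comp L hconv, ← smul_eq_mul, ← map_smul]
  congr 1
  ext x
  have hev := mellin_continuousLinearMap_comp (ContinuousMap.evalCLM ℂ x) hconv
  rw [ContinuousMap.evalCLM_apply] at hev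
  rw [← hev, ContinuousMap.smul_apply, smul_eq_mul]
  have hcp : cpowFun p _ hs0 x = (p x : ℂ) ^ ((q : ℂ) - n + n * s) := rfl
  rw [hcp]
  rcases eq_or_lt_of_le (hp x) with h0 | h0
  · have hw : ((q : ℂ) - n + n * s) ≠ 0 := fun h => by rw [h] at hs0; simp at hs0
    rw [← h0, Complex.ofReal_zero, Complex.zero_cpow hw, mul_zero]
    have : ∀ t : ℝ,
        (ContinuousMap.evalCLM ℂ x) (complexify p ^ q * resolventProd p n cs t) = 0 := by
      intro t
      simp [← h0]
      exact Or.inl (by omega)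
    simp only [this, mellin, smul_zero, integral_zero]
  · have hpn : 0 < p x ^ n := pow_pos h0 n
    have e1 : mellin (fun t => (ContinuousMap.evalCLM ℂ x)
        (complexify p ^ q * resolventProd p n cs t)) (1 - s)
        = mellin (fun t => (p x : ℂ) ^ q • invProd cs (p x ^ n * t)) (1 - s) := by
      refine setIntegral_congr_fun measurableSet_Ioi fun t ht => ?_
      have : resolventProd p n cs t x = invProd cs (p x ^ n * t) := by
        rw [resolventProd_apply hp n hcs (le_of_lt ht), mul_comm]
      simp [this]
    rw [e1, mellin_const_smul, mellin_comp_mul_left _ _ hpn, smul_eq_mul, smul_eq_mul]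
    have hpx : (p x : ℂ) ≠ 0 := by exact_mod_cast h0.ne'
    have e2 : ((p x ^ n : ℝ) : ℂ) ^ (-(1 - s)) = (p x : ℂ) ^ ((n : ℂ) * (-(1 - s))) := by
      rw [Complex.ofReal_pow, ← Complex.cpow_natCast, ← Complex.cpow_mul]
      · rw [← Complex.ofReal_log h0.le, ← Complex.ofReal_natCast, ← Complex.ofReal_mul,
          Complex.ofReal_im]; linarith [Real.pi_pos]
      · rw [← Complex.ofReal_log h0.le, ← Complex.ofReal_natCast, ← Complex.ofReal_mul,
          Complex.ofReal_im]; linarith [Real.pi_pos]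
    rw [e2, ← Complex.cpow_natCast, ← mul_assoc, ← Complex.cpow_add _ _ hpx, mul_comm]
    congr 2
    ring

/-- The functions `p ^ w` depend holomorphically on `w`: as elements of the algebra of continuous
functions they are given by the Cauchy integral formula. -/
theorem differentiableAt_cpowFamily {w : ℂ} (hw : 0 < w.re) :
    DifferentiableAt ℂ (cpowFamily p) w := by
  have hR : (0 : ℝ) < w.re / 2 := by linarith
  have hball : Metric.closedBall w (w.re / 2) ⊆ {z | 0 < z.re} := by
    intro z hz
    have h1 : |(z - w).re| ≤ w.re / 2 :=
      (Complex.abs_re_le_norm _).trans (by simpa [dist_eq_norm] using hz)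
    have h2 := (abs_le.mp h1).1
    simp only [Complex.sub_re] at h2
    show 0 < z.re
    linarith
  have hcont : ContinuousOn (cpowFamily p) (Metric.closedBall w (w.re / 2)) :=
    continuousOn_cpowFamily.mono hball
  have hint : CircleIntegrable (cpowFamily p) w (w.re / 2) :=
    (hcont.mono Metric.sphere_subset_closedBall).circleIntegrable hR.le
  lift w.re / 2 to NNReal using hR.le with R hRR
  have hser := hasFPowerSeriesOn_cauchy_integral hint (by exact_mod_cast hR)
  have hd := hser.analyticAt.differentiableAt
  refine hd.congr_of_eventuallyEq ?_
  filter_upwards [Metric.ball_mem_nhds w hR] with z hz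
  ext x
  have hci : CircleIntegrable (fun ζ => (ζ - z)⁻¹ • cpowFamily p ζ) w R := by
    refine ContinuousOn.circleIntegrable hR.le ?_
    refine ContinuousOn.smul (ContinuousOn.inv₀ (continuousOn_id.sub continuousOn_const)
      fun ζ hζ h => ?_) (hcont.mono Metric.sphere_subset_closedBall)
    replace h : ζ = z := sub_eq_zero.mp h
    rw [h] at hζ
    exact (Metric.mem_ball.mp hz).ne (Metric.mem_sphere.mp hζ)
  have hev : ContinuousMap.evalCLM ℂ x (∮ ζ in C(w, R), (ζ - z)⁻¹ • cpowFamily p ζ)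
      = ∮ ζ in C(w, R), (ζ - z)⁻¹ • cpowFamily p ζ x := by
    rw [circleIntegral, circleIntegral, ← ContinuousLinearMap.intervalIntegral_comp_comm]
    · simp
    · exact hci.out
  have hpt : ∀ ζ ∈ Metric.closedBall w R, cpowFamily p ζ x = (p x : ℂ) ^ ζ := by
    intro ζ hζ
    rw [cpowFamily_of_re_pos (hball hζ)]; rfl
  have hdiff : DifferentiableOn ℂ (fun ζ => cpowFamily p ζ x) (Metric.closedBall w R) := by
    refine DifferentiableOn.congr (f := fun ζ : ℂ => (p x : ℂ) ^ ζ) (fun ζ hζ => ?_) hpt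
    have hζ0 : ζ ≠ 0 := fun h => by
      have := hball hζ
      rw [h] at this
      simp at this
    exact (differentiableAt_id.const_cpow (Or.inr hζ0)).differentiableWithinAt
  have hcauchy := hdiff.circleIntegral_sub_inv_smul hz
  rw [ContinuousMap.evalCLM_apply] at hev
  rw [ContinuousMap.smul_apply, hev, hcauchy, smul_smul, inv_mul_cancel₀ Complex.two_pi_I_ne_zero,
    one_smul]

end CompactCalculus

/-! ### Functional calculus of the inverse Laplacian -/

namespace AbstractLaplacian

variable {H : Type*} [NormedAddCommGroup H] [InnerProductSpace ℂ H] [CompleteSpace H]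
variable (Δ : AbstractLaplacian H)

theorem inv_isPositive : Δ.inv.IsPositive := by
  rw [ContinuousLinearMap.isPositive_iff_complex]
  intro x
  have hs : ⟪Δ.inv x, x⟫_ℂ = ⟪x, Δ.inv x⟫_ℂ :=
    (ContinuousLinearMap.isSelfAdjoint_iff_isSymmetric.mp Δ.inv_isSelfAdjoint) x x
  have hre : 0 ≤ (⟪Δ.inv x, x⟫_ℂ).re := by
    obtain ⟨c, hc, h⟩ := Δ.strictlyPositive
    have h1 := h (Δ.opEquiv.symm x)
    rw [op_opEquiv_symm] at h1
    rw [inv_apply]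
    exact le_trans (by positivity) h1
  refine ⟨?_, hre⟩
  have him : (⟪Δ.inv x, x⟫_ℂ).im = 0 := by
    rw [← Complex.conj_eq_iff_im, inner_conj_symm, hs]
  exact Complex.ext (by simp) (by simpa using him.symm)

open scoped ComplexOrder in
theorem spectrum_inv {x : ℂ} (hx : x ∈ spectrum ℂ Δ.inv) : 0 ≤ x.re ∧ (x.re : ℂ) = x := by
  have h0 : 0 ≤ Δ.inv := (ContinuousLinearMap.nonneg_iff_isPositive _).mpr Δ.inv_isPositive
  have h1 : 0 ≤ x := spectrum_nonneg_of_nonneg h0 hx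
  rw [Complex.le_def] at h1
  exact ⟨h1.1, Complex.ext (by simp) (by simpa using h1.2)⟩

/-- The identity function on the spectrum of `Δ⁻¹`, as a real-valued function. -/
def specFun : C(spectrum ℂ Δ.inv, ℝ) := ⟨fun x => (x : ℂ).re, by fun_prop⟩

theorem specFun_nonneg (x : spectrum ℂ Δ.inv) : 0 ≤ Δ.specFun x := (Δ.spectrum_inv x.2).1

theorem ofReal_specFun (x : spectrum ℂ Δ.inv) : ((Δ.specFun x : ℝ) : ℂ) = x :=
  (Δ.spectrum_inv x.2).2

theorem inv_isStarNormal : IsStarNormal Δ.inv := Δ.inv_isSelfAdjoint.isStarNormal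

/-- The continuous functional calculus of the bounded operator `Δ⁻¹`. -/
def calculus : C(spectrum ℂ Δ.inv, ℂ) →⋆ₐ[ℂ] (H →L[ℂ] H) := cfcHom Δ.inv_isStarNormal

theorem calculus_specFun : Δ.calculus (complexify Δ.specFun) = Δ.inv := by
  have : complexify Δ.specFun = (ContinuousMap.id ℂ).restrict (spectrum ℂ Δ.inv) := by
    ext x
    exact Δ.ofReal_specFun x
  rw [this]
  exact cfcHom_id Δ.inv_isStarNormal

/-- The functional calculus as a continuous linear map. -/
def calculusL : C(spectrum ℂ Δ.inv, ℂ) →L[ℂ] (H →L[ℂ] H) :=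
  ⟨Δ.calculus.toAlgHom.toLinearMap, cfcHom_continuous Δ.inv_isStarNormal⟩

theorem norm_calculus_le (f : C(spectrum ℂ Δ.inv, ℂ)) : ‖Δ.calculus f‖ ≤ ‖f‖ :=
  NonUnitalStarAlgHom.norm_apply_le Δ.calculus f

theorem negPow_eq_calculus (w : ℂ) (hw : 0 < w.re) :
    Δ.negPow w = Δ.calculus (cpowFun Δ.specFun w hw) := by
  have hcont : ContinuousOn (fun x : ℂ => x ^ w) (spectrum ℂ Δ.inv) := by
    rw [continuousOn_iff_continuous_domRestrict]
    refine (cpowFun Δ.specFun w hw).continuous.congr fun x => ?_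
    show ((Δ.specFun x : ℝ) : ℂ) ^ w = _
    rw [Δ.ofReal_specFun]
    rfl
  rw [negPow, cfc_apply _ _ Δ.inv_isStarNormal hcont]
  congr 1
  ext x
  show _ = ((Δ.specFun x : ℝ) : ℂ) ^ w
  rw [Δ.ofReal_specFun]
  rfl

theorem commute_calculus_inv (f : C(spectrum ℂ Δ.inv, ℂ)) : Commute (Δ.calculus f) Δ.inv := by
  have h := (Commute.all f (complexify Δ.specFun)).map Δ.calculus
  rwa [calculus_specFun] at h

/-- Bounded operators which commute with `Δ⁻¹` preserve the smooth vectors. -/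
theorem map_mem_smooth_of_commute {T : H →L[ℂ] H} (hT : Commute T Δ.inv) {v : H}
    (hv : v ∈ Δ.smooth) : T v ∈ Δ.smooth := by
  have hc : ∀ x : H, T (Δ.inv x) = Δ.inv (T x) := fun x =>
    congrArg (fun T : H →L[ℂ] H => T x) hT.eq
  have key : ∀ (n : ℕ) (x : H), x ∈ Δ.domPow n → T x ∈ Δ.domPow n := by
    intro n
    induction n with
    | zero => intro x _; exact Submodule.mem_top
    | succ n ih =>
      intro x hx
      obtain ⟨h, hx'⟩ := (Δ.mem_domPow_succ n x).mp hx
      have e : T x = Δ.inv (T (Δ.op ⟨x, h⟩)) := by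
        rw [← hc, inv_apply, opEquiv_symm_op]
      rw [e, inv_apply, mem_domPow_succ]
      refine ⟨(Δ.opEquiv.symm _).2, ?_⟩
      rw [Subtype.coe_eta, op_opEquiv_symm]
      exact ih _ hx'
  rw [mem_smooth]
  exact fun n => key n _ ((Δ.mem_smooth _).mp hv n)

/-- The functional calculus of `Δ⁻¹`, acting on the smooth vectors. -/
def smoothCalculus : C(spectrum ℂ Δ.inv, ℂ) →ₐ[ℂ] Module.End ℂ Δ.smooth :=
  AlgHom.ofLinearMap
    { toFun := fun f => LinearMap.codRestrict Δ.smooth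
        ((Δ.calculus f).toLinearMap ∘ₗ Δ.smooth.subtype)
        fun v => Δ.map_mem_smooth_of_commute (Δ.commute_calculus_inv f) v.2
      map_add' := fun f g => by
        ext v
        show Δ.calculus (f + g) (v : H) = Δ.calculus f v + Δ.calculus g v
        rw [map_add]; rfl
      map_smul' := fun c f => by
        ext v
        show Δ.calculus (c • f) (v : H) = c • Δ.calculus f v
        rw [map_smul]; rfl }
    (by
      ext v
      show Δ.calculus 1 (v : H) = v
      rw [map_one]; rfl)
    (fun f g => by
      ext v
      show Δ.calculus (f * g) (v : H) = Δ.calculus f (Δ.calculus g v)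
      rw [map_mul]; rfl)

theorem coe_smoothCalculus (f : C(spectrum ℂ Δ.inv, ℂ)) (v : Δ.smooth) :
    (Δ.smoothCalculus f v : H) = Δ.calculus f (v : H) := rfl

theorem extendsSmooth_calculus (f : C(spectrum ℂ Δ.inv, ℂ)) :
    ExtendsSmooth (Δ.calculus f) (Δ.smoothCalculus f) := fun _ => rfl

/-- `Δ⁻¹` on the smooth vectors. -/
def invOnSmooth : Module.End ℂ Δ.smooth := Δ.smoothCalculus (complexify Δ.specFun)

theorem coe_invOnSmooth (v : Δ.smooth) : (Δ.invOnSmooth v : H) = Δ.inv (v : H) := by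
  rw [invOnSmooth, coe_smoothCalculus, calculus_specFun]

theorem invOnSmooth_mul_onSmooth : Δ.invOnSmooth * Δ.onSmooth = 1 := by
  ext v
  show (Δ.invOnSmooth (Δ.onSmooth v) : H) = v
  rw [coe_invOnSmooth, inv_apply]
  exact congrArg Subtype.val (Δ.opEquiv_symm_op ⟨v, Δ.smooth_le_domain v.2⟩)

theorem onSmooth_mul_invOnSmooth : Δ.onSmooth * Δ.invOnSmooth = 1 := by
  ext v
  have h := Δ.coe_invOnSmooth v
  rw [inv_apply] at h
  have h2 : (⟨(Δ.invOnSmooth v : H), Δ.smooth_le_domain (Δ.invOnSmooth v).2⟩ : Δ.op.domain)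
      = Δ.opEquiv.symm (v : H) := Subtype.ext h
  show Δ.op ⟨(Δ.invOnSmooth v : H), Δ.smooth_le_domain (Δ.invOnSmooth v).2⟩ = v
  rw [h2, op_opEquiv_symm]

theorem commute_smoothCalculus (f : C(spectrum ℂ Δ.inv, ℂ)) :
    Commute (Δ.smoothCalculus f) Δ.onSmooth := by
  have h : Commute (Δ.smoothCalculus f) Δ.invOnSmooth :=
    (Commute.all f (complexify Δ.specFun)).map Δ.smoothCalculus
  calc Δ.smoothCalculus f * Δ.onSmooth
      = (Δ.onSmooth * Δ.invOnSmooth) * Δ.smoothCalculus f * Δ.onSmooth := by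
        rw [onSmooth_mul_invOnSmooth, one_mul]
    _ = Δ.onSmooth * Δ.smoothCalculus f * (Δ.invOnSmooth * Δ.onSmooth) := by
        rw [mul_assoc Δ.onSmooth, ← h.eq]; simp only [mul_assoc]
    _ = Δ.onSmooth * Δ.smoothCalculus f := by rw [invOnSmooth_mul_onSmooth, mul_one]

theorem onSmooth_pow_mul_invOnSmooth_pow (n : ℕ) : Δ.onSmooth ^ n * Δ.invOnSmooth ^ n = 1 := by
  have h : Commute Δ.onSmooth Δ.invOnSmooth := (Δ.commute_smoothCalculus _).symm
  rw [← h.mul_pow, onSmooth_mul_invOnSmooth, one_pow]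

theorem invOnSmooth_pow_mul_onSmooth_pow (n : ℕ) : Δ.invOnSmooth ^ n * Δ.onSmooth ^ n = 1 := by
  have h : Commute Δ.invOnSmooth Δ.onSmooth := Δ.commute_smoothCalculus _
  rw [← h.mul_pow, invOnSmooth_mul_onSmooth, one_pow]

theorem onSmooth_pow_mul_invOnSmooth_pow_add (n e : ℕ) :
    Δ.onSmooth ^ n * Δ.invOnSmooth ^ (n + e) = Δ.invOnSmooth ^ e := by
  rw [pow_add, ← mul_assoc, onSmooth_pow_mul_invOnSmooth_pow, one_mul]

theorem negPowOnSmooth_eq (w : ℂ) (hw : 0 < w.re) :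
    Δ.negPowOnSmooth w = Δ.smoothCalculus (cpowFun Δ.specFun w hw) := by
  ext v
  show Δ.negPow w (v : H) = _
  rw [negPow_eq_calculus _ w hw]; rfl

theorem cpow_neg (w : ℂ) (hw : 0 < w.re) :
    Δ.cpow (-w) = Δ.smoothCalculus (cpowFun Δ.specFun w hw) := by
  have hfl : ⌊(-w).re⌋₊ = 0 := Nat.floor_eq_zero.mpr (by rw [Complex.neg_re]; linarith)
  have hw1 : 0 < (((0 + 1 : ℕ) : ℂ) - -w).re := by simp; linarith
  have e : cpowFun Δ.specFun _ hw1 = complexify Δ.specFun * cpowFun Δ.specFun w hw := by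
    simpa using cpowFun_add_natCast (p := Δ.specFun) hw hw1 1 (by push_cast; ring)
  rw [cpow, hfl, Δ.negPowOnSmooth_eq _ hw1, e, map_mul, ← mul_assoc, zero_add, pow_one]
  have := Δ.onSmooth_mul_invOnSmooth
  rw [invOnSmooth] at this
  rw [this, one_mul]

theorem cpow_natCast (e : ℕ) : Δ.cpow (e : ℂ) = Δ.onSmooth ^ e := by
  have hfl : ⌊((e : ℂ)).re⌋₊ = e := by simp
  have h1 : (((e + 1 : ℕ) : ℂ) - e) = 1 := by push_cast; ring
  have h2 : Δ.negPowOnSmooth 1 = Δ.invOnSmooth := by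
    rw [Δ.negPowOnSmooth_eq 1 (by simp), invOnSmooth]
    congr 1
    ext x
    exact Complex.cpow_one _
  rw [cpow, hfl, h1, h2, pow_succ, mul_assoc, onSmooth_mul_invOnSmooth, mul_one]

theorem inv_pow_mem_domPow (n : ℕ) (x : H) : (Δ.inv ^ n) x ∈ Δ.domPow n := by
  induction n generalizing x with
  | zero => exact Submodule.mem_top
  | succ n ih =>
    have e : (Δ.inv ^ (n + 1)) x = Δ.inv ((Δ.inv ^ n) x) := by rw [pow_succ']; rfl
    rw [e, inv_apply, mem_domPow_succ]
    refine ⟨(Δ.opEquiv.symm _).2, ?_⟩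
    rw [Subtype.coe_eta, op_opEquiv_symm]
    exact ih x

/-- The smooth vectors are dense: the functions `max (u - ε) 0` of `Δ⁻¹` map into them, and they
approximate `Δ⁻¹`, whose range is dense. -/
theorem dense_smooth : Dense (Δ.smooth : Set H) := by
  have hdom : ∀ v ∈ Δ.op.domain, v ∈ closure (Δ.smooth : Set H) := by
    intro v hv
    rw [Metric.mem_closure_iff]
    intro ε hε
    set x := Δ.op ⟨v, hv⟩ with hx
    have hvx : Δ.inv x = v := by rw [inv_apply, hx, opEquiv_symm_op]
    set η := ε / (2 * (‖x‖ + 1)) with hη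
    have hη0 : 0 < η := by positivity
    let f : C(spectrum ℂ Δ.inv, ℝ) := ⟨fun u => max (Δ.specFun u - η) 0, by fun_prop⟩
    refine ⟨Δ.calculus (complexify f) x, ?_, ?_⟩
    · refine (Δ.mem_smooth _).mpr fun n => ?_
      -- `f` vanishes near `0`, so it is divisible by every power of the variable
      let h : C(spectrum ℂ Δ.inv, ℝ) :=
        ⟨fun u => max (Δ.specFun u - η) 0 / (max (Δ.specFun u) η) ^ n, by
          refine Continuous.div (by fun_prop) (by fun_prop) fun u => ?_
          exact pow_ne_zero _ (lt_max_of_lt_right hη0).ne'⟩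
      have e : complexify f = complexify Δ.specFun ^ n * complexify h := by
        ext u
        simp only [ContinuousMap.mul_apply, ContinuousMap.pow_apply, complexify_apply]
        have : f u = Δ.specFun u ^ n * h u := by
          show max (Δ.specFun u - η) 0
            = Δ.specFun u ^ n * (max (Δ.specFun u - η) 0 / (max (Δ.specFun u) η) ^ n)
          rcases le_total (Δ.specFun u) η with hle | hle
          · rw [max_eq_right (by linarith)]; simp
          · have : Δ.specFun u ≠ 0 := (lt_of_lt_of_le hη0 hle).ne'
            rw [max_eq_left (a := Δ.specFun u) hle]
            field_simp
        rw [this]; push_cast; rfl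
      rw [e, map_mul, map_pow, calculus_specFun]
      exact Δ.inv_pow_mem_domPow n _
    · have hle : ‖complexify Δ.specFun - complexify f‖ ≤ η := by
        refine (ContinuousMap.norm_le _ hη0.le).mpr fun u => ?_
        rw [ContinuousMap.sub_apply, complexify_apply, complexify_apply, ← Complex.ofReal_sub,
          Complex.norm_real, Real.norm_eq_abs]
        show |Δ.specFun u - max (Δ.specFun u - η) 0| ≤ η
        have := Δ.specFun_nonneg u
        rcases le_total (Δ.specFun u) η with hle | hle
        · rw [max_eq_right (by linarith), sub_zero, abs_of_nonneg this]; exact hle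
        · rw [max_eq_left (by linarith), sub_sub_cancel, abs_of_pos hη0]
      have e : Δ.inv x - Δ.calculus (complexify f) x
          = Δ.calculus (complexify Δ.specFun - complexify f) x := by
        rw [map_sub, calculus_specFun]; rfl
      rw [← hvx, dist_eq_norm, e]
      calc _ ≤ ‖Δ.calculus (complexify Δ.specFun - complexify f)‖ * ‖x‖ :=
            ContinuousLinearMap.le_opNorm _ _
        _ ≤ η * ‖x‖ := by gcongr; exact (Δ.norm_calculus_le _).trans hle
        _ < ε := by
          rw [hη, div_mul_eq_mul_div, div_lt_iff₀ (by positivity)]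
          nlinarith [norm_nonneg x]
  have h1 : closure (Δ.op.domain : Set H) ⊆ closure (Δ.smooth : Set H) :=
    closure_minimal hdom isClosed_closure
  intro x
  exact h1 (Δ.selfAdjoint.dense_domain x)

end AbstractLaplacian

/-! ### Bounded extensions of operators on the smooth vectors -/

section Extensions

variable {H : Type*} [NormedAddCommGroup H] [InnerProductSpace ℂ H] [CompleteSpace H]
variable {Δ : AbstractLaplacian H}

theorem ExtendsSmooth.unique {T T' : H →L[ℂ] H} {A : Module.End ℂ Δ.smooth}
    (h : ExtendsSmooth T A) (h' : ExtendsSmooth T' A) : T = T' := by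
  refine DFunLike.coe_injective (Continuous.ext_on Δ.dense_smooth T.continuous T'.continuous ?_)
  intro v hv
  exact (h ⟨v, hv⟩).trans (h' ⟨v, hv⟩).symm

theorem ExtendsSmooth.add {T T' : H →L[ℂ] H} {A A' : Module.End ℂ Δ.smooth}
    (h : ExtendsSmooth T A) (h' : ExtendsSmooth T' A') : ExtendsSmooth (T + T') (A + A') :=
  fun v => by
    show T (v : H) + T' (v : H) = (A v : H) + (A' v : H)
    rw [h v, h' v]

theorem ExtendsSmooth.smul {T : H →L[ℂ] H} {A : Module.End ℂ Δ.smooth} (c : ℂ)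
    (h : ExtendsSmooth T A) : ExtendsSmooth (c • T) (c • A) := fun v => by
  show c • T (v : H) = c • (A v : H)
  rw [h v]

theorem ExtendsSmooth.mul {T T' : H →L[ℂ] H} {A A' : Module.End ℂ Δ.smooth}
    (h : ExtendsSmooth T A) (h' : ExtendsSmooth T' A') : ExtendsSmooth (T * T') (A * A') :=
  fun v => by
    show T (T' (v : H)) = (A (A' v) : H)
    rw [h' v, h (A' v)]

theorem extendsSmooth_zero : ExtendsSmooth (0 : H →L[ℂ] H) (0 : Module.End ℂ Δ.smooth) :=
  fun _ => rfl

theorem exists_extendsSmooth_of_bound {A : Module.End ℂ Δ.smooth} {C : ℝ}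
    (h : ∀ v : Δ.smooth, ‖(A v : H)‖ ≤ C * ‖(v : H)‖) : ∃ T : H →L[ℂ] H, ExtendsSmooth T A := by
  have hd : DenseRange Δ.smooth.subtype := by
    have := Δ.dense_smooth
    rw [DenseRange]
    convert this
    simp
  refine ⟨(Δ.smooth.subtype ∘ₗ A).extendOfNorm Δ.smooth.subtype, fun v => ?_⟩
  exact LinearMap.extendOfNorm_eq hd ⟨C, h⟩ v

theorem smoothTrace_eq_opTrace {T : H →L[ℂ] H} {A : Module.End ℂ Δ.smooth}
    (h : ExtendsSmooth T A) : smoothTrace A = opTrace T := by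
  have hex : ∃ T : H →L[ℂ] H, ExtendsSmooth T A := ⟨T, h⟩
  rw [smoothTrace, dif_pos hex, hex.choose_spec.unique h]

end Extensions

/-! ### Diagonalizable maps and invariant subspaces -/

section Eigen

variable {V : Type*} [AddCommGroup V] [Module ℂ V] {f : V →ₗ[ℂ] V} {p : Submodule ℂ V}

/-- Applying `f - ν` removes the summand with eigenvalue `ν` and multiplies the others by nonzero
scalars, which is how the induction peels off one eigenvector at a time. -/
theorem mem_of_sum_eigenvectors_mem (hp : ∀ x ∈ p, f x ∈ p) (s : Finset ℂ) (y : ℂ → V)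
    (hy : ∀ μ ∈ s, f (y μ) = μ • y μ) (hs : ∑ μ ∈ s, y μ ∈ p) : ∀ μ ∈ s, y μ ∈ p := by
  classical
  induction s using Finset.induction_on generalizing y with
  | empty => simp
  | insert ν s hν ih =>
    have h1 : f (∑ μ ∈ insert ν s, y μ) - ν • ∑ μ ∈ insert ν s, y μ
        = ∑ μ ∈ s, (μ - ν) • y μ := by
      rw [Finset.sum_insert hν, map_add, map_sum, hy ν (Finset.mem_insert_self _ _), smul_add,
        add_sub_add_left_eq_sub, Finset.smul_sum, ← Finset.sum_sub_distrib]
      refine Finset.sum_congr rfl fun μ hμ => ?_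
      rw [hy μ (Finset.mem_insert_of_mem hμ), sub_smul]
    have h2 : ∑ μ ∈ s, (μ - ν) • y μ ∈ p := by
      rw [← h1]
      exact p.sub_mem (hp _ hs) (p.smul_mem _ hs)
    have h3 : ∀ μ ∈ s, y μ ∈ p := by
      intro μ hμ
      have h4 := ih (fun μ => (μ - ν) • y μ) (fun μ hμ => by
        rw [map_smul, hy μ (Finset.mem_insert_of_mem hμ), smul_comm]) h2 μ hμ
      have h5 : μ - ν ≠ 0 := sub_ne_zero.mpr fun h => hν (h ▸ hμ)
      exact (p.smul_mem_iff h5).mp h4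
    intro μ hμ
    rcases Finset.mem_insert.mp hμ with rfl | hμ
    · rw [Finset.sum_insert hν] at hs
      exact (p.add_mem_iff_left (p.sum_mem h3)).mp hs
    · exact h3 μ hμ

/-- If `f` is diagonalizable, then every element of an invariant subspace is a sum of eigenvectors
which lie in the subspace. -/
theorem IsDiagonalizableMap.exists_sum_eq (hf : IsDiagonalizableMap f) (hp : ∀ x ∈ p, f x ∈ p)
    {x : V} (hx : x ∈ p) : ∃ (s : Finset ℂ) (y : ℂ → V),
      (∀ μ ∈ s, f (y μ) = μ • y μ ∧ y μ ∈ p) ∧ ∑ μ ∈ s, y μ = x := by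
  have hx' : x ∈ ⨆ μ : ℂ, Module.End.eigenspace f μ := by
    rw [DirectSum.IsInternal.submodule_iSup_eq_top hf]; trivial
  obtain ⟨y, hy, hsum⟩ := (Submodule.mem_iSup_iff_exists_finsupp _ _).mp hx'
  have hy' : ∀ μ, f (y μ) = μ • y μ := fun μ => Module.End.mem_eigenspace_iff.mp (hy μ)
  refine ⟨y.support, y, fun μ hμ => ⟨hy' μ, ?_⟩, hsum⟩
  refine mem_of_sum_eigenvectors_mem hp y.support y (fun μ _ => hy' μ) ?_ μ hμ
  have : ∑ μ ∈ y.support, y μ = x := hsum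
  rwa [this]

end Eigen

/-! ### Operators of bounded order -/

namespace TwistedDOAlgebra

variable {H : Type*} [NormedAddCommGroup H] [InnerProductSpace ℂ H] [CompleteSpace H]
variable {Δ : AbstractLaplacian H} {r : ℕ} (D : TwistedDOAlgebra Δ r)

theorem twist_pow_mem_filt_iff (n m : ℕ) (X : D.alg) :
    ((D.twist ^ n) X : Module.End ℂ Δ.smooth) ∈ D.filt m ↔
      (X : Module.End ℂ Δ.smooth) ∈ D.filt m := by
  induction n generalizing X with
  | zero => rfl
  | succ n ih =>
    rw [pow_succ]
    show ((D.twist ^ n) (D.twist X) : Module.End ℂ Δ.smooth) ∈ D.filt m ↔ _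
    rw [ih, D.twist_mem_filt_iff]

theorem twist_pow_apply_eigenvector (n : ℕ) {X : D.alg} {μ : ℂ} (h : D.twist X = μ • X) :
    (D.twist ^ n) X = μ ^ n • X := by
  induction n with
  | zero => simp
  | succ n ih =>
    rw [pow_succ]
    show (D.twist ^ n) (D.twist X) = _
    rw [h, map_smul, ih, smul_smul, pow_succ']

theorem mem_alg_of_mem_filt {m : ℕ} {X : Module.End ℂ Δ.smooth} (h : X ∈ D.filt m) :
    X ∈ D.alg := (D.mem_alg_iff X).mpr ⟨m, h⟩

/-- The operators `∑ Xᵢ Δⁱ` of total order at most `b`, where `Xᵢ` is in the algebra and `Δ` has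
order `r`. The algebra itself need not contain `Δ`. -/
def opsOfOrder (b : ℕ) : Submodule ℂ (Module.End ℂ Δ.smooth) :=
  Submodule.span ℂ {T | ∃ l i X, X ∈ D.filt l ∧ l + r * i ≤ b ∧ T = X * Δ.onSmooth ^ i}

theorem mul_onSmooth_pow_mem_opsOfOrder {b l i : ℕ} {X : Module.End ℂ Δ.smooth} (hX : X ∈ D.filt l)
    (h : l + r * i ≤ b) : X * Δ.onSmooth ^ i ∈ D.opsOfOrder b :=
  Submodule.subset_span ⟨l, i, X, hX, h, rfl⟩

theorem mem_opsOfOrder_of_mem_filt {b l : ℕ} {X : Module.End ℂ Δ.smooth} (hX : X ∈ D.filt l)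
    (h : l ≤ b) : X ∈ D.opsOfOrder b := by
  simpa using D.mul_onSmooth_pow_mem_opsOfOrder (i := 0) hX (by simpa using h)

theorem opsOfOrder_mono : Monotone D.opsOfOrder := fun _ _ h =>
  Submodule.span_mono fun _ ⟨l, i, X, hX, hb, hT⟩ => ⟨l, i, X, hX, hb.trans h, hT⟩

theorem mul_onSmooth_pow_mem {b : ℕ} {T : Module.End ℂ Δ.smooth} (hT : T ∈ D.opsOfOrder b) (j : ℕ) :
    T * Δ.onSmooth ^ j ∈ D.opsOfOrder (b + r * j) := by
  induction hT using Submodule.span_induction with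
  | mem T h =>
    obtain ⟨l, i, X, hX, hb, rfl⟩ := h
    rw [mul_assoc, ← pow_add]
    exact D.mul_onSmooth_pow_mem_opsOfOrder hX (by rw [mul_add]; omega)
  | zero => rw [zero_mul]; exact Submodule.zero_mem _
  | add T T' _ _ h h' => rw [add_mul]; exact Submodule.add_mem _ h h'
  | smul c T _ h => rw [smul_mul_assoc]; exact Submodule.smul_mem _ _ h

theorem onSmooth_mul_mem {b : ℕ} {T : Module.End ℂ Δ.smooth} (hT : T ∈ D.opsOfOrder b) :
    Δ.onSmooth * T ∈ D.opsOfOrder (b + r) := by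
  induction hT using Submodule.span_induction with
  | mem T h =>
    obtain ⟨l, i, X, hX, hb, rfl⟩ := h
    have h1 := D.twistedCommutator_mem l ⟨X, D.mem_alg_of_mem_filt hX⟩ hX
    have h2 := (D.twist_pow_mem_filt_iff r l ⟨X, D.mem_alg_of_mem_filt hX⟩).mpr hX
    set X' : D.alg := (D.twist ^ r) ⟨X, D.mem_alg_of_mem_filt hX⟩
    have e : Δ.onSmooth * (X * Δ.onSmooth ^ i)
        = (Δ.onSmooth * X - (X' : Module.End ℂ Δ.smooth) * Δ.onSmooth) * Δ.onSmooth ^ i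
          + (X' : Module.End ℂ Δ.smooth) * Δ.onSmooth ^ (i + 1) := by
      rw [sub_mul, pow_succ']; simp only [mul_assoc]; abel
    rw [e]
    exact Submodule.add_mem _ (D.mul_onSmooth_pow_mem_opsOfOrder h1 (by omega))
      (D.mul_onSmooth_pow_mem_opsOfOrder h2 (by rw [mul_add]; omega))
  | zero => rw [mul_zero]; exact Submodule.zero_mem _
  | add T T' _ _ h h' => rw [mul_add]; exact Submodule.add_mem _ h h'
  | smul c T _ h => rw [mul_smul_comm]; exact Submodule.smul_mem _ _ h

theorem onSmooth_pow_mul_mem {b : ℕ} {T : Module.End ℂ Δ.smooth} (hT : T ∈ D.opsOfOrder b) (a : ℕ) :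
    Δ.onSmooth ^ a * T ∈ D.opsOfOrder (b + r * a) := by
  induction a with
  | zero => simpa using hT
  | succ a ih =>
    rw [pow_succ', mul_assoc]
    have := D.onSmooth_mul_mem ih
    rwa [add_assoc] at this

/-- The elliptic estimate, in terms of bounded operators. -/
theorem exists_extendsSmooth_filt (hr : r ≠ 0) {l e : ℕ} {X : Module.End ℂ Δ.smooth}
    (hX : X ∈ D.filt l) (h : l ≤ r * e) :
    ∃ B : H →L[ℂ] H, ExtendsSmooth B (X * Δ.invOnSmooth ^ e) := by
  obtain ⟨C, hC, hbd⟩ := D.elliptic (r * e) X (D.filt_mono h hX)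
  have he : ((r * e : ℕ) : ℂ) / r = e := by
    have : (r : ℂ) ≠ 0 := by exact_mod_cast hr
    push_cast
    field_simp
  rw [he, Δ.cpow_natCast] at hbd
  refine exists_extendsSmooth_of_bound (C := C) fun v => ?_
  have h1 := hbd ((Δ.invOnSmooth ^ e) v)
  have h2 : (Δ.onSmooth ^ e) ((Δ.invOnSmooth ^ e) v) = v :=
    congrArg (fun T : Module.End ℂ Δ.smooth => T v) (Δ.onSmooth_pow_mul_invOnSmooth_pow e)
  rwa [h2] at h1

/-- An operator of order at most `r e` becomes bounded after multiplication by `Δ⁻ᵉ` on the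
right. -/
theorem exists_extendsSmooth_opsOfOrder (hr : r ≠ 0) {b e : ℕ} {T : Module.End ℂ Δ.smooth}
    (hT : T ∈ D.opsOfOrder b) (h : b ≤ r * e) :
    ∃ B : H →L[ℂ] H, ExtendsSmooth B (T * Δ.invOnSmooth ^ e) := by
  induction hT using Submodule.span_induction with
  | mem T hT =>
    obtain ⟨l, i, X, hX, hb, rfl⟩ := hT
    have hie : i ≤ e := Nat.le_of_mul_le_mul_left (by omega : r * i ≤ r * e) (Nat.pos_of_ne_zero hr)
    obtain ⟨j, rfl⟩ := Nat.exists_eq_add_of_le hie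
    rw [mul_assoc, Δ.onSmooth_pow_mul_invOnSmooth_pow_add]
    exact D.exists_extendsSmooth_filt hr hX (by rw [mul_add] at h; omega)
  | zero => exact ⟨0, by rw [zero_mul]; exact extendsSmooth_zero⟩
  | add T T' _ _ h h' =>
    obtain ⟨B, hB⟩ := h
    obtain ⟨B', hB'⟩ := h'
    exact ⟨B + B', by rw [add_mul]; exact hB.add hB'⟩
  | smul c T _ h =>
    obtain ⟨B, hB⟩ := h
    exact ⟨c • B, by rw [smul_mul_assoc]; exact hB.smul c⟩

/-- Multiplication by a power of `Δ⁻¹` on the left also makes an operator of the algebra bounded: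
the twisted commutation relation turns `Δ⁻¹ X` into `X' Δ⁻¹ - Δ⁻¹ X'' Δ⁻¹`, where the order is
traded for powers of `Δ⁻¹` on the right. -/
theorem exists_extendsSmooth_left_aux (hr : r ≠ 0) (c : ℕ) : ∀ {l i : ℕ}
    {X : Module.End ℂ Δ.smooth}, X ∈ D.filt l → l ≤ r * i + c →
    ∃ B : H →L[ℂ] H, ExtendsSmooth B (Δ.invOnSmooth ^ c * X * Δ.invOnSmooth ^ i) := by
  induction c with
  | zero =>
    intro l i X hX h
    rw [pow_zero, one_mul]
    exact D.exists_extendsSmooth_filt hr hX h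
  | succ c ih =>
    intro l i X hX h
    set X₀ : D.alg := ⟨X, D.mem_alg_of_mem_filt hX⟩
    set X' : D.alg := (D.twist ^ r).symm X₀ with hX'
    have hXX' : (D.twist ^ r) X' = X₀ := (D.twist ^ r).apply_symm_apply X₀
    have hX'm : (X' : Module.End ℂ Δ.smooth) ∈ D.filt l := by
      rw [← D.twist_pow_mem_filt_iff r, hXX']; exact hX
    have hX'' := D.twistedCommutator_mem l X' hX'm
    rw [hXX'] at hX''
    set X'' := Δ.onSmooth * (X' : Module.End ℂ Δ.smooth) - (X₀ : Module.End ℂ Δ.smooth) * Δ.onSmooth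
      with hdef
    obtain ⟨B₁, hB₁⟩ := ih hX'm (i := i + 1) (by rw [mul_add]; omega)
    obtain ⟨B₂, hB₂⟩ := ih hX'' (i := i + 1) (by rw [mul_add]; omega)
    have hK : ExtendsSmooth Δ.inv Δ.invOnSmooth := fun v => (Δ.coe_invOnSmooth v).symm
    refine ⟨B₁ + (-1 : ℂ) • (Δ.inv * B₂), ?_⟩
    have e : Δ.invOnSmooth ^ (c + 1) * X * Δ.invOnSmooth ^ i
        = Δ.invOnSmooth ^ c * (X' : Module.End ℂ Δ.smooth) * Δ.invOnSmooth ^ (i + 1)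
          + (-1 : ℂ) • (Δ.invOnSmooth * (Δ.invOnSmooth ^ c * X'' * Δ.invOnSmooth ^ (i + 1))) := by
      have e1 : Δ.invOnSmooth * (Δ.invOnSmooth ^ c * X'' * Δ.invOnSmooth ^ (i + 1))
          = Δ.invOnSmooth ^ c * (Δ.invOnSmooth * Δ.onSmooth) * (X' : Module.End ℂ Δ.smooth)
              * Δ.invOnSmooth ^ (i + 1)
            - Δ.invOnSmooth ^ (c + 1) * X * (Δ.onSmooth * Δ.invOnSmooth) * Δ.invOnSmooth ^ i := by
        rw [hdef, pow_succ' _ i, pow_succ _ c, mul_sub, sub_mul, mul_sub]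
        simp only [← mul_assoc]
        rw [(Commute.self_pow Δ.invOnSmooth c).eq]
      rw [e1, Δ.invOnSmooth_mul_onSmooth, Δ.onSmooth_mul_invOnSmooth, mul_one, mul_one]
      module
    rw [e]
    exact hB₁.add ((hK.mul hB₂).smul (-1))

theorem exists_extendsSmooth_left (hr : r ≠ 0) {m : ℕ} {X : Module.End ℂ Δ.smooth}
    (hX : X ∈ D.filt m) : ∃ B : H →L[ℂ] H, ExtendsSmooth B (Δ.invOnSmooth ^ m * X) := by
  simpa using D.exists_extendsSmooth_left_aux hr m (i := 0) hX (by simp)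

/-- For an eigenvector of the twist, commuting past `Δⁿ` costs a scalar, up to operators of lower
order. -/
theorem onSmooth_pow_mul_sub_mem (hr : r ≠ 0) {l n : ℕ} (hn : 1 ≤ n) {X : D.alg} {μ : ℂ}
    (hX : (X : Module.End ℂ Δ.smooth) ∈ D.filt l) (hμ : D.twist X = μ • X) :
    Δ.onSmooth ^ n * (X : Module.End ℂ Δ.smooth)
      - (μ ^ r) ^ n • ((X : Module.End ℂ Δ.smooth) * Δ.onSmooth ^ n)
      ∈ D.opsOfOrder (l + r * n - 1) := by
  have h1 := D.twistedCommutator_mem l X hX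
  rw [D.twist_pow_apply_eigenvector r hμ] at h1
  have h1' : Δ.onSmooth * (X : Module.End ℂ Δ.smooth)
      - μ ^ r • ((X : Module.End ℂ Δ.smooth) * Δ.onSmooth) ∈ D.filt (l + r - 1) := by
    rw [← smul_mul_assoc]; exact h1
  induction n, hn using Nat.le_induction with
  | base => simpa using D.mem_opsOfOrder_of_mem_filt h1' le_rfl
  | succ n hn ih =>
    have e : Δ.onSmooth ^ (n + 1) * (X : Module.End ℂ Δ.smooth)
        - (μ ^ r) ^ (n + 1) • ((X : Module.End ℂ Δ.smooth) * Δ.onSmooth ^ (n + 1))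
        = Δ.onSmooth * (Δ.onSmooth ^ n * (X : Module.End ℂ Δ.smooth)
            - (μ ^ r) ^ n • ((X : Module.End ℂ Δ.smooth) * Δ.onSmooth ^ n))
          + (μ ^ r) ^ n • ((Δ.onSmooth * (X : Module.End ℂ Δ.smooth)
            - μ ^ r • ((X : Module.End ℂ Δ.smooth) * Δ.onSmooth)) * Δ.onSmooth ^ n) := by
      rw [mul_sub, sub_mul, smul_sub, mul_smul_comm, smul_mul_assoc, smul_smul, ← pow_succ,
        pow_succ' Δ.onSmooth]
      simp only [mul_assoc]
      abel
    rw [e]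
    have hrn : r ≤ r * n := Nat.le_mul_of_pos_right r (by omega)
    refine Submodule.add_mem _ ?_ (Submodule.smul_mem _ _ ?_)
    · exact D.opsOfOrder_mono (by rw [mul_add]; omega) (D.onSmooth_mul_mem ih)
    · exact D.mul_onSmooth_pow_mem_opsOfOrder h1' (by rw [mul_add]; omega)

/-- If the twist is diagonalizable, then additive statements about the elements of order at most `l`
need only be checked on eigenvectors of the twist, because the filtration is invariant. The
eigenvalue `0` does not occur, since the twist is injective. -/
theorem filt_induction (hdiag : IsDiagonalizableMap (V := D.alg) D.twist.toLinearMap) {l : ℕ}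
    {P : Module.End ℂ Δ.smooth → Prop} (h0 : P 0) (hadd : ∀ X Y, X ∈ D.filt l → Y ∈ D.filt l →
      P X → P Y → P (X + Y))
    (h : ∀ (X : D.alg) (μ : ℂ), (X : Module.End ℂ Δ.smooth) ∈ D.filt l → μ ≠ 0 →
      D.twist X = μ • X → P X)
    {X : Module.End ℂ Δ.smooth} (hX : X ∈ D.filt l) : P X := by
  classical
  let p : Submodule ℂ D.alg := (D.filt l).comap D.alg.toSubmodule.subtype
  obtain ⟨s, y, hy, hsum⟩ := hdiag.exists_sum_eq (p := p)
    (fun x hx => (D.twist_mem_filt_iff l x).mpr hx) (x := ⟨X, D.mem_alg_of_mem_filt hX⟩) hX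
  have hsum' : X = ∑ μ ∈ s, ((y μ : D.alg) : Module.End ℂ Δ.smooth) := by
    have := congrArg (D.alg.toSubmodule.subtype) hsum
    rw [map_sum] at this
    exact this.symm
  have key : ∀ t ⊆ s, (∑ μ ∈ t, ((y μ : D.alg) : Module.End ℂ Δ.smooth)) ∈ D.filt l ∧
      P (∑ μ ∈ t, ((y μ : D.alg) : Module.End ℂ Δ.smooth)) := by
    intro t
    induction t using Finset.induction_on with
    | empty => intro _; simpa using h0
    | insert μ t hμ ih =>
      intro hts
      have hμs := hts (Finset.mem_insert_self μ t)
      obtain ⟨h1, h2⟩ := ih fun x hx => hts (Finset.mem_insert_of_mem hx)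
      obtain ⟨h3, h4⟩ := hy μ hμs
      rw [Finset.sum_insert hμ]
      refine ⟨Submodule.add_mem _ h4 h1, hadd _ _ h4 h1 ?_ h2⟩
      by_cases hμ0 : μ = 0
      · have : y μ = 0 := by
          rw [hμ0, zero_smul] at h3
          rw [hμ0]
          exact D.twist.map_eq_zero_iff.mp h3
        rw [this]; exact h0
      · exact h _ μ h4 hμ0 h3
  rw [hsum']
  exact (key s subset_rfl).2

theorem opsOfOrder_induction (hdiag : IsDiagonalizableMap (V := D.alg) D.twist.toLinearMap) {b : ℕ}
    {P : Module.End ℂ Δ.smooth → Prop} (h0 : P 0) (hadd : ∀ T T', P T → P T' → P (T + T'))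
    (h : ∀ (X : D.alg) (μ : ℂ) (l i : ℕ), (X : Module.End ℂ Δ.smooth) ∈ D.filt l →
      l + r * i ≤ b → μ ≠ 0 → D.twist X = μ • X → P (X * Δ.onSmooth ^ i))
    {T : Module.End ℂ Δ.smooth} (hT : T ∈ D.opsOfOrder b) : P T := by
  have hgen : ∀ l i X, X ∈ D.filt l → l + r * i ≤ b → P (X * Δ.onSmooth ^ i) := by
    intro l i X hX hb
    refine D.filt_induction hdiag (P := fun X => P (X * Δ.onSmooth ^ i))
      (by simpa using h0) ?_ ?_ hX
    · intro X Y _ _ hX hY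
      rw [add_mul]; exact hadd _ _ hX hY
    · exact fun X μ hX hμ hXμ => h X μ l i hX hb hμ hXμ
  induction hT using Submodule.closure_induction with
  | zero => exact h0
  | add T T' _ _ hT hT' => exact hadd T T' hT hT'
  | smul_mem c T hT =>
    obtain ⟨l, i, X, hX, hb, rfl⟩ := hT
    rw [← smul_mul_assoc]
    exact hgen l i _ (Submodule.smul_mem _ c hX) hb

end TwistedDOAlgebra

/-! ### Residues and continued Mellin transforms -/

section Residues

open Filter Set

/-- The residue of `f` at a pole `z₀` of order at most one, as the limit of `(z - z₀) f z`. The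
value `f z₀` plays no role. -/
def HasSimpleResidue (f : ℂ → ℂ) (z₀ a : ℂ) : Prop :=
  Tendsto (fun z => (z - z₀) * f z) (𝓝[≠] z₀) (𝓝 a)

theorem HasSimpleResidue.isResidueAt {f : ℂ → ℂ} {z₀ a : ℂ} (hf : MeromorphicAt f z₀)
    (h : HasSimpleResidue f z₀ a) : IsResidueAt f z₀ a := by
  set g : ℂ → ℂ := Function.update (fun z => (z - z₀) * f z) z₀ a with hg
  have hgf : g =ᶠ[𝓝[≠] z₀] fun z => (z - z₀) * f z := by
    filter_upwards [self_mem_nhdsWithin] with z hz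
    exact Function.update_of_ne hz _ _
  have hgm : MeromorphicAt g z₀ := by
    refine MeromorphicAt.congr ?_ hgf.symm
    exact (MeromorphicAt.sub (MeromorphicAt.id z₀) (MeromorphicAt.const z₀ z₀)).mul hf
  have hgc : ContinuousAt g z₀ := continuousAt_update_same.mpr h
  have hga := hgm.analyticAt hgc
  obtain ⟨R, hR, hball⟩ := Metric.eventually_nhds_iff_ball.mp hga.eventually_analyticAt
  filter_upwards [Ioo_mem_nhdsGT hR] with ε hε
  have hsub : Metric.closedBall z₀ ε ⊆ Metric.ball z₀ R := Metric.closedBall_subset_ball hε.2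
  have hd : DifferentiableOn ℂ g (Metric.closedBall z₀ ε) := fun z hz =>
    (hball z (hsub hz)).differentiableAt.differentiableWithinAt
  have hc := hd.circleIntegral_sub_inv_smul (Metric.mem_ball_self hε.1)
  have hgz : g z₀ = a := by simp [hg]
  rw [hgz, smul_eq_mul] at hc
  rw [← hc]
  refine circleIntegral.integral_congr hε.1.le fun z hz => ?_
  have hz0 : z ≠ z₀ := by
    rintro rfl
    rw [Metric.mem_sphere, dist_self] at hz
    exact hε.1.ne hz
  have : g z = (z - z₀) * f z := Function.update_of_ne hz0 _ _
  rw [smul_eq_mul, this, inv_mul_cancel_left₀ (sub_ne_zero.mpr hz0)]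

/-- Where `f` has a pole of order at most one, `(z - z₀) f z` has nonnegative order, hence a limit.
-/
theorem HasOnlySimplePoles.exists_hasSimpleResidue {f : ℂ → ℂ} (hs : HasOnlySimplePoles f)
    (hf : Meromorphic f) (z₀ : ℂ) : ∃ a, HasSimpleResidue f z₀ a := by
  have h1 : MeromorphicAt (fun z : ℂ => z - z₀) z₀ :=
    MeromorphicAt.sub (MeromorphicAt.id z₀) (MeromorphicAt.const z₀ z₀)
  refine tendsto_nhds_of_meromorphicOrderAt_nonneg (f := (fun z : ℂ => z - z₀) * f)
    (h1.mul (hf z₀)) ?_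
  rw [meromorphicOrderAt_mul h1 (hf z₀), meromorphicOrderAt_id_sub_const]
  calc (0 : WithTop ℤ) = 1 + (-1 : ℤ) := by norm_cast
    _ ≤ _ := by gcongr; exact hs z₀

theorem HasSimpleResidue.unique {f g : ℂ → ℂ} {z₀ a b : ℂ} (hf : HasSimpleResidue f z₀ a)
    (hg : HasSimpleResidue g z₀ b) (h : f =ᶠ[𝓝[≠] z₀] g) : a = b := by
  refine tendsto_nhds_unique hf (hg.congr' ?_)
  filter_upwards [h] with z hz
  rw [hz]

theorem HasSimpleResidue.congr {f g : ℂ → ℂ} {z₀ a : ℂ} (hf : HasSimpleResidue f z₀ a)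
    (h : f =ᶠ[𝓝[≠] z₀] g) : HasSimpleResidue g z₀ a := by
  refine Tendsto.congr' ?_ hf
  filter_upwards [h] with z hz
  rw [hz]

theorem HasSimpleResidue.add {f g : ℂ → ℂ} {z₀ a b : ℂ} (hf : HasSimpleResidue f z₀ a)
    (hg : HasSimpleResidue g z₀ b) : HasSimpleResidue (fun z => f z + g z) z₀ (a + b) := by
  refine (Tendsto.add hf hg).congr fun z => ?_
  ring

theorem HasSimpleResidue.const_mul {f : ℂ → ℂ} {z₀ a : ℂ} (c : ℂ) (hf : HasSimpleResidue f z₀ a) :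
    HasSimpleResidue (fun z => c * f z) z₀ (c * a) := by
  refine (Tendsto.const_mul c hf).congr fun z => ?_
  ring

/-- A continuous factor multiplies the residue by its value at the pole. -/
theorem HasSimpleResidue.mul_left {f h : ℂ → ℂ} {z₀ a : ℂ} (hf : HasSimpleResidue f z₀ a)
    (hh : ContinuousAt h z₀) : HasSimpleResidue (fun z => h z * f z) z₀ (h z₀ * a) := by
  refine (Tendsto.mul (hh.tendsto.mono_left nhdsWithin_le_nhds) hf).congr fun z => ?_
  ring

theorem HasSimpleResidue.comp_affine {f : ℂ → ℂ} {c e a : ℂ} (hc : c ≠ 0)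
    (hf : HasSimpleResidue f e a) : HasSimpleResidue (fun s => f (e + c * s)) 0 (a / c) := by
  have ht : Tendsto (fun s : ℂ => e + c * s) (𝓝[≠] 0) (𝓝[≠] e) := by
    refine tendsto_nhdsWithin_of_tendsto_nhds_of_eventually_within _ ?_ ?_
    · have : Continuous fun s : ℂ => e + c * s := by fun_prop
      simpa using (this.tendsto 0).mono_left nhdsWithin_le_nhds
    · filter_upwards [self_mem_nhdsWithin] with s hs
      simp only [mem_compl_iff, mem_singleton_iff] at hs ⊢
      simpa using ⟨hc, hs⟩
  refine ((hf.comp ht).div_const c).congr fun s => ?_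
  simp only [Function.comp]
  field_simp
  ring

/-- Identity theorem: meromorphic functions on a preconnected set which agree near a point of it
agree near every point of it, with the possible exception of the point itself. -/
theorem MeromorphicOn.eventuallyEq_of_preconnected {f g : ℂ → ℂ} {U : Set ℂ}
    (hf : MeromorphicOn f U) (hg : MeromorphicOn g U) (hU : IsPreconnected U) {x y : ℂ} (hx : x ∈ U)
    (hy : y ∈ U) (h : f =ᶠ[𝓝[≠] x] g) : f =ᶠ[𝓝[≠] y] g := by
  have hfg : MeromorphicOn (f - g) U := hf.sub hg
  by_contra hne
  have hy' : meromorphicOrderAt (f - g) y ≠ ⊤ := by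
    rw [Ne, meromorphicOrderAt_eq_top_iff]
    intro h'
    exact hne (by filter_upwards [h'] with z hz using sub_eq_zero.mp hz)
  have hx' := hfg.meromorphicOrderAt_ne_top_of_isPreconnected hU hy hx hy'
  rw [Ne, meromorphicOrderAt_eq_top_iff] at hx'
  exact hx' (by filter_upwards [h] with z hz using sub_eq_zero.mpr hz)

/-- The open strip `-1 < re s < 1`. -/
def unitStrip : Set ℂ := {s | -1 < s.re ∧ s.re < 1}

theorem isPreconnected_unitStrip : IsPreconnected unitStrip := by
  have : unitStrip = Complex.reCLM ⁻¹' Ioo (-1) 1 := rfl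
  rw [this]
  exact ((convex_Ioo (-1 : ℝ) 1).linear_preimage Complex.reCLM.toLinearMap).isPreconnected

theorem isOpen_unitStrip : IsOpen unitStrip :=
  (isOpen_lt continuous_const Complex.continuous_re).inter
    (isOpen_lt Complex.continuous_re continuous_const)

/-- The integral in `s ∫ t ^ (-s) f t` converges for `β < re s < 1`, and this function of `s` has a
meromorphic continuation to the strip `-1 < re s < 1`, with at most a simple pole at `0` and residue
`a` there. -/
def HasMellinResidue (β : ℝ) (f : ℝ → ℂ) (a : ℂ) : Prop :=
  ∃ M : ℂ → ℂ, MeromorphicOn M unitStrip ∧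
    (∀ s : ℂ, β < s.re → s.re < 1 →
      MellinConvergent f (1 - s) ∧ M s = s * mellin f (1 - s)) ∧
    HasSimpleResidue M 0 a

theorem HasMellinResidue.add {β : ℝ} {f g : ℝ → ℂ} {a b : ℂ} (hf : HasMellinResidue β f a)
    (hg : HasMellinResidue β g b) : HasMellinResidue β (fun t => f t + g t) (a + b) := by
  obtain ⟨M, hM, hM', hMa⟩ := hf
  obtain ⟨N, hN, hN', hNb⟩ := hg
  refine ⟨fun s => M s + N s, hM.add hN, fun s h0 h1 => ?_, hMa.add hNb⟩
  obtain ⟨hc, he⟩ := hM' s h0 h1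
  obtain ⟨hc', he'⟩ := hN' s h0 h1
  have := hasMellin_add hc hc'
  exact ⟨this.1, by simp only [he, he', this.2]; ring⟩

theorem HasMellinResidue.const_mul {β : ℝ} {f : ℝ → ℂ} {a : ℂ} (c : ℂ)
    (hf : HasMellinResidue β f a) : HasMellinResidue β (fun t => c * f t) (c * a) := by
  obtain ⟨M, hM, hM', hMa⟩ := hf
  refine ⟨fun s => c * M s, (MeromorphicOn.const c).mul hM, fun s h0 h1 => ?_, hMa.const_mul c⟩
  obtain ⟨hc, he⟩ := hM' s h0 h1
  have := hasMellin_const_smul hc c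
  simp only [smul_eq_mul] at this
  exact ⟨this.1, by simp only [he, this.2]; ring⟩

theorem HasMellinResidue.congr {β : ℝ} {f g : ℝ → ℂ} {a : ℂ} (hf : HasMellinResidue β f a)
    (h : ∀ t, 0 < t → f t = g t) : HasMellinResidue β g a := by
  obtain ⟨M, hM, hM', hMa⟩ := hf
  refine ⟨M, hM, fun s h0 h1 => ?_, hMa⟩
  obtain ⟨hc, he⟩ := hM' s h0 h1
  have e : mellin g (1 - s) = mellin f (1 - s) :=
    MeasureTheory.setIntegral_congr_fun measurableSet_Ioi fun t ht => by simp only [h t ht]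
  refine ⟨MeasureTheory.IntegrableOn.congr_fun hc (fun t ht => ?_) measurableSet_Ioi, by rw [he, e]⟩
  simp only [h t ht]

/-- The Mellin transform determines the continuation, by the identity theorem on the strip, and so
the residue. -/
theorem HasMellinResidue.unique {β : ℝ} (hβ : 0 ≤ β) (hβ1 : β < 1) {f : ℝ → ℂ} {a b : ℂ}
    (hf : HasMellinResidue β f a) (hf' : HasMellinResidue β f b) : a = b := by
  obtain ⟨M, hM, hM', hMa⟩ := hf
  obtain ⟨N, hN, hN', hNb⟩ := hf'
  refine hMa.unique hNb ?_
  have hx : β < (((β + 1) / 2 : ℝ) : ℂ).re ∧ (((β + 1) / 2 : ℝ) : ℂ).re < 1 := by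
    rw [Complex.ofReal_re]; constructor <;> linarith
  refine hM.eventuallyEq_of_preconnected hN isPreconnected_unitStrip
    (x := (((β + 1) / 2 : ℝ) : ℂ)) ⟨by linarith [hx.1], hx.2⟩ (by simp [unitStrip]) ?_
  refine Filter.Eventually.filter_mono nhdsWithin_le_nhds ?_
  have ho : IsOpen {s : ℂ | β < s.re ∧ s.re < 1} :=
    (isOpen_lt continuous_const Complex.continuous_re).inter
      (isOpen_lt Complex.continuous_re continuous_const)
  filter_upwards [ho.mem_nhds hx] with s hs
  rw [(hM' s hs.1 hs.2).2, (hN' s hs.1 hs.2).2]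

/-- A bounded function which is `O(t⁻²)` contributes no residue. -/
theorem hasMellinResidue_zero_of_bounded {β : ℝ} (hβ : 0 ≤ β) {f : ℝ → ℂ} {C : ℝ}
    (hf : ContinuousOn f (Ioi 0)) (h0 : ∀ t, 0 < t → ‖f t‖ ≤ C)
    (h1 : ∀ t, 0 < t → ‖f t‖ ≤ C * t ^ (-(2 : ℝ))) : HasMellinResidue β f 0 := by
  have hd : ∀ s ∈ unitStrip, DifferentiableAt ℂ (fun s => s * mellin f (1 - s)) s := by
    intro s hs
    have h := differentiableAt_mellin_of_bounded (s := 1 - s) hf h0 h1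
      (by simp; linarith [hs.2]) (by simp; linarith [hs.1])
    exact differentiableAt_id.mul (h.comp s (by fun_prop))
  have hA : AnalyticOnNhd ℂ (fun s => s * mellin f (1 - s)) unitStrip :=
    DifferentiableOn.analyticOnNhd (fun s hs => (hd s hs).differentiableWithinAt) isOpen_unitStrip
  refine ⟨fun s => s * mellin f (1 - s), hA.meromorphicOn, fun s hs0 hs1 => ⟨?_, rfl⟩, ?_⟩
  · exact mellinConvergent_of_bounded hf h0 h1 (by simp; linarith) (by simp; linarith)
  · have hc : ContinuousAt (fun s => s * mellin f (1 - s)) 0 :=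
      (hd 0 (by simp [unitStrip])).continuousAt
    have : Tendsto (fun s : ℂ => (s - 0) * (s * mellin f (1 - s))) (𝓝[≠] 0)
        (𝓝 ((0 - 0) * (0 * mellin f (1 - 0)))) :=
      ((ContinuousAt.mul (by fun_prop) hc).tendsto).mono_left nhdsWithin_le_nhds
    simpa [HasSimpleResidue] using this

/-- The contribution of a product of resolvents: the Mellin transform is, up to a scalar factor
which is regular at `0`, a translate of the function `Z` which continues `L (p ^ w)`. If there is
more than one factor, then the scalar vanishes at `0` and kills the simple pole of `Z`. -/
theorem hasMellinResidue_resolventProd {X : Type*} [TopologicalSpace X] [CompactSpace X]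
    {p : C(X, ℝ)} (hp : ∀ x, 0 ≤ p x) {n q : ℕ} (hq : 1 ≤ q) (hqn : q ≤ n) {cs : List ℂ}
    (hcs : ∀ c ∈ cs, c ∈ Complex.slitPlane) (hne : cs ≠ []) (L : C(X, ℂ) →L[ℂ] ℂ)
    {Z : ℂ → ℂ} (hZ : Meromorphic Z) {r : ℂ} (hr : r ≠ 0) {d : ℂ}
    (hL : ∀ w (hw : 0 < w.re), L (cpowFun p w hw) = Z (r * (w + d))) {a : ℂ}
    (ha : HasSimpleResidue Z (r * (q - n + d)) a) :
    HasMellinResidue (1 - (q : ℝ) / n) (fun t => L (complexify p ^ q * resolventProd p n cs t))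
      (if cs.length = 1 then a / (r * n) else 0) := by
  have hn : 0 < (n : ℝ) := by exact_mod_cast (by omega : 0 < n)
  have hn' : (n : ℂ) ≠ 0 := by exact_mod_cast hn.ne'
  obtain ⟨h, hh, hh0, hhs⟩ := exists_extension_mul_mellin_invProd hcs hne
  have hA : AnalyticOnNhd ℂ h unitStrip :=
    DifferentiableOn.analyticOnNhd (fun s hs => (hh s hs.1 hs.2).differentiableWithinAt)
      isOpen_unitStrip
  refine ⟨fun s => h s * Z (r * (q - n + d) + r * n * s), ?_, fun s hs0 hs1 => ?_, ?_⟩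
  · refine hA.meromorphicOn.mul fun s _ => ?_
    exact (hZ _).comp_analyticAt (g := fun s : ℂ => r * (q - n + d) + r * n * s) (by fun_prop)
  · have hs0' : 0 < ((q : ℂ) - n + n * s).re := by
      have h1 : (1 - (q : ℝ) / n) * n < s.re * n := mul_lt_mul_of_pos_right hs0 hn
      have h2 : (1 - (q : ℝ) / n) * n = n - q := by field_simp
      simp
      linarith
    have hqn1 : (q : ℝ) / n ≤ 1 := by rw [div_le_one hn]; exact_mod_cast hqn
    obtain ⟨hc, he⟩ := mellin_functional_resolventProd hp hq hqn hcs hne L hs1 hs0'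
    refine ⟨hc, ?_⟩
    beta_reduce
    rw [he, hL, hhs s (by linarith) hs1, mul_assoc]
    congr 3
    ring
  · have hc : ContinuousAt h 0 := (hh 0 (by simp) (by simp)).continuousAt
    have h2 := (ha.comp_affine (mul_ne_zero hr hn')).mul_left hc
    rw [hh0] at h2
    convert h2 using 1
    split_ifs <;> simp

/-- If a meromorphic function agrees with `L (p ^ w)`, up to an affine change of variables, for
large `re w`, then it does so for all `re w > 0`, after a change of its values on a discrete set. -/
theorem exists_meromorphic_eq_functional_cpowFun {X : Type*} [TopologicalSpace X] [CompactSpace X]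
    {p : C(X, ℝ)} (L : C(X, ℂ) →L[ℂ] ℂ) {Z : ℂ → ℂ} (hZ : Meromorphic Z) {r : ℝ} (hr : 0 < r)
    {d : ℝ} (h : ∃ x₁ : ℝ, ∀ w (hw : 0 < w.re), x₁ < w.re → Z (r * (w + d)) = L (cpowFun p w hw)) :
    ∃ Z' : ℂ → ℂ, Meromorphic Z' ∧ (∀ z, Z =ᶠ[𝓝[≠] z] Z') ∧
      ∀ w (hw : 0 < w.re), L (cpowFun p w hw) = Z' (r * (w + d)) := by
  classical
  obtain ⟨x₁, h⟩ := h
  have hr' : (r : ℂ) ≠ 0 := by exact_mod_cast hr.ne'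
  let F : ℂ → ℂ := fun z => L (cpowFamily p (z / r - d))
  have hre : ∀ z : ℂ, (z / r - d).re = z.re / r - d := fun z => by
    rw [Complex.sub_re, Complex.div_ofReal_re, Complex.ofReal_re]
  let U : Set ℂ := {z | 0 < (z / r - d).re}
  have hUo : IsOpen U := isOpen_lt continuous_const (by fun_prop)
  have hFd : ∀ z ∈ U, DifferentiableAt ℂ F z := fun z hz => by
    have h1 : DifferentiableAt ℂ (fun z : ℂ => z / r - d) z := by fun_prop
    have h2 : DifferentiableAt ℂ (cpowFamily p) (z / r - d) := differentiableAt_cpowFamily hz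
    have h3 : DifferentiableAt ℂ (fun z : ℂ => cpowFamily p (z / r - d)) z :=
      DifferentiableAt.comp (g := cpowFamily p) (f := fun z : ℂ => z / r - d) z h2 h1
    exact DifferentiableAt.comp (g := L) z L.differentiableAt h3
  have hFm : MeromorphicOn F U := (DifferentiableOn.analyticOnNhd
    (fun z hz => (hFd z hz).differentiableWithinAt) hUo).meromorphicOn
  have hUc : IsPreconnected U := by
    have : U = Complex.reCLM ⁻¹' Ioi (r * d) := by
      ext z
      show 0 < (z / r - d).re ↔ r * d < z.re
      rw [hre, sub_pos, lt_div_iff₀ hr, mul_comm]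
    rw [this]
    exact ((convex_Ioi (r * d)).linear_preimage Complex.reCLM.toLinearMap).isPreconnected
  -- the two functions agree far to the right, hence on the half plane up to a discrete set
  have hZF : ∀ z ∈ U, Z =ᶠ[𝓝[≠] z] F := by
    intro z hz
    let x : ℂ := ((r * (d + |x₁| + 1) : ℝ) : ℂ)
    have hx : |x₁| < (x / r - d).re := by
      rw [hre, Complex.ofReal_re, mul_div_cancel_left₀ _ hr.ne']; linarith
    have hxU : x ∈ U := lt_of_le_of_lt (abs_nonneg _) hx
    refine hZ.meromorphicOn.eventuallyEq_of_preconnected hFm hUc hxU hz ?_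
    refine Filter.Eventually.filter_mono nhdsWithin_le_nhds ?_
    have ho : IsOpen {z : ℂ | |x₁| < (z / r - d).re} := isOpen_lt continuous_const (by fun_prop)
    filter_upwards [ho.mem_nhds hx] with z hz
    have hz0 : 0 < (z / r - d).re := lt_of_le_of_lt (abs_nonneg _) hz
    have h1 := h (z / r - d) hz0 (lt_of_le_of_lt (le_abs_self _) hz)
    rw [sub_add_cancel, mul_div_cancel₀ _ hr'] at h1
    rw [h1]
    show _ = L (cpowFamily p (z / r - d))
    rw [cpowFamily_of_re_pos hz0]
  have hZZ' : ∀ z, Z =ᶠ[𝓝[≠] z] fun z => if z ∈ U then F z else Z z := by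
    intro z₀
    filter_upwards [(hZ z₀).eventually_continuousAt] with z hz
    split_ifs with hzU
    · refine tendsto_nhds_unique (hz.tendsto.mono_left nhdsWithin_le_nhds)
        (Tendsto.congr' (hZF z hzU).symm ?_)
      exact ((hFd z hzU).continuousAt.tendsto.mono_left nhdsWithin_le_nhds)
    · rfl
  refine ⟨fun z => if z ∈ U then F z else Z z, fun z => (hZ z).congr (hZZ' z), hZZ', fun w hw => ?_⟩
  have e : ((r : ℂ) * (w + d)) / r - d = w := by field_simp; ring
  have hmem : (r : ℂ) * (w + d) ∈ U := by
    show 0 < (((r : ℂ) * (w + d)) / r - d).re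
    rw [e]; exact hw
  simp only [hmem, if_true, F, e]
  rw [cpowFamily_of_re_pos hw]

end Residues

/-! ### Zeta functions -/

section Zeta

variable {H : Type*} [NormedAddCommGroup H] [InnerProductSpace ℂ H] [CompleteSpace H]
variable {Δ : AbstractLaplacian H} {r : ℕ} {ρ : ModularOperator Δ}

theorem zetaOperator_eq (hr : r ≠ 0) (X : Module.End ℂ Δ.smooth) {w : ℂ} (hw : 0 < w.re) :
    zetaOperator r ρ X (r * w)
      = ρ.onSmooth.toLinearMap * X * Δ.smoothCalculus (cpowFun Δ.specFun w hw) := by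
  have hr' : (r : ℂ) ≠ 0 := by exact_mod_cast hr
  have : -((r : ℂ) * w) / r = -w := by field_simp
  rw [zetaOperator, this, Δ.cpow_neg w hw]

/-- The operators `ρ X Δ⁻ᵃ` are trace class for large `a`. -/
theorem eventually_isTraceClassOnSmooth (hr : r ≠ 0) {X : Module.End ℂ Δ.smooth}
    (h : ∃ x₀ : ℝ, ∀ z : ℂ, x₀ < z.re → IsTraceClassOnSmooth (zetaOperator r ρ X z)) :
    ∀ᶠ a : ℕ in Filter.atTop,
      IsTraceClassOnSmooth (ρ.onSmooth.toLinearMap * X * Δ.invOnSmooth ^ a) := by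
  obtain ⟨x₀, h⟩ := h
  filter_upwards [Filter.eventually_gt_atTop 0, Filter.eventually_gt_atTop ⌈x₀⌉₊] with a ha hx
  have ha' : 0 < (a : ℂ).re := by simpa using ha
  have h1 := h (r * a) (by
    have h2 : x₀ < a := lt_of_le_of_lt (Nat.le_ceil x₀) (by exact_mod_cast hx)
    have h3 : (1 : ℝ) ≤ r := by exact_mod_cast Nat.one_le_iff_ne_zero.mpr hr
    have h4 : (0 : ℝ) ≤ a := by positivity
    have h5 : ((r : ℂ) * a).re = r * a := by simp
    rw [h5]
    nlinarith)
  rwa [zetaOperator_eq hr X ha', cpowFun_natCast, map_pow] at h1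

/-- Values of the zeta function of `Y X` in terms of the functional `B ↦ Tr (ρ Y Δ⁻ᵃ B)`. -/
theorem zetaFunction_mul_eq (hr : r ≠ 0) {X Y : Module.End ℂ Δ.smooth} {a d : ℕ} {A B : H →L[ℂ] H}
    (hA : ExtendsSmooth A (ρ.onSmooth.toLinearMap * Y * Δ.invOnSmooth ^ a))
    {τ : (H →L[ℂ] H) →L[ℂ] ℂ} (hτ : ∀ B, opTrace (A * B) = τ B)
    (hB : ExtendsSmooth B (Δ.onSmooth ^ a * X * Δ.invOnSmooth ^ d)) {w : ℂ} (hw : 0 < w.re) :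
    zetaFunction r ρ (Y * X) (r * (w + d)) = τ (B * Δ.calculus (cpowFun Δ.specFun w hw)) := by
  have hwd : 0 < (w + d).re := by
    have : (w + d).re = w.re + d := by simp
    rw [this]; positivity
  rw [← hτ, zetaFunction]
  refine smoothTrace_eq_opTrace ?_
  have h := hA.mul (hB.mul (Δ.extendsSmooth_calculus (cpowFun Δ.specFun w hw)))
  rw [zetaOperator_eq hr _ hwd, cpowFun_add_natCast hw hwd d rfl, map_mul, map_pow]
  convert h using 1
  calc ρ.onSmooth.toLinearMap * (Y * X) * (Δ.invOnSmooth ^ d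
        * Δ.smoothCalculus (cpowFun Δ.specFun w hw))
      = ρ.onSmooth.toLinearMap * Y * (Δ.invOnSmooth ^ a * Δ.onSmooth ^ a) * X * Δ.invOnSmooth ^ d
        * Δ.smoothCalculus (cpowFun Δ.specFun w hw) := by
        rw [Δ.invOnSmooth_pow_mul_onSmooth_pow, mul_one]; simp only [mul_assoc]
    _ = _ := by simp only [mul_assoc]

theorem ModularOperator.conj_mul_onSmooth (ρ : ModularOperator Δ) (X : Module.End ℂ Δ.smooth) :
    ρ.conj X * ρ.onSmooth.toLinearMap = ρ.onSmooth.toLinearMap * X := by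
  ext v
  simp [ModularOperator.conj]

/-- The twisted cyclicity of the trace, in the region of convergence:
`Tr (ρ X Y Δ⁻ˢ) = Tr (ρ Y Δ⁻ˢ ρ X ρ⁻¹)`. Splitting `Δ⁻ˢ = Δ⁻ᵇ Δ⁻ᵘ` and moving `Δ⁻ᵘ` to the front
turns the left-hand side into the trace of `(Δ⁻ᵘ ρ X ρ⁻¹) (ρ Y Δ⁻ᵇ)`, a product of a bounded and a
trace class operator, so that the unbounded operator `ρ` need not be moved. -/
theorem zetaFunction_mul_eq_twisted (hr : r ≠ 0) {X Y : Module.End ℂ Δ.smooth} {a m : ℕ}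
    {A B : H →L[ℂ] H} (hA : ExtendsSmooth A (ρ.onSmooth.toLinearMap * Y * Δ.invOnSmooth ^ a))
    {τ : (H →L[ℂ] H) →L[ℂ] ℂ} (hτ : ∀ B, opTrace (A * B) = τ B)
    (hB : ExtendsSmooth B (Δ.invOnSmooth ^ m * ρ.conj X))
    (hY : ∃ x₀ : ℝ, ∀ z : ℂ, x₀ < z.re → IsTraceClassOnSmooth (zetaOperator r ρ Y z))
    (hXY : ∃ x₀ : ℝ, ∀ z : ℂ, x₀ < z.re → IsTraceClassOnSmooth (zetaOperator r ρ (X * Y) z)) :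
    ∃ x₁ : ℝ, ∀ w (hw : 0 < w.re), x₁ < w.re → zetaFunction r ρ (X * Y) (r * (w + (a + m)))
      = τ (Δ.calculus (cpowFun Δ.specFun w hw) * B) := by
  obtain ⟨b, ⟨⟨A', hA', hA'tr⟩, ⟨T, hT, hTtr⟩⟩, hab⟩ := ((eventually_isTraceClassOnSmooth hr hY).and
    (eventually_isTraceClassOnSmooth hr hXY)).and (Filter.eventually_ge_atTop a) |>.exists
  obtain ⟨e, rfl⟩ := Nat.exists_eq_add_of_le hab
  refine ⟨e, fun w hw hwe => ?_⟩
  obtain ⟨τA, hτA⟩ := hA'tr.exists_functional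
  obtain ⟨τT, hτT⟩ := hTtr.exists_functional
  -- `w = e + u`, and the total exponent is `(a + e) + (m + u)`
  set u : ℂ := w - e with hu
  have hu0 : 0 < u.re := by simp [hu]; linarith
  have hmu : 0 < (u + m).re := by
    have : (u + m).re = u.re + m := by simp
    rw [this]; positivity
  have hwd : 0 < (w + (a + m)).re := by
    have : (w + (a + m)).re = w.re + (a + m) := by simp
    rw [this]; positivity
  have e1 : cpowFun Δ.specFun _ hwd
      = complexify Δ.specFun ^ (a + e) * cpowFun Δ.specFun (u + m) hmu :=
    cpowFun_add_natCast hmu hwd (a + e) (by rw [hu]; push_cast; ring)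
  have e2 : cpowFun Δ.specFun (u + m) hmu = complexify Δ.specFun ^ m * cpowFun Δ.specFun u hu0 :=
    cpowFun_add_natCast hu0 hmu m rfl
  have e3 : cpowFun Δ.specFun w hw = complexify Δ.specFun ^ e * cpowFun Δ.specFun u hu0 :=
    cpowFun_add_natCast hu0 hw e (by rw [hu]; ring)
  have h1 : zetaFunction r ρ (X * Y) (r * (w + (a + m)))
      = opTrace (T * Δ.calculus (cpowFun Δ.specFun (u + m) hmu)) := by
    refine smoothTrace_eq_opTrace ?_
    rw [zetaOperator_eq hr _ hwd, e1, map_mul, map_pow, ← mul_assoc]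
    exact hT.mul (Δ.extendsSmooth_calculus _)
  have h2 : Δ.calculus (cpowFun Δ.specFun (u + m) hmu) * T
      = (Δ.calculus (cpowFun Δ.specFun u hu0) * B) * A' := by
    refine ExtendsSmooth.unique ((Δ.extendsSmooth_calculus _).mul hT) ?_
    convert ((Δ.extendsSmooth_calculus _).mul hB).mul hA' using 1
    rw [e2, mul_comm (complexify Δ.specFun ^ m), map_mul, map_pow]
    have := ρ.conj_mul_onSmooth X
    calc Δ.smoothCalculus (cpowFun Δ.specFun u hu0) * Δ.invOnSmooth ^ m
          * (ρ.onSmooth.toLinearMap * (X * Y) * Δ.invOnSmooth ^ (a + e))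
        = Δ.smoothCalculus (cpowFun Δ.specFun u hu0) * Δ.invOnSmooth ^ m
          * (ρ.onSmooth.toLinearMap * X) * (Y * Δ.invOnSmooth ^ (a + e)) := by
          simp only [mul_assoc]
      _ = _ := by rw [← this]; simp only [mul_assoc]
  have h3 : A' = A * Δ.calculus (complexify Δ.specFun ^ e) := by
    refine hA'.unique ?_
    convert hA.mul (Δ.extendsSmooth_calculus (complexify Δ.specFun ^ e)) using 1
    rw [map_pow, pow_add]
    simp only [mul_assoc]
    rfl
  rw [h1, (hτT _).2.1, ← (hτT _).2.2, h2, (hτA _).2.2, ← (hτA _).2.1, h3, ← hτ, e3, map_mul]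
  simp only [mul_assoc]

theorem IsTraceClassOnSmooth.smoothTrace_add {A A' : Module.End ℂ Δ.smooth}
    (h : IsTraceClassOnSmooth A) (h' : IsTraceClassOnSmooth A') :
    smoothTrace (A + A') = smoothTrace A + smoothTrace A' := by
  obtain ⟨T, hT, hTtr⟩ := h
  obtain ⟨T', hT', hTtr'⟩ := h'
  obtain ⟨τ, hτ⟩ := hTtr.exists_functional
  obtain ⟨τ', hτ'⟩ := hTtr'.exists_functional
  rw [smoothTrace_eq_opTrace (hT.add hT'), smoothTrace_eq_opTrace hT, smoothTrace_eq_opTrace hT']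
  have h1 := (hτ 1).1
  have h2 := (hτ' 1).1
  rw [mul_one] at h1 h2
  rw [opTrace, opTrace, opTrace, ← h1.tsum_add h2]
  exact tsum_congr fun i => by rw [← inner_add_right]; rfl

theorem IsTraceClassOnSmooth.smoothTrace_smul {A : Module.End ℂ Δ.smooth} (c : ℂ)
    (h : IsTraceClassOnSmooth A) : smoothTrace (c • A) = c * smoothTrace A := by
  obtain ⟨T, hT, hTtr⟩ := h
  rw [smoothTrace_eq_opTrace (hT.smul c), smoothTrace_eq_opTrace hT, opTrace, opTrace,
    ← tsum_mul_left]
  exact tsum_congr fun i => by rw [← inner_smul_right]; rfl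

theorem IsZetaContinuation.add {X X' : Module.End ℂ Δ.smooth} {Z Z' : ℂ → ℂ}
    (h : ∃ x₀ : ℝ, ∀ z : ℂ, x₀ < z.re → IsTraceClassOnSmooth (zetaOperator r ρ X z))
    (h' : ∃ x₀ : ℝ, ∀ z : ℂ, x₀ < z.re → IsTraceClassOnSmooth (zetaOperator r ρ X' z))
    (hZ : IsZetaContinuation r ρ X Z) (hZ' : IsZetaContinuation r ρ X' Z') :
    IsZetaContinuation r ρ (X + X') (fun z => Z z + Z' z) := by
  obtain ⟨x, hx⟩ := h
  obtain ⟨x', hx'⟩ := h'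
  obtain ⟨hZm, y, hy⟩ := hZ
  obtain ⟨hZm', y', hy'⟩ := hZ'
  refine ⟨hZm.add hZm', max (max x x') (max y y'), fun z hz => ?_⟩
  simp only [max_lt_iff] at hz
  have e : zetaOperator r ρ (X + X') z = zetaOperator r ρ X z + zetaOperator r ρ X' z := by
    simp only [zetaOperator, mul_add, add_mul]
  beta_reduce
  rw [zetaFunction, e, (hx z hz.1.1).smoothTrace_add (hx' z hz.1.2), hy z hz.2.1, hy' z hz.2.2]
  rfl

theorem IsZetaContinuation.smul {X : Module.End ℂ Δ.smooth} {Z : ℂ → ℂ} (c : ℂ)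
    (h : ∃ x₀ : ℝ, ∀ z : ℂ, x₀ < z.re → IsTraceClassOnSmooth (zetaOperator r ρ X z))
    (hZ : IsZetaContinuation r ρ X Z) : IsZetaContinuation r ρ (c • X) (fun z => c * Z z) := by
  obtain ⟨x, hx⟩ := h
  obtain ⟨hZm, y, hy⟩ := hZ
  refine ⟨(Meromorphic.const c).mul hZm, max x y, fun z hz => ?_⟩
  simp only [max_lt_iff] at hz
  have e : zetaOperator r ρ (c • X) z = c • zetaOperator r ρ X z := by
    simp only [zetaOperator, mul_smul_comm, smul_mul_assoc]
  beta_reduce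
  rw [zetaFunction, e, (hx z hz.1).smoothTrace_smul, hy z hz.2]
  rfl

/-- Two continuations of the same zeta function agree away from a discrete set. -/
theorem IsZetaContinuation.eventuallyEq {X : Module.End ℂ Δ.smooth} {Z Z' : ℂ → ℂ}
    (hZ : IsZetaContinuation r ρ X Z) (hZ' : IsZetaContinuation r ρ X Z') (z : ℂ) :
    Z =ᶠ[𝓝[≠] z] Z' := by
  obtain ⟨hZm, y, hy⟩ := hZ
  obtain ⟨hZm', y', hy'⟩ := hZ'
  refine hZm.meromorphicOn.eventuallyEq_of_preconnected (U := Set.univ) hZm'.meromorphicOn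
    isPreconnected_univ (x := ((max y y' + 1 : ℝ) : ℂ)) trivial trivial ?_
  refine Filter.Eventually.filter_mono nhdsWithin_le_nhds ?_
  have ho : IsOpen {z : ℂ | max y y' < z.re} := isOpen_lt continuous_const Complex.continuous_re
  filter_upwards [ho.mem_nhds (show max y y' < ((max y y' + 1 : ℝ) : ℂ).re by simp)] with z hz
  rw [hy z ((le_max_left _ _).trans_lt hz), hy' z ((le_max_right _ _).trans_lt hz)]

/-- The residue functional: for every continuation of the zeta function of `X`, its residue at `0`
is `Φ X`. -/
theorem exists_residueFunctional (D : TwistedDOAlgebra Δ r)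
    (htrace : ∀ X ∈ D.alg, ∃ x₀ : ℝ, ∀ z : ℂ, x₀ < z.re →
      IsTraceClassOnSmooth (zetaOperator r ρ X z))
    (hmero : ∀ X ∈ D.alg, ∃ Z : ℂ → ℂ, IsZetaContinuation r ρ X Z ∧ HasOnlySimplePoles Z) :
    ∃ Φ : D.alg →ₗ[ℂ] ℂ, ∀ (X : D.alg) (Z : ℂ → ℂ),
      IsZetaContinuation r ρ (X : Module.End ℂ Δ.smooth) Z → HasSimpleResidue Z 0 (Φ X) := by
  have h : ∀ X : D.alg, ∃ a : ℂ, ∀ Z : ℂ → ℂ,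
      IsZetaContinuation r ρ (X : Module.End ℂ Δ.smooth) Z → HasSimpleResidue Z 0 a := by
    intro X
    obtain ⟨Z, hZ, hZs⟩ := hmero X X.2
    obtain ⟨a, ha⟩ := hZs.exists_hasSimpleResidue hZ.1 0
    exact ⟨a, fun Z' hZ' => ha.congr (hZ.eventuallyEq hZ' 0)⟩
  choose Φ hΦ using h
  refine ⟨{ toFun := Φ, map_add' := fun X Y => ?_, map_smul' := fun c X => ?_ }, hΦ⟩
  · obtain ⟨Z, hZ, -⟩ := hmero X X.2
    obtain ⟨Z', hZ', -⟩ := hmero Y Y.2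
    exact (hΦ (X + Y) _ (IsZetaContinuation.add (htrace X X.2) (htrace Y Y.2) hZ hZ')).unique
      ((hΦ X Z hZ).add (hΦ Y Z' hZ')) (Filter.EventuallyEq.refl _ _)
  · obtain ⟨Z, hZ, -⟩ := hmero X X.2
    exact (hΦ (c • X) _ (IsZetaContinuation.smul c (htrace X X.2) hZ)).unique
      ((hΦ X Z hZ).const_mul c) (Filter.EventuallyEq.refl _ _)

end Zeta

/-! ### The resolvent expansion -/

section Expansion

open Filter

variable {H : Type*} [NormedAddCommGroup H] [InnerProductSpace ℂ H] [CompleteSpace H]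
variable {Δ : AbstractLaplacian H}

/-- The operator `Δᵃ (t + c Δⁿ)⁻¹ T ∏ (t + cᵢ Δⁿ)⁻¹` on the smooth vectors. Each resolvent is
written as `p ^ n (t p ^ n + c)⁻¹`, a continuous function of `p = Δ⁻¹`. -/
def sandwich (Δ : AbstractLaplacian H) (a n : ℕ) (c : ℂ) (cs : List ℂ)
    (T : Module.End ℂ Δ.smooth) (t : ℝ) : Module.End ℂ Δ.smooth :=
  Δ.onSmooth ^ a * Δ.smoothCalculus (complexify Δ.specFun ^ n * resolventFun Δ.specFun n c t) * T *
    Δ.smoothCalculus (complexify Δ.specFun ^ (n * cs.length) * resolventProd Δ.specFun n cs t)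

theorem sandwich_add (a n : ℕ) (c : ℂ) (cs : List ℂ) (T T' : Module.End ℂ Δ.smooth) (t : ℝ) :
    sandwich Δ a n c cs (T + T') t = sandwich Δ a n c cs T t + sandwich Δ a n c cs T' t := by
  simp only [sandwich, mul_add, add_mul]

theorem resolvent_mul_add (n : ℕ) {c : ℂ} (hc : c ∈ Complex.slitPlane) {t : ℝ} (ht : 0 ≤ t) :
    Δ.smoothCalculus (complexify Δ.specFun ^ n * resolventFun Δ.specFun n c t)
      * ((t : ℂ) • 1 + c • Δ.onSmooth ^ n) = 1 := by
  have h1 := congrArg Δ.smoothCalculus (resolventFun_mul_cancel Δ.specFun_nonneg n hc ht)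
  rw [map_mul, map_add, map_smul, map_pow, AlgHom.commutes, map_one] at h1
  have h2 : (t : ℂ) • (1 : Module.End ℂ Δ.smooth) + c • Δ.onSmooth ^ n
      = ((t : ℂ) • Δ.invOnSmooth ^ n + algebraMap ℂ _ c) * Δ.onSmooth ^ n := by
    rw [add_mul, smul_mul_assoc, Δ.invOnSmooth_pow_mul_onSmooth_pow, Algebra.algebraMap_eq_smul_one,
      smul_mul_assoc, one_mul]
  have h3 : Commute (Δ.smoothCalculus (complexify Δ.specFun ^ n))
      (Δ.smoothCalculus (resolventFun Δ.specFun n c t)) := (Commute.all _ _).map Δ.smoothCalculus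
  rw [h2, map_mul, h3.eq, mul_assoc, ← mul_assoc _ _ (Δ.onSmooth ^ n)]
  have h4 : Commute (Δ.smoothCalculus (complexify Δ.specFun ^ n))
      ((t : ℂ) • Δ.invOnSmooth ^ n + algebraMap ℂ _ c) := by
    rw [map_pow]
    refine Commute.add_right ((Commute.refl _).smul_right _) ?_
    exact (Algebra.commutes c _).symm
  rw [h4.eq, ← mul_assoc, ← mul_assoc, AbstractLaplacian.invOnSmooth, h1, one_mul, map_pow]
  exact Δ.invOnSmooth_pow_mul_onSmooth_pow n

theorem add_mul_resolvent (n : ℕ) {c : ℂ} (hc : c ∈ Complex.slitPlane) {t : ℝ} (ht : 0 ≤ t) :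
    ((t : ℂ) • 1 + c • Δ.onSmooth ^ n)
      * Δ.smoothCalculus (complexify Δ.specFun ^ n * resolventFun Δ.specFun n c t) = 1 := by
  have h : Commute (Δ.smoothCalculus (complexify Δ.specFun ^ n * resolventFun Δ.specFun n c t))
      ((t : ℂ) • 1 + c • Δ.onSmooth ^ n) :=
    Commute.add_right ((Commute.one_right _).smul_right _)
      (((Δ.commute_smoothCalculus _).pow_right n).smul_right c)
  rw [← h.eq, resolvent_mul_add n hc ht]

/-- The resolvent identity for twisted commutators: with `T₁ = Δⁿ T - ν T Δⁿ`,
`(t + c Δⁿ)⁻¹ T = T (t + c ν Δⁿ)⁻¹ - c (t + c Δⁿ)⁻¹ T₁ (t + c ν Δⁿ)⁻¹`. -/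
theorem sandwich_eq (a n : ℕ) {c ν : ℂ} (hc : c ∈ Complex.slitPlane)
    (hcν : c * ν ∈ Complex.slitPlane) (cs : List ℂ) (T : Module.End ℂ Δ.smooth) {t : ℝ}
    (ht : 0 ≤ t) :
    sandwich Δ a n c cs T t = Δ.onSmooth ^ a * T *
        Δ.smoothCalculus (complexify Δ.specFun ^ (n * (cs.length + 1)) *
          resolventProd Δ.specFun n (c * ν :: cs) t)
      + (-c) • sandwich Δ a n c (c * ν :: cs)
        (Δ.onSmooth ^ n * T - ν • (T * Δ.onSmooth ^ n)) t := by
  set R := Δ.smoothCalculus (complexify Δ.specFun ^ n * resolventFun Δ.specFun n c t) with hR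
  set Rν := Δ.smoothCalculus (complexify Δ.specFun ^ n * resolventFun Δ.specFun n (c * ν) t)
    with hRν
  set P := Δ.smoothCalculus
    (complexify Δ.specFun ^ (n * cs.length) * resolventProd Δ.specFun n cs t) with hP
  have hcons : Δ.smoothCalculus (complexify Δ.specFun ^ (n * (cs.length + 1)) *
      resolventProd Δ.specFun n (c * ν :: cs) t) = Rν * P := by
    rw [hRν, hP, ← map_mul, resolventProd_cons, mul_add, mul_one, pow_add]
    congr 1
    ring
  have h1 : R * ((t : ℂ) • 1 + c • Δ.onSmooth ^ n) = 1 := resolvent_mul_add n hc ht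
  have h2 : ((t : ℂ) • 1 + (c * ν) • Δ.onSmooth ^ n) * Rν = 1 := add_mul_resolvent n hcν ht
  have key : R * T = T * Rν - c • (R * (Δ.onSmooth ^ n * T - ν • (T * Δ.onSmooth ^ n)) * Rν) := by
    have e : c • (R * (Δ.onSmooth ^ n * T - ν • (T * Δ.onSmooth ^ n)) * Rν)
        = (R * ((t : ℂ) • 1 + c • Δ.onSmooth ^ n)) * T * Rν
          - R * T * (((t : ℂ) • 1 + (c * ν) • Δ.onSmooth ^ n) * Rν) := by
      simp only [mul_sub, sub_mul, mul_add, add_mul, smul_sub, mul_smul_comm, smul_mul_assoc,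
        smul_smul, one_mul, mul_one, mul_assoc]
      abel
    rw [e, h1, h2, one_mul, mul_one]
    abel
  have e1 : sandwich Δ a n c cs T t = Δ.onSmooth ^ a * (R * T) * P := by
    simp only [sandwich, mul_assoc, hR, hP]
  have e2 : sandwich Δ a n c (c * ν :: cs) (Δ.onSmooth ^ n * T - ν • (T * Δ.onSmooth ^ n)) t
      = Δ.onSmooth ^ a * (R * (Δ.onSmooth ^ n * T - ν • (T * Δ.onSmooth ^ n)) * Rν) * P := by
    rw [sandwich, List.length_cons, hcons]
    simp only [mul_assoc, hR]
  have e3 : ∀ S : Module.End ℂ Δ.smooth, (-c) • S = -(c • S) := fun S => neg_smul c S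
  rw [e1, e2, hcons, key, e3, ← sub_eq_add_neg, mul_sub, sub_mul, mul_smul_comm, smul_mul_assoc]
  simp only [mul_assoc]

/-- `t ↦ Tr (A Δᵃ (t + c Δⁿ)⁻¹ T ∏ (t + cᵢ Δⁿ)⁻¹)` is a well-defined function of `t > 0`, whose
Mellin transform has residue `res`. The trace is encoded by the functional `τ = Tr (A ·)`, which is
applied to the bounded extension of the operator. -/
def HasTraceResidue (Δ : AbstractLaplacian H) (τ : (H →L[ℂ] H) →L[ℂ] ℂ) (β : ℝ) (a n : ℕ) (c : ℂ)
    (cs : List ℂ) (T : Module.End ℂ Δ.smooth) (res : ℂ) : Prop :=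
  ∃ f : ℝ → ℂ, HasMellinResidue β f res ∧
    ∀ t, 0 < t → ∃ B : H →L[ℂ] H, ExtendsSmooth B (sandwich Δ a n c cs T t) ∧ f t = τ B

variable {τ : (H →L[ℂ] H) →L[ℂ] ℂ} {β : ℝ} {a n : ℕ} {c : ℂ} {cs : List ℂ}
  {T T' : Module.End ℂ Δ.smooth} {res res' : ℂ}

theorem HasTraceResidue.add (h : HasTraceResidue Δ τ β a n c cs T res)
    (h' : HasTraceResidue Δ τ β a n c cs T' res') :
    HasTraceResidue Δ τ β a n c cs (T + T') (res + res') := by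
  obtain ⟨f, hf, hB⟩ := h
  obtain ⟨f', hf', hB'⟩ := h'
  refine ⟨_, hf.add hf', fun t ht => ?_⟩
  obtain ⟨B, hB1, hB2⟩ := hB t ht
  obtain ⟨B', hB1', hB2'⟩ := hB' t ht
  exact ⟨B + B', by rw [sandwich_add]; exact hB1.add hB1', by rw [map_add, hB2, hB2']⟩

theorem HasTraceResidue.unique (hβ : 0 ≤ β) (hβ1 : β < 1)
    (h : HasTraceResidue Δ τ β a n c cs T res) (h' : HasTraceResidue Δ τ β a n c cs T res') :
    res = res' := by
  obtain ⟨f, hf, hB⟩ := h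
  obtain ⟨f', hf', hB'⟩ := h'
  refine hf.unique hβ hβ1 (hf'.congr fun t ht => ?_)
  obtain ⟨B, hB1, hB2⟩ := hB t ht
  obtain ⟨B', hB1', hB2'⟩ := hB' t ht
  rw [hB2, hB2', hB1.unique hB1']

/-- One step of the expansion, for residues: if the commutator term contributes no residue, then
only the term in which the resolvent has been moved past `T` counts. Of the powers of `Δ⁻¹` which
the resolvents provide, `e` make `Δᵃ T` bounded and `q` are left for convergence in `t`. -/
theorem HasTraceResidue.of_step {ν : ℂ} (hc : c ∈ Complex.slitPlane)
    (hcν : c * ν ∈ Complex.slitPlane) {e q : ℕ} (hq : q + e = n * (cs.length + 1))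
    {B₀ : H →L[ℂ] H} (hB₀ : ExtendsSmooth B₀ (Δ.onSmooth ^ a * T * Δ.invOnSmooth ^ e))
    (hmain : HasMellinResidue β (fun t => τ (B₀ * Δ.calculus (complexify Δ.specFun ^ q *
      resolventProd Δ.specFun n (c * ν :: cs) t))) res)
    (h : HasTraceResidue Δ τ β a n c (c * ν :: cs)
      (Δ.onSmooth ^ n * T - ν • (T * Δ.onSmooth ^ n)) 0) :
    HasTraceResidue Δ τ β a n c cs T res := by
  obtain ⟨f, hf, hB⟩ := h
  have hsum := hmain.add (hf.const_mul (-c))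
  rw [mul_zero, add_zero] at hsum
  refine ⟨_, hsum, fun t ht => ?_⟩
  obtain ⟨B, hB1, hB2⟩ := hB t ht
  refine ⟨B₀ * Δ.calculus (complexify Δ.specFun ^ q *
      resolventProd Δ.specFun n (c * ν :: cs) t) + (-c) • B, ?_, ?_⟩
  · rw [sandwich_eq a n hc hcν cs T ht.le]
    refine ExtendsSmooth.add ?_ (hB1.smul (-c))
    convert hB₀.mul (Δ.extendsSmooth_calculus (complexify Δ.specFun ^ q *
      resolventProd Δ.specFun n (c * ν :: cs) t)) using 1
    rw [← hq, AbstractLaplacian.invOnSmooth, ← map_pow, mul_assoc (_ * T) _ (Δ.smoothCalculus _),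
      ← map_mul, pow_add]
    congr 2
    ring
  · rw [map_add, map_smul, hB2, smul_eq_mul]

/-- The remainder contributes no residue. Once `Δᵃ T Δ⁻ᵉ` is bounded with `n` powers of `Δ⁻¹` to
spare, the resolvents on both sides of it decay like `t⁻¹` each. -/
theorem hasTraceResidue_zero_of_extendsSmooth (hβ : 0 ≤ β) (hn : 1 ≤ n) (hc : c ∈ Complex.slitPlane)
    (hcs : ∀ c' ∈ cs, c' ∈ Complex.slitPlane) {e : ℕ} (he : n + e = n * cs.length) (hne : cs ≠ [])
    {B₀ : H →L[ℂ] H} (hB₀ : ExtendsSmooth B₀ (Δ.onSmooth ^ a * T * Δ.invOnSmooth ^ e)) :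
    HasTraceResidue Δ τ β a n c cs T 0 := by
  have hc' : ∀ c' ∈ [c], c' ∈ Complex.slitPlane := by simpa using hc
  have hn1 : ((n : ℝ) / n) = 1 := div_self (by positivity)
  obtain ⟨C₁, h1, h1'⟩ := pow_mul_resolventProd_bounds Δ.specFun_nonneg hn le_rfl hc' (by simp)
  obtain ⟨C₂, h2, h2'⟩ := pow_mul_resolventProd_bounds Δ.specFun_nonneg hn le_rfl hcs hne
  rw [hn1] at h1' h2'
  have hC₁ : 0 ≤ C₁ := (norm_nonneg _).trans (h1 1 one_pos)
  have hC₂ : 0 ≤ C₂ := (norm_nonneg _).trans (h2 1 one_pos)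
  let F : ℝ → H →L[ℂ] H := fun t =>
    Δ.calculusL (complexify Δ.specFun ^ n * resolventProd Δ.specFun n [c] t) * B₀ *
      Δ.calculusL (complexify Δ.specFun ^ n * resolventProd Δ.specFun n cs t)
  have hF : ∀ t, ‖τ (F t)‖ ≤ ‖τ‖ *
      (‖complexify Δ.specFun ^ n * resolventProd Δ.specFun n [c] t‖ * ‖B₀‖
        * ‖complexify Δ.specFun ^ n * resolventProd Δ.specFun n cs t‖) := by
    intro t
    refine (τ.le_opNorm _).trans (mul_le_mul_of_nonneg_left ?_ (norm_nonneg _))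
    refine (norm_mul_le _ _).trans ?_
    refine mul_le_mul ((norm_mul_le _ _).trans ?_) (Δ.norm_calculus_le _) (norm_nonneg _)
      (by positivity)
    exact mul_le_mul_of_nonneg_right (Δ.norm_calculus_le _) (norm_nonneg _)
  refine ⟨fun t => τ (F t), hasMellinResidue_zero_of_bounded hβ (C := ‖τ‖ * (C₁ * ‖B₀‖ * C₂))
    ?_ (fun t ht => (hF t).trans ?_) (fun t ht => (hF t).trans ?_), fun t ht => ⟨F t, ?_, rfl⟩⟩
  · have hcc := continuousOn_resolventProd Δ.specFun_nonneg n hc'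
    have hccs := continuousOn_resolventProd Δ.specFun_nonneg n hcs
    refine τ.continuous.comp_continuousOn
      (ContinuousOn.mul (ContinuousOn.mul ?_ continuousOn_const) ?_)
    · exact Δ.calculusL.continuous.comp_continuousOn (continuousOn_const.mul hcc)
    · exact Δ.calculusL.continuous.comp_continuousOn (continuousOn_const.mul hccs)
  · gcongr
    · exact h1 t ht
    · exact h2 t ht
  · have e2 : ‖τ‖ * (C₁ * ‖B₀‖ * C₂) * t ^ (-(2 : ℝ))
        = ‖τ‖ * ((C₁ * t ^ (-(1 : ℝ))) * ‖B₀‖ * (C₂ * t ^ (-(1 : ℝ)))) := by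
      have : t ^ (-(2 : ℝ)) = t ^ (-(1 : ℝ)) * t ^ (-(1 : ℝ)) := by
        rw [← Real.rpow_add ht]; norm_num
      rw [this]; ring
    rw [e2]
    gcongr
    · exact h1' t ht
    · exact h2' t ht
  · convert ((Δ.extendsSmooth_calculus (complexify Δ.specFun ^ n *
      resolventProd Δ.specFun n [c] t)).mul hB₀).mul (Δ.extendsSmooth_calculus
        (complexify Δ.specFun ^ n * resolventProd Δ.specFun n cs t)) using 1
    · rfl
    have hcomm : Commute
        (Δ.smoothCalculus (complexify Δ.specFun ^ n * resolventFun Δ.specFun n c t))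
        (Δ.onSmooth ^ a) := (Δ.commute_smoothCalculus _).pow_right a
    have e3 : resolventProd Δ.specFun n [c] t = resolventFun Δ.specFun n c t := by
      simp [resolventProd]
    have e4 : Δ.smoothCalculus (complexify Δ.specFun ^ (n * cs.length) *
        resolventProd Δ.specFun n cs t) = Δ.invOnSmooth ^ e *
          Δ.smoothCalculus (complexify Δ.specFun ^ n * resolventProd Δ.specFun n cs t) := by
      rw [AbstractLaplacian.invOnSmooth, ← map_pow, ← map_mul, ← he, pow_add]
      congr 1
      ring
    rw [sandwich, e3, e4, ← hcomm.eq]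
    simp only [mul_assoc]

/-- All but finitely many of the directions `1 + i y` avoid the negative real axis after
multiplication by a given nonzero number. -/
theorem eventually_mul_mem_slitPlane {ν : ℂ} (hν : ν ≠ 0) :
    ∀ᶠ y : ℝ in cofinite, (1 + y * Complex.I) * ν ∈ Complex.slitPlane := by
  have hsub : Set.Subsingleton {y : ℝ | ¬ (1 + y * Complex.I) * ν ∈ Complex.slitPlane} := by
    have key : ∀ y : ℝ, (1 + y * Complex.I) * ν ∉ Complex.slitPlane →
        ν.im + y * ν.re = 0 ∧ ν.re - y * ν.im ≤ 0 := by
      intro y hy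
      rw [Complex.mem_slitPlane_iff, not_or, not_lt, not_not] at hy
      simpa [add_comm] using And.intro hy.2 hy.1
    intro y hy y' hy'
    obtain ⟨h1, h2⟩ := key y hy
    obtain ⟨h1', h2'⟩ := key y' hy'
    have h3 : (y - y') * ν.re = 0 := by linear_combination h1 - h1'
    rcases mul_eq_zero.mp h3 with h | h
    · linarith
    · exfalso
      rw [h, mul_zero, add_zero] at h1
      exact hν (Complex.ext h h1)
  exact hsub.finite

theorem one_add_mul_I_mem_slitPlane (y : ℝ) : (1 + y * Complex.I) ∈ Complex.slitPlane := by
  rw [Complex.mem_slitPlane_iff]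
  left
  simp

end Expansion

/-! ### Comparison of the residues -/

section Comparison

open Filter

variable {H : Type*} [NormedAddCommGroup H] [InnerProductSpace ℂ H] [CompleteSpace H]
variable {Δ : AbstractLaplacian H} {r : ℕ} {ρ : ModularOperator Δ}

theorem HasTraceResidue.zero {τ : (H →L[ℂ] H) →L[ℂ] ℂ} {β : ℝ} (hβ : 0 ≤ β) (a n : ℕ) (c : ℂ)
    (cs : List ℂ) : HasTraceResidue Δ τ β a n c cs 0 0 := by
  refine ⟨fun _ => 0, hasMellinResidue_zero_of_bounded hβ (C := 0) continuousOn_const (by simp)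
    (by simp), fun t _ => ⟨0, ?_, (map_zero τ).symm⟩⟩
  have : sandwich Δ a n c cs 0 t = 0 := by simp [sandwich]
  rw [this]
  exact extendsSmooth_zero

/-- The leading term of one step of the expansion of `Tr (ρ Y Δ⁻ᵃ · )`: its Mellin transform is
governed by the zeta function of `Y X`, and it has no residue when there are two or more
resolvents. -/
theorem hasMellinResidue_leadingTerm (D : TwistedDOAlgebra Δ r) (hr : r ≠ 0)
    {X Y : Module.End ℂ Δ.smooth} {a : ℕ} {A : H →L[ℂ] H}
    (hA : ExtendsSmooth A (ρ.onSmooth.toLinearMap * Y * Δ.invOnSmooth ^ a))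
    {τ : (H →L[ℂ] H) →L[ℂ] ℂ} (hτ : ∀ B, opTrace (A * B) = τ B)
    {Z : ℂ → ℂ} (hZ : IsZetaContinuation r ρ (Y * X) Z) {l d : ℕ} (hX : X ∈ D.filt l)
    (hld : l + r * a ≤ r * d) (i : ℕ) {n q : ℕ} (hq : 1 ≤ q) (hqn : q ≤ n) {res : ℂ}
    (hres : HasSimpleResidue Z (r * (q - n + d)) res) :
    ∃ B₀ : H →L[ℂ] H,
      ExtendsSmooth B₀ (Δ.onSmooth ^ a * (X * Δ.onSmooth ^ i) * Δ.invOnSmooth ^ (i + d)) ∧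
      ∀ cs : List ℂ, cs ≠ [] → (∀ c ∈ cs, c ∈ Complex.slitPlane) →
        HasMellinResidue (1 - (q : ℝ) / n)
          (fun t => τ (B₀ * Δ.calculus (complexify Δ.specFun ^ q * resolventProd Δ.specFun n cs t)))
          (if cs.length = 1 then res / (r * n) else 0) := by
  obtain ⟨B₀, hB₀⟩ := D.exists_extendsSmooth_opsOfOrder hr
    (D.onSmooth_pow_mul_mem (D.mem_opsOfOrder_of_mem_filt hX le_rfl) a) hld
  refine ⟨B₀, ?_, fun cs hne hcs => ?_⟩
  · rw [mul_assoc, mul_assoc X, Δ.onSmooth_pow_mul_invOnSmooth_pow_add, ← mul_assoc]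
    exact hB₀
  · let L : C(spectrum ℂ Δ.inv, ℂ) →L[ℂ] ℂ :=
      τ.comp ((ContinuousLinearMap.mul ℂ (H →L[ℂ] H) B₀).comp Δ.calculusL)
    obtain ⟨hZm, x₀, hx₀⟩ := hZ
    have hr0 : (0 : ℝ) < r := by exact_mod_cast Nat.pos_of_ne_zero hr
    obtain ⟨Z', hZ'm, hZZ', hL⟩ := exists_meromorphic_eq_functional_cpowFun
      (p := Δ.specFun) L hZm hr0 (d := d) ⟨x₀ / r, fun w hw hx => by
        have h1 := zetaFunction_mul_eq (ρ := ρ) hr hA hτ hB₀ hw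
        rw [div_lt_iff₀ hr0] at hx
        push_cast
        rw [hx₀ _ ?_, h1]
        · rfl
        · have : ((r : ℂ) * (w + d)).re = r * (w.re + d) := by
            rw [← Complex.ofReal_natCast, Complex.re_ofReal_mul]; simp
          rw [this]
          nlinarith [Nat.cast_nonneg (α := ℝ) d, mul_nonneg hr0.le (Nat.cast_nonneg (α := ℝ) d)]⟩
    push_cast at hL
    exact hasMellinResidue_resolventProd Δ.specFun_nonneg hq hqn hcs hne L hZ'm
      (r := r) (by exact_mod_cast hr) hL (hres.congr (hZZ' _))

/-- A term with at least one resolvent on the right contributes nothing to the residue. One step of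
the expansion raises the number `k` of resolvents on the right by one and the order `b` by at most
`r n - 1`, which keeps `b + k ≤ m + k r n`. The leading terms of these steps have `k + 1 ≥ 2`
resolvents, so they have no residue, and once `k ≥ m + r n + r a` the remainder decays. The
induction is on the number `j` of steps which are missing. The direction `1 + i y` of the resolvents
has to avoid finitely many values, for which a product with some `ν` is on the negative real axis.
-/
theorem eventually_hasTraceResidue_zero (D : TwistedDOAlgebra Δ r) (hr : r ≠ 0)
    (hdiag : IsDiagonalizableMap (V := D.alg) D.twist.toLinearMap)
    (hmero : ∀ X ∈ D.alg, ∃ Z : ℂ → ℂ, IsZetaContinuation r ρ X Z ∧ HasOnlySimplePoles Z)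
    {Y : Module.End ℂ Δ.smooth} (hY : Y ∈ D.alg) {a m n q : ℕ} (hq : 1 ≤ q) (hn : n = q + a + m)
    {A : H →L[ℂ] H} (hA : ExtendsSmooth A (ρ.onSmooth.toLinearMap * Y * Δ.invOnSmooth ^ a))
    {τ : (H →L[ℂ] H) →L[ℂ] ℂ} (hτ : ∀ B, opTrace (A * B) = τ B) (j : ℕ) :
    ∀ (νs : List ℂ) (b : ℕ) (T : Module.End ℂ Δ.smooth), νs ≠ [] → (∀ ν ∈ νs, ν ≠ 0) →
      T ∈ D.opsOfOrder b → b + νs.length ≤ m + νs.length * (r * n) →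
      m + r * n + r * a ≤ νs.length + j →
      ∀ᶠ y : ℝ in cofinite, HasTraceResidue Δ τ (1 - (q : ℝ) / n) a n (1 + y * Complex.I)
        (νs.map ((1 + y * Complex.I) * ·)) T 0 := by
  have hn0 : (0 : ℝ) < n := by exact_mod_cast (by omega : 0 < n)
  have hβ : 0 ≤ 1 - (q : ℝ) / n := by
    rw [sub_nonneg, div_le_one hn0]; exact_mod_cast (by omega : q ≤ n)
  have hslit : ∀ νs : List ℂ, (∀ ν ∈ νs, ν ≠ 0) → ∀ᶠ y : ℝ in cofinite,
      ∀ c ∈ νs.map ((1 + y * Complex.I) * ·), c ∈ Complex.slitPlane := by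
    intro νs h0
    have : ∀ᶠ y : ℝ in cofinite, ∀ ν ∈ {ν | ν ∈ νs}, (1 + y * Complex.I) * ν ∈ Complex.slitPlane :=
      (eventually_all_finite νs.finite_toSet).mpr fun ν hν => eventually_mul_mem_slitPlane (h0 ν hν)
    filter_upwards [this] with y hy
    simpa using hy
  induction j with
  | zero =>
    intro νs b T hne h0 hT hb hN
    have hlen : 1 ≤ νs.length := List.length_pos_iff.mpr hne
    obtain ⟨k, hk⟩ := Nat.exists_eq_add_of_le hlen
    have hord : b + r * a ≤ r * (n * k) := by
      have : (1 + k) * (r * n) = r * n + r * (n * k) := by ring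
      rw [hk] at hb hN
      omega
    obtain ⟨B₀, hB₀⟩ := D.exists_extendsSmooth_opsOfOrder hr (D.onSmooth_pow_mul_mem hT a) hord
    filter_upwards [hslit νs h0] with y hy
    exact hasTraceResidue_zero_of_extendsSmooth hβ (by omega) (one_add_mul_I_mem_slitPlane y) hy
      (by rw [List.length_map, hk]; ring) (by simpa using hne) hB₀
  | succ j ih =>
    intro νs b T hne h0 hT hb hN
    refine D.opsOfOrder_induction hdiag (b := b) (P := fun T => ∀ᶠ y : ℝ in cofinite,
      HasTraceResidue Δ τ (1 - (q : ℝ) / n) a n (1 + y * Complex.I)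
        (νs.map ((1 + y * Complex.I) * ·)) T 0) ?_ ?_ ?_ hT
    · exact Eventually.of_forall fun y => HasTraceResidue.zero hβ _ _ _ _
    · intro T T' h h'
      filter_upwards [h, h'] with y hy hy'
      simpa using hy.add hy'
    · intro X μ l i hX hli hμ0 hμ
      set ν : ℂ := (μ ^ r) ^ n with hν
      have hν0 : ν ≠ 0 := pow_ne_zero _ (pow_ne_zero _ hμ0)
      have h0' : ∀ ν' ∈ ν :: νs, ν' ≠ 0 := by
        simpa using And.intro hν0 h0
      have hlen : 1 ≤ νs.length := List.length_pos_iff.mpr hne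
      have hT₁ := D.mul_onSmooth_pow_mem (D.onSmooth_pow_mul_sub_mem hr (by omega : 1 ≤ n) hX hμ) i
      have hrn : 1 ≤ r * n := Nat.mul_pos (Nat.pos_of_ne_zero hr) (by omega)
      have hrm : m ≤ r * m := Nat.le_mul_of_pos_left m (Nat.pos_of_ne_zero hr)
      have hind := ih (ν :: νs) (b + r * n - 1) _ (by simp) h0'
        (D.opsOfOrder_mono (by omega : l + r * n - 1 + r * i ≤ b + r * n - 1) hT₁)
        (by
          have : (νs.length + 1) * (r * n) = νs.length * (r * n) + r * n := by ring
          rw [List.length_cons]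
          omega)
        (by rw [List.length_cons]; omega)
      -- the exponent of `Δ⁻¹` which leaves exactly `q` powers for the resolvents
      have hre : l + r * i + r * a ≤ r * (n * νs.length + a + m) := by
        have : r * (n * νs.length + a + m) = νs.length * (r * n) + r * a + r * m := by ring
        omega
      have hie : i ≤ n * νs.length + a + m :=
        Nat.le_of_mul_le_mul_left (by omega : r * i ≤ _) (Nat.pos_of_ne_zero hr)
      obtain ⟨d, hd⟩ := Nat.exists_eq_add_of_le hie
      rw [hd, mul_add] at hre
      obtain ⟨Z, hZ, hZs⟩ := hmero (Y * X) (D.alg.mul_mem hY X.2)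
      obtain ⟨res, hres⟩ := hZs.exists_hasSimpleResidue hZ.1 (r * (q - n + d))
      obtain ⟨B₀, hB₀, hB₀'⟩ := hasMellinResidue_leadingTerm D hr hA hτ hZ hX
        (by omega : l + r * a ≤ r * d) i hq (by omega) hres
      filter_upwards [hind, hslit _ h0'] with y hy hsl
      rw [List.map_cons] at hy hsl
      have hmain := hB₀' _ (by simp) hsl
      rw [if_neg (by rw [List.length_cons, List.length_map]; omega)] at hmain
      refine HasTraceResidue.of_step (one_add_mul_I_mem_slitPlane y) (hsl _ (by simp))
        (e := i + d) ?_ hB₀ hmain ?_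
      · rw [List.length_map, ← hd, hn]; ring
      · convert hy using 1
        rw [sub_mul, smul_mul_assoc, mul_assoc, mul_assoc, mul_assoc, ← pow_add, ← pow_add,
          add_comm i n]

/-- The expansion of `Tr (ρ Y (t + c Δⁿ)⁻¹ X)` to the right of `X`: only its first term, with a
single resolvent, has a residue, which is that of the zeta function of `Y X`. -/
theorem eventually_hasTraceResidue_left (D : TwistedDOAlgebra Δ r) (hr : r ≠ 0)
    (hdiag : IsDiagonalizableMap (V := D.alg) D.twist.toLinearMap)
    (hmero : ∀ X ∈ D.alg, ∃ Z : ℂ → ℂ, IsZetaContinuation r ρ X Z ∧ HasOnlySimplePoles Z)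
    {Φ : D.alg →ₗ[ℂ] ℂ} (hΦ : ∀ (X : D.alg) (Z : ℂ → ℂ),
      IsZetaContinuation r ρ (X : Module.End ℂ Δ.smooth) Z → HasSimpleResidue Z 0 (Φ X))
    (Y : D.alg) {a m n q : ℕ} (hq : 1 ≤ q) (hn : n = q + a + m)
    {A : H →L[ℂ] H} (hA : ExtendsSmooth A
      (ρ.onSmooth.toLinearMap * (Y : Module.End ℂ Δ.smooth) * Δ.invOnSmooth ^ a))
    {τ : (H →L[ℂ] H) →L[ℂ] ℂ} (hτ : ∀ B, opTrace (A * B) = τ B) {X : D.alg}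
    (hX : (X : Module.End ℂ Δ.smooth) ∈ D.filt m) :
    ∀ᶠ y : ℝ in cofinite, HasTraceResidue Δ τ (1 - (q : ℝ) / n) a n (1 + y * Complex.I) []
      X (Φ (Y * X) / (r * n)) := by
  have hn0 : (0 : ℝ) < n := by exact_mod_cast (by omega : 0 < n)
  have hβ : 0 ≤ 1 - (q : ℝ) / n := by
    rw [sub_nonneg, div_le_one hn0]; exact_mod_cast (by omega : q ≤ n)
  have key := D.filt_induction hdiag (l := m) (P := fun X => ∀ hX : X ∈ D.alg,
    ∀ᶠ y : ℝ in cofinite, HasTraceResidue Δ τ (1 - (q : ℝ) / n) a n (1 + y * Complex.I) []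
      X (Φ (Y * ⟨X, hX⟩) / (r * n))) ?_ ?_ ?_ hX
  · exact key X.2
  · intro h
    have e : (⟨0, h⟩ : D.alg) = 0 := rfl
    rw [e, mul_zero, map_zero, zero_div]
    exact Eventually.of_forall fun y => HasTraceResidue.zero hβ _ _ _ _
  · intro X X' hX hX' h h' hXX'
    have e : (⟨X + X', hXX'⟩ : D.alg)
        = ⟨X, D.mem_alg_of_mem_filt hX⟩ + ⟨X', D.mem_alg_of_mem_filt hX'⟩ := rfl
    rw [e, mul_add, map_add, add_div]
    filter_upwards [h (D.mem_alg_of_mem_filt hX), h' (D.mem_alg_of_mem_filt hX')] with y hy hy'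
    exact hy.add hy'
  · intro X μ hX hμ0 hμ _
    obtain ⟨Z, hZ, -⟩ := hmero (Y * X) (D.alg.mul_mem Y.2 X.2)
    have hres : HasSimpleResidue Z (r * (q - n + (a + m : ℕ))) (Φ (Y * X)) := by
      have e : (r : ℂ) * (q - n + (a + m : ℕ)) = 0 := by rw [hn]; push_cast; ring
      rw [e]
      exact hΦ (Y * X) Z hZ
    have hrm : m ≤ r * m := Nat.le_mul_of_pos_left m (Nat.pos_of_ne_zero hr)
    obtain ⟨B₀, hB₀, hB₀'⟩ := hasMellinResidue_leadingTerm D hr hA hτ hZ hX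
      (by rw [mul_add]; omega : m + r * a ≤ r * (a + m)) 0 hq (by omega) hres
    have hν0 : (μ ^ r) ^ n ≠ 0 := pow_ne_zero _ (pow_ne_zero _ hμ0)
    have hrn : 1 ≤ r * n := Nat.mul_pos (Nat.pos_of_ne_zero hr) (by omega)
    have hrest := eventually_hasTraceResidue_zero D hr hdiag hmero Y.2 hq hn hA hτ
      (m + r * n + r * a) [(μ ^ r) ^ n] _ _ (by simp) (by simpa using hν0)
      (D.onSmooth_pow_mul_sub_mem hr (by omega : 1 ≤ n) hX hμ) (by simp; omega) (by simp)
    filter_upwards [hrest, eventually_mul_mem_slitPlane hν0] with y hy hsl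
    have hmain := hB₀' [(1 + y * Complex.I) * (μ ^ r) ^ n] (by simp) (by simpa using hsl)
    rw [if_pos (by simp)] at hmain
    refine HasTraceResidue.of_step (one_add_mul_I_mem_slitPlane y) hsl (e := a + m) ?_ ?_ hmain hy
    · rw [hn]; simp; ring
    · simpa using hB₀

/-- The same trace `Tr (ρ Y (t + c Δⁿ)⁻¹ ρ X ρ⁻¹)`, without any expansion: its Mellin transform
replaces the resolvent by a complex power of `Δ`, and `Tr (ρ Y Δ⁻ˢ ρ X ρ⁻¹) = Tr (ρ X Y Δ⁻ˢ)`, so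
that the residue is that of the zeta function of `X Y`. -/
theorem hasTraceResidue_right (D : TwistedDOAlgebra Δ r) (hr : r ≠ 0) {X Y : D.alg}
    (htrace : ∀ X ∈ D.alg, ∃ x₀ : ℝ, ∀ z : ℂ, x₀ < z.re →
      IsTraceClassOnSmooth (zetaOperator r ρ X z))
    {Z : ℂ → ℂ} (hZ : IsZetaContinuation r ρ (X * Y : D.alg) Z) {res : ℂ}
    (hres : HasSimpleResidue Z 0 res)
    {a m n q : ℕ} (hq : 1 ≤ q) (hn : n = q + a + m)
    {A : H →L[ℂ] H} (hA : ExtendsSmooth A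
      (ρ.onSmooth.toLinearMap * (Y : Module.End ℂ Δ.smooth) * Δ.invOnSmooth ^ a))
    {τ : (H →L[ℂ] H) →L[ℂ] ℂ} (hτ : ∀ B, opTrace (A * B) = τ B)
    (hX : ρ.conj X ∈ D.filt m) {c : ℂ} (hc : c ∈ Complex.slitPlane) :
    HasTraceResidue Δ τ (1 - (q : ℝ) / n) a n c [] (ρ.conj X) (res / (r * n)) := by
  obtain ⟨B, hB⟩ := D.exists_extendsSmooth_left hr hX
  obtain ⟨x₁, hx₁⟩ := zetaFunction_mul_eq_twisted hr hA hτ hB (htrace Y Y.2)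
    (htrace _ (D.alg.mul_mem X.2 Y.2))
  obtain ⟨hZm, x₀, hx₀⟩ := hZ
  let L : C(spectrum ℂ Δ.inv, ℂ) →L[ℂ] ℂ :=
    τ.comp (((ContinuousLinearMap.mul ℂ (H →L[ℂ] H)).flip B).comp Δ.calculusL)
  have hr0 : (0 : ℝ) < r := by exact_mod_cast Nat.pos_of_ne_zero hr
  obtain ⟨Z', hZ'm, hZZ', hL⟩ := exists_meromorphic_eq_functional_cpowFun
    (p := Δ.specFun) L hZm hr0 (d := a + m) ⟨max x₁ (x₀ / r), fun w hw hx => by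
      rw [max_lt_iff, div_lt_iff₀ hr0] at hx
      have h1 := hx₁ w hw hx.1
      push_cast
      rw [hx₀ _ ?_]
      · exact h1
      · have : ((r : ℂ) * (w + (a + m))).re = r * (w.re + (a + m)) := by
          rw [← Complex.ofReal_natCast, Complex.re_ofReal_mul]; simp
        rw [this]
        nlinarith [hx.2, mul_nonneg hr0.le (Nat.cast_nonneg (α := ℝ) (a + m)),
          Nat.cast_add (R := ℝ) a m]⟩
  push_cast at hL
  have hres' : HasSimpleResidue Z' (r * (q - n + (a + m))) res := by
    have e : (r : ℂ) * (q - n + (a + m)) = 0 := by rw [hn]; push_cast; ring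
    rw [e]
    exact hres.congr (hZZ' _)
  have hM := hasMellinResidue_resolventProd Δ.specFun_nonneg hq (by omega : q ≤ n) (cs := [c])
    (by simpa using hc) (by simp) L hZ'm (r := r) (by exact_mod_cast hr) hL hres'
  rw [if_pos (by simp)] at hM
  refine ⟨_, hM, fun t _ => ⟨_, ?_, rfl⟩⟩
  convert (Δ.extendsSmooth_calculus (complexify Δ.specFun ^ q *
    resolventProd Δ.specFun n [c] t)).mul hB using 1
  · rfl
  have e3 : resolventProd Δ.specFun n [c] t = resolventFun Δ.specFun n c t := by
    simp [resolventProd]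
  have e4 : resolventProd Δ.specFun n [] t = 1 := by simp [resolventProd]
  have e5 : Δ.smoothCalculus (complexify Δ.specFun ^ n * resolventFun Δ.specFun n c t)
      = Δ.invOnSmooth ^ a * Δ.smoothCalculus (complexify Δ.specFun ^ q *
          resolventFun Δ.specFun n c t) * Δ.invOnSmooth ^ m := by
    rw [AbstractLaplacian.invOnSmooth, ← map_pow, ← map_pow, ← map_mul, ← map_mul, hn]
    congr 1
    ring
  rw [sandwich, e3, e4, e5]
  simp only [← mul_assoc, Δ.onSmooth_pow_mul_invOnSmooth_pow, List.length_nil, mul_zero, pow_zero,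
    mul_one, map_one, one_mul]

end Comparison

end

theorem mainTheorem4 {H : Type*} [NormedAddCommGroup H] [InnerProductSpace ℂ H] [CompleteSpace H]
    (Δ : AbstractLaplacian H) (r : ℕ) (hr : 2 ≤ r)
    (D : TwistedDOAlgebra Δ r)
    (hdiag : IsDiagonalizableMap (V := D.alg) D.twist.toLinearMap)
    (ρ : ModularOperator Δ)
    (hρ : ∀ X ∈ D.alg, ρ.conj X ∈ D.alg)
    (htrace : ∀ X ∈ D.alg, ∃ x₀ : ℝ, ∀ z : ℂ, x₀ < z.re →
      IsTraceClassOnSmooth (zetaOperator r ρ X z))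
    (hmero : ∀ X ∈ D.alg, ∃ Z : ℂ → ℂ, IsZetaContinuation r ρ X Z ∧ HasOnlySimplePoles Z) :
    ∃ Φ : D.alg →ₗ[ℂ] ℂ,
      (∀ (X : D.alg) (Z : ℂ → ℂ), IsZetaContinuation r ρ (X : Module.End ℂ Δ.smooth) Z →
        IsResidueAt Z 0 (Φ X)) ∧
      ∀ X Y : D.alg, Φ (X * Y) = Φ (Y * ⟨ρ.conj X, hρ X X.2⟩) := by
  have hr0 : r ≠ 0 := by omega
  obtain ⟨Φ, hΦ⟩ := exists_residueFunctional D htrace hmero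
  refine ⟨Φ, fun X Z hZ => (hΦ X Z hZ).isResidueAt (hZ.1 0), fun X Y => ?_⟩
  obtain ⟨m, hm⟩ := (D.mem_alg_iff _).mp (hρ X X.2)
  obtain ⟨a, A, hA, hAtr⟩ := (eventually_isTraceClassOnSmooth hr0 (htrace Y Y.2)).exists
  obtain ⟨τ, hτ⟩ := hAtr.exists_functional
  obtain ⟨Z, hZ, -⟩ := hmero _ (X * Y).2
  -- For `n = 1 + a + m` the resolvent of `Δⁿ` provides the powers `Δ⁻ᵃ` and `Δ⁻ᵐ`, which make the
  -- trace converge, and one more for the convergence of the Mellin integral.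
  obtain ⟨y, hy⟩ := (eventually_hasTraceResidue_left D hr0 hdiag hmero hΦ Y (q := 1) le_rfl rfl hA
    (fun B => (hτ B).2.1) (X := ⟨ρ.conj X, hρ X X.2⟩) hm).exists
  have h2 := hasTraceResidue_right D hr0 htrace hZ (hΦ _ Z hZ) (q := 1) le_rfl rfl hA
    (fun B => (hτ B).2.1) hm (one_add_mul_I_mem_slitPlane y)
  have hn0 : (0 : ℝ) < (1 + a + m : ℕ) := by exact_mod_cast (by omega : 0 < 1 + a + m)
  have h3 := h2.unique (by
    rw [sub_nonneg, div_le_one hn0]; exact_mod_cast (by omega : 1 ≤ 1 + a + m))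
    (by rw [sub_lt_self_iff]; positivity) hy
  have hrn : ((r : ℂ) * ((1 + a + m : ℕ) : ℂ)) ≠ 0 :=
    mul_ne_zero (by exact_mod_cast hr0) (by exact_mod_cast hn0.ne')
  exact (div_left_inj' hrn).mp h3
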